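/- A self-deleting graph is a pair $(G,f)$ of a finite simple graph $G=(V,E)$ and a function $f\colon V\to 2^E$; put $\mu=\max_{v\in V}|f(v)|$. A path $(v_1,e_1,v_2,\ldots,e_{k-1},v_k)$ in $G$ is $f$-conforming if $e_i\notin f(v_j)$ whenever $j\le i$. The problem Self-Deleting $s$-$t$-path asks, given $(G,f)$ and $s,t\in V$, whether $G$ has an $f$-conforming $s$-$t$ path. Let $\mathrm{fen}$ be the minimum number of edges of $G$ whose deletion leaves a forest, and $\mathrm{vcn}$ the vertex cover number of $G$. A kernel for the problem with parameter $\kappa$ on a class of graphs is a polynomial-time algorithm that maps every instance $x$ on a graph of the class to an equivalent instance $x'$ on a graph of the class such that the encoding length of $x'$ plus $\kappa(x')$ is bounded by a function of $\kappa(x)$. A Turing kernel is a polynomial-time algorithm that decides every instance $x$ on a graph of the class with the help of an oracle that decides the problem for instances $y$ on graphs of the class for which the encoding length of $y$ plus $\kappa(y)$ is bounded by a function of $\kappa(x)$; the number of vertices of a (Turing) kernel is the bound, in terms of $\kappa(x)$, on the number of vertices of $x'$ (of the queried instances $y$). Self-Deleting $s$-$t$-path admits (a) a kernel with at most $8\,\mathrm{fen}+4$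 vertices and $O(\mathrm{fen}+1)$ edges, for the parameter $\mathrm{fen}$ on all graphs; (b) a kernel with $O(\mathrm{vcn}+1)$ vertices and edges, for the parameter $\mathrm{vcn}$ on outerplanar graphs; (c) a Turing kernel with $O(\mu+1)$ vertices, for the parameter $\mu$ on cliques (complete graphs). In all three cases the bound on encoding length plus parameter can be taken to be a polynomial. -/

import Mathlib

namespace SelfDeleting

/-! ### A computation model with a step count

Programs act on finite binary trees. Every elementary step costs one plus the size of the tree it is
applied to (logarithmic-cost accounting), so running times agree, up to a polynomial, with those of
multitape (oracle) Turing machines. -/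

/-- Finite binary trees, the data that programs work on. -/
inductive Data : Type
  | nil : Data
  | cons : Data → Data → Data

namespace Data

/-- The size of a tree: its number of nodes. -/
def size : Data → ℕ
  | nil => 1
  | cons a b => a.size + b.size + 1

/-- Truth values: `nil` is false, every other tree counts as true. -/
def ofBool : Bool → Data
  | false => nil
  | true => cons nil nil

/-- Natural numbers in unary. -/
def ofNat : ℕ → Data
  | 0 => nil
  | n + 1 => cons nil (ofNat n)

/-- Lists. -/
def ofList : List Data → Data
  | [] => nil
  | a :: l => cons a (ofList l)

/-- Left subtree (`nil` for the empty tree). -/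
def left : Data → Data
  | nil => nil
  | cons a _ => a

/-- Right subtree (`nil` for the empty tree). -/
def right : Data → Data
  | nil => nil
  | cons _ b => b

/-- A Boolean `m × n` matrix, as the list of its rows. -/
def ofMatrix {m n : ℕ} (M : Fin m → Fin n → Bool) : Data :=
  ofList (List.ofFn fun i => ofList (List.ofFn fun j => ofBool (M i j)))

end Data

/-- Programs. -/
inductive Prog : Type
  /-- return the input -/
  | skip : Prog
  /-- return `nil` -/
  | empty : Prog
  /-- return the left subtree of the input -/
  | fst : Prog
  /-- return the right subtree of the input -/
  | snd : Prog
  /-- test the two subtrees of the input for equality -/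
  | eq : Prog
  /-- run both programs on the input and pair the results -/
  | pair : Prog → Prog → Prog
  /-- run the first program on the input, then the second one on its result -/
  | seq : Prog → Prog → Prog
  /-- run the second program on the input if the first one returns true, and the third one if not -/
  | cond : Prog → Prog → Prog → Prog
  /-- as long as the first program returns true, replace the input by the result of the second -/
  | loop : Prog → Prog → Prog
  /-- ask the oracle about the input -/
  | query : Prog

open Classical in
/-- `Run O p d r t`: started on `d`, the program `p` halts with result `r` after `t` steps, where the
oracle answers a query `q` with the bit `b` if `O q b` (a query without an answer blocks the
computation). -/
inductive Run (O : Data → Bool → Prop) : Prog → Data → Data → ℕ → Prop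
  | skip (d : Data) : Run O .skip d d (1 + d.size)
  | empty (d : Data) : Run O .empty d .nil (1 + d.size)
  | fst (d : Data) : Run O .fst d d.left (1 + d.size)
  | snd (d : Data) : Run O .snd d d.right (1 + d.size)
  | eq (d : Data) : Run O .eq d (.ofBool (decide (d.left = d.right))) (1 + d.size)
  | pair {p q : Prog} {d a b : Data} {t u : ℕ} :
      Run O p d a t → Run O q d b u → Run O (.pair p q) d (.cons a b) (1 + d.size + t + u)
  | seq {p q : Prog} {d e r : Data} {t u : ℕ} :
      Run O p d e t → Run O q e r u → Run O (.seq p q) d r (1 + d.size + t + u)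
  | cond_true {p q r : Prog} {d b e : Data} {t u : ℕ} :
      Run O p d b t → b ≠ .nil → Run O q d e u → Run O (.cond p q r) d e (1 + d.size + t + u)
  | cond_false {p q r : Prog} {d e : Data} {t u : ℕ} :
      Run O p d .nil t → Run O r d e u → Run O (.cond p q r) d e (1 + d.size + t + u)
  | loop_done {p q : Prog} {d : Data} {t : ℕ} :
      Run O p d .nil t → Run O (.loop p q) d d (1 + d.size + t)
  | loop_step {p q : Prog} {d b e r : Data} {t u v : ℕ} :
      Run O p d b t → b ≠ .nil → Run O q d e u → Run O (.loop p q) e r v →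
      Run O (.loop p q) d r (1 + d.size + t + u + v)
  | query {d : Data} {b : Bool} : O d b → Run O .query d (.ofBool b) (1 + d.size)

/-- The oracle that answers no query: ordinary computation. -/
def noOracle : Data → Bool → Prop := fun _ _ => False

/-! ### Graph parameters and outerplanarity -/

/-- The feedback edge number: the smallest number of edges whose deletion leaves a forest. -/
noncomputable def feedbackEdgeNumber {V : Type*} (G : SimpleGraph V) : ℕ :=
  sInf {k | ∃ F : Finset (Sym2 V), (F : Set (Sym2 V)) ⊆ G.edgeSet ∧
    (G.deleteEdges (F : Set (Sym2 V))).IsAcyclic ∧ F.card = k}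

/-- A graph is outerplanar if it can be drawn in the plane with its vertices as distinct points of a
circle and its edges as pairwise non-crossing straight chords of that circle. -/
def IsOuterplanar {V : Type*} (G : SimpleGraph V) : Prop :=
  ∃ pos : V → ℂ, Function.Injective pos ∧ (∀ v, ‖pos v‖ = 1) ∧
    ∀ a b c d : V, G.Adj a b → G.Adj c d → s(a, b) ≠ s(c, d) →
      Disjoint (openSegment ℝ (pos a) (pos b)) (openSegment ℝ (pos c) (pos d))

/-! ### The problem -/

/-- An instance `(G, f, s, t)`, with vertex set `Fin n`. -/
structure Instance : Type where
  n : ℕ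
  G : SimpleGraph (Fin n)
  f : Fin n → Finset (Sym2 (Fin n))
  f_subset : ∀ v, (f v : Set (Sym2 (Fin n))) ⊆ G.edgeSet
  s : Fin n
  t : Fin n

/-- The walk `v₀, e₀, v₁, e₁, …` is `f`-conforming: `e i ∉ f (v j)` for all `j ≤ i`. -/
def IsConforming {V : Type*} {G : SimpleGraph V} (f : V → Finset (Sym2 V)) {u v : V}
    (p : G.Walk u v) : Prop :=
  ∀ i j : ℕ, j ≤ i → i < p.length → s(p.getVert i, p.getVert (i + 1)) ∉ f (p.getVert j)

namespace Instance

/-- Yes-instances: there is an `f`-conforming `s`-`t` path. -/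
def IsYes (x : Instance) : Prop :=
  ∃ p : x.G.Walk x.s x.t, p.IsPath ∧ IsConforming x.f p

/-- The number of edges. -/
noncomputable def numEdges (x : Instance) : ℕ := x.G.edgeSet.ncard

open Classical in
/-- The encoding of an instance as the list of `n`, `s`, `t` (in unary), the adjacency matrix, and for
each vertex `v` the adjacency matrix of the edge set `f v`. -/
noncomputable def encode (x : Instance) : Data :=
  .ofList [.ofNat x.n, .ofNat x.s, .ofNat x.t,
    .ofMatrix fun i j => decide (x.G.Adj i j),
    .ofList (List.ofFn fun v => .ofMatrix fun i j => decide (s(i, j) ∈ x.f v))]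

/-- The length of the encoding. -/
noncomputable def size (x : Instance) : ℕ := x.encode.size

/-- The parameter `fen`. -/
noncomputable def fen (x : Instance) : ℕ := feedbackEdgeNumber x.G

/-- The parameter `vcn`, the vertex cover number. -/
noncomputable def vcn (x : Instance) : ℕ := x.G.vertexCoverNum.toNat

/-- The parameter `μ`, the maximum size of a deletion set. -/
def mu (x : Instance) : ℕ := Finset.univ.sup fun v => (x.f v).card

end Instance

/-! ### Kernels and Turing kernels -/

/-- On the class `C` of instances, the problem parameterized by `κ` has a kernel with at most `N k`
vertices and at most `M k` edges, where `k` is the parameter of the input: a polynomial-time program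
that maps every instance in `C` to an equivalent one in `C`. The total size of the output and its
parameter are bounded in terms of `k` alone, moreover by a polynomial `g`. The program does not need
the value of the parameter. -/
def HasKernel (C : Instance → Prop) (κ : Instance → ℕ) (N M : ℕ → ℕ) : Prop :=
  ∃ (prog : Prog) (p g : Polynomial ℕ), ∀ x : Instance, C x →
    ∃ (x' : Instance) (time : ℕ),
      Run noOracle prog x.encode x'.encode time ∧
      time ≤ p.eval (x.size + κ x) ∧
      C x' ∧ (x'.IsYes ↔ x.IsYes) ∧
      x'.size + κ x' ≤ g.eval (κ x) ∧
      x'.n ≤ N (κ x) ∧ x'.numEdges ≤ M (κ x)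

/-- The oracle that decides the problem for those instances in `C` that have at most `N` vertices and
for which encoding length and parameter add up to at most `B`. It answers no other query. -/
def boundedOracle (C : Instance → Prop) (κ : Instance → ℕ) (N B : ℕ) : Data → Bool → Prop :=
  fun q b => ∃ y : Instance, q = y.encode ∧ C y ∧ y.n ≤ N ∧ y.size + κ y ≤ B ∧ (b = true ↔ y.IsYes)

/-- On the class `C` of instances, the problem parameterized by `κ` has a Turing kernel with at most
`N k` vertices: a polynomial-time oracle program that decides every instance in `C` with parameter
`k`, asking the oracle only about instances in `C` that have at most `N k` vertices and whose total
size and parameter are bounded in terms of `k` alone, moreover by a polynomial `g`. -/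
def HasTuringKernel (C : Instance → Prop) (κ : Instance → ℕ) (N : ℕ → ℕ) : Prop :=
  ∃ (prog : Prog) (p g : Polynomial ℕ), ∀ x : Instance, C x →
    ∃ (answer : Bool) (time : ℕ),
      Run (boundedOracle C κ (N (κ x)) (g.eval (κ x))) prog x.encode (.ofBool answer) time ∧
      time ≤ p.eval (x.size + κ x) ∧
      (answer = true ↔ x.IsYes)

end SelfDeleting

/-! ### Functions computable in polynomial time. -/

namespace SelfDeleting

/-! Each of the three algorithms rests on a remark about which vertices a conforming path can visit.

Cliques: let s, v, ... be a shortest conforming path. If s does not delete the edge su for some u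
after v, then jumping from s straight to u gives a shorter conforming path, because the rest is a
suffix and leaving out vertices only removes constraints. So every vertex after v is joined to s by
an edge of f(s), and there are at most μ of these (`exists_isPathList_of_clique`). For every v the
oracle is asked about the clique on s, t, v and these vertices; the answer is the disjunction.

Outerplanar graphs: an inner vertex of a path has two neighbours, so vertices other than s and t
with at most one neighbour can be dropped. With the vertices on a line and non-crossing edges above
it, at most 3 vcn vertices outside a vertex cover have two neighbours (`NonCrossing.card_le`), and
there are at most twice as many edges as vertices (`NonCrossing.ncard_edgeSet_le`).

Feedback edge number: edges at vertices of degree one are deleted, and for adjacent x, y with at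
most two neighbours each, the path x, y, w is replaced by an edge xw, where x acts for y as well
(`hasPath_contract_iff`); s and t are exempt from both rules. One vertex can do the work of two
because a deletion by x matters only for edges used after x. What x deletes on xw counts only for
paths that leave towards w, and what x deletes on its other edge counts only for paths that come
from w, so the two directions of travel are recorded independently. Both rules preserve `Sparse`:
every vertex set S spans at most |S| - 1 + fen edges. When no rule applies, the inner vertices of
degree two are pairwise non-adjacent and all other inner vertices have degree at least three, and a
degree count leaves at most 5 fen + 3 vertices (`Sparse.card_le`, `Instance.card_fenKeep_le`).

The algorithms are functions on the encodings `Raw`. Their running time follows from the closure of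
`PolyFn` under composition, branching and folds with small intermediate results; their correctness
is proved separately for `Instance`. -/

theorem eval_mono (p : Polynomial ℕ) {m n : ℕ} (h : m ≤ n) : p.eval m ≤ p.eval n := by
  induction p using Polynomial.induction_on' with
  | add p q hp hq => simpa using add_le_add hp hq
  | monomial k a => simpa using Nat.mul_le_mul_left a (Nat.pow_le_pow_left h k)

theorem Data.size_pos (d : Data) : 1 ≤ d.size := by cases d <;> simp [Data.size]

theorem Data.size_left_le (d : Data) : d.left.size ≤ d.size := by
  cases d <;> simp [Data.size, Data.left]; omega

theorem Data.size_right_le (d : Data) : d.right.size ≤ d.size := by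
  cases d <;> simp [Data.size, Data.right]; omega

theorem Data.size_ofBool_le (b : Bool) : (Data.ofBool b).size ≤ 3 := by
  cases b <;> simp [Data.size, Data.ofBool]

/-- A computation produces no more than twice as many nodes as it takes steps. -/
theorem Run.size_le {O : Data → Bool → Prop} {p : Prog} {d r : Data} {t : ℕ} (h : Run O p d r t) :
    r.size ≤ 2 * t := by
  induction h with
  | skip d => omega
  | empty d => simp only [Data.size]; omega
  | fst d => have := d.size_left_le; omega
  | snd d => have := d.size_right_le; omega
  -- On the empty tree the test takes two steps and returns a tree with three nodes, hence the
  -- factor two.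
  | eq d => exact (Data.size_ofBool_le _).trans (by have := d.size_pos; omega)
  | pair _ _ h₁ h₂ => simp only [Data.size]; omega
  | @query d b _ => have := Data.size_ofBool_le b; have := d.size_pos; omega
  | _ => omega

/-- Types whose elements are encoded as trees. -/
class Enc (α : Type) where
  enc : α → Data

open Enc (enc)

/-- The size of the encoding of an element. -/
def sz {α : Type} [Enc α] (a : α) : ℕ := (enc a).size

instance : Enc Data := ⟨id⟩
instance : Enc Unit := ⟨fun _ => .nil⟩
instance : Enc Bool := ⟨Data.ofBool⟩
instance : Enc ℕ := ⟨Data.ofNat⟩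
instance {α β : Type} [Enc α] [Enc β] : Enc (α × β) := ⟨fun p => .cons (enc p.1) (enc p.2)⟩
instance {α : Type} [Enc α] : Enc (List α) := ⟨fun l => .ofList (l.map enc)⟩

section

variable {α β γ σ : Type} [Enc α] [Enc β] [Enc γ] [Enc σ]

@[simp] theorem sz_pair (a : α) (b : β) : sz (a, b) = sz a + sz b + 1 := rfl

@[simp] theorem sz_nil : sz ([] : List α) = 1 := rfl

@[simp] theorem sz_cons (a : α) (l : List α) : sz (a :: l) = sz a + sz l + 1 := rfl

theorem sz_bool (b : Bool) : sz b ≤ 3 := Data.size_ofBool_le b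

@[simp] theorem sz_unit (u : Unit) : sz u = 1 := rfl

@[simp] theorem sz_nat (n : ℕ) : sz n = 2 * n + 1 := by
  induction n with
  | zero => rfl
  | succ n ih =>
    have : sz (n + 1) = 1 + sz n + 1 := rfl
    omega

@[simp] theorem enc_pair (a : α) (b : β) : enc (a, b) = .cons (enc a) (enc b) := rfl

theorem sz_append (l m : List α) : sz (l ++ m) + 1 = sz l + sz m := by
  induction l with
  | nil => simp; omega
  | cons a l ih => simp only [List.cons_append, sz_cons]; omega

theorem sz_reverse (l : List α) : sz l.reverse = sz l := by
  induction l with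
  | nil => rfl
  | cons a l ih =>
    have := sz_append l.reverse [a]
    simp only [List.reverse_cons, sz_cons, sz_nil] at this ⊢
    omega

theorem length_le_sz (l : List α) : l.length ≤ sz l := by
  induction l with
  | nil => simp
  | cons a l ih => simp only [List.length_cons, sz_cons]; omega

theorem sz_le_of_mem {l : List α} {a : α} (h : a ∈ l) : sz a ≤ sz l := by
  induction l with
  | nil => simp at h
  | cons b l ih =>
    rcases List.mem_cons.1 h with rfl | h
    · simp only [sz_cons]; omega
    · have := ih h; simp only [sz_cons]; omega

theorem sz_le_of_sublist {l m : List α} (h : l.Sublist m) : sz l ≤ sz m := by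
  induction h with
  | slnil => exact le_rfl
  | cons a _ ih => simp only [sz_cons]; omega
  | cons_cons a _ ih => simp only [sz_cons]; omega

theorem sz_list_le {l : List α} {c : ℕ} (h : ∀ a ∈ l, sz a ≤ c) : sz l ≤ l.length * (c + 1) + 1 := by
  induction l with
  | nil => simp
  | cons b l ih =>
    have h₁ := h b (by simp)
    have h₂ := ih fun a ha => h a (by simp [ha])
    simp only [sz_cons, List.length_cons, add_mul]
    omega

/-- Functions computed by a program in polynomial time, without help of an oracle. -/
@[fun_prop]
def PolyFn (f : α → β) : Prop :=
  ∃ (prog : Prog) (p : Polynomial ℕ), ∀ (O : Data → Bool → Prop) (a : α),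
    ∃ t, Run O prog (enc a) (enc (f a)) t ∧ t ≤ p.eval (sz a)

namespace PolyFn

/-- The output is bounded by the running time. This is what makes running times compose: the time of
a second program becomes a polynomial in the size of the first input. -/
theorem sz_le {f : α → β} (hf : PolyFn f) :
    ∃ p : Polynomial ℕ, ∀ a, sz (f a) ≤ p.eval (sz a) := by
  obtain ⟨prog, p, h⟩ := hf
  refine ⟨2 * p, fun a => ?_⟩
  obtain ⟨t, h₁, h₂⟩ := h noOracle a
  have := h₁.size_le
  simp only [Polynomial.eval_mul, Polynomial.eval_ofNat]
  exact this.trans (by omega)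

@[fun_prop]
theorem id' : PolyFn (fun a : α => a) :=
  ⟨.skip, 1 + .X, fun O a => ⟨_, Run.skip _, by simp [sz]⟩⟩

theorem exists_run_const (d : Data) : ∃ (prog : Prog) (c : ℕ), ∀ (O : Data → Bool → Prop) (e : Data),
    ∃ t, Run O prog e d t ∧ t ≤ c * (1 + e.size) := by
  induction d with
  | nil => exact ⟨.empty, 1, fun O e => ⟨_, Run.empty e, by omega⟩⟩
  | cons a b iha ihb =>
    obtain ⟨p, c, hp⟩ := iha
    obtain ⟨q, c', hq⟩ := ihb
    refine ⟨.pair p q, 1 + c + c', fun O e => ?_⟩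
    obtain ⟨t, h₁, h₂⟩ := hp O e
    obtain ⟨u, h₃, h₄⟩ := hq O e
    refine ⟨_, Run.pair h₁ h₃, ?_⟩
    simp only [add_mul]
    omega

@[fun_prop]
theorem const (b : β) : PolyFn (fun _ : α => b) := by
  obtain ⟨prog, c, h⟩ := exists_run_const (enc b)
  refine ⟨prog, .C c * (1 + .X), fun O a => ?_⟩
  obtain ⟨t, h₁, h₂⟩ := h O (enc a)
  exact ⟨t, h₁, by simpa [sz] using h₂⟩

@[fun_prop]
theorem comp {g : β → γ} {f : α → β} (hg : PolyFn g) (hf : PolyFn f) :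
    PolyFn (fun a => g (f a)) := by
  obtain ⟨r, hr⟩ := hf.sz_le
  obtain ⟨P, p, hp⟩ := hf
  obtain ⟨Q, q, hq⟩ := hg
  refine ⟨.seq P Q, 1 + .X + p + q.comp r, fun O a => ?_⟩
  obtain ⟨t, h₁, h₂⟩ := hp O a
  obtain ⟨u, h₃, h₄⟩ := hq O (f a)
  refine ⟨_, Run.seq h₁ h₃, ?_⟩
  have := eval_mono q (hr a)
  simp only [Polynomial.eval_add, Polynomial.eval_one, Polynomial.eval_X, Polynomial.eval_comp]
  simp only [sz] at *
  omega

@[fun_prop]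
theorem prodMk {f : α → β} {g : α → γ} (hf : PolyFn f) (hg : PolyFn g) :
    PolyFn (fun a => (f a, g a)) := by
  obtain ⟨P, p, hp⟩ := hf
  obtain ⟨Q, q, hq⟩ := hg
  refine ⟨.pair P Q, 1 + .X + p + q, fun O a => ?_⟩
  obtain ⟨t, h₁, h₂⟩ := hp O a
  obtain ⟨u, h₃, h₄⟩ := hq O a
  refine ⟨_, Run.pair h₁ h₃, ?_⟩
  simp only [Polynomial.eval_add, Polynomial.eval_one, Polynomial.eval_X]
  simp only [sz] at *
  omega

theorem fst₀ : PolyFn (Prod.fst : α × β → α) :=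
  ⟨.fst, 1 + .X, fun O a => ⟨_, Run.fst _, by simp [sz]⟩⟩

theorem snd₀ : PolyFn (Prod.snd : α × β → β) :=
  ⟨.snd, 1 + .X, fun O a => ⟨_, Run.snd _, by simp [sz]⟩⟩

@[fun_prop]
theorem fst {f : α → β × γ} (hf : PolyFn f) : PolyFn (fun a => (f a).1) := fst₀.comp hf

@[fun_prop]
theorem snd {f : α → β × γ} (hf : PolyFn f) : PolyFn (fun a => (f a).2) := snd₀.comp hf

@[fun_prop]
theorem cond {c : α → Bool} {f g : α → β} (hc : PolyFn c) (hf : PolyFn f) (hg : PolyFn g) :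
    PolyFn (fun a => bif c a then f a else g a) := by
  obtain ⟨R, r, hr⟩ := hc
  obtain ⟨P, p, hp⟩ := hf
  obtain ⟨Q, q, hq⟩ := hg
  refine ⟨.cond R P Q, 1 + .X + r + p + q, fun O a => ?_⟩
  obtain ⟨v, h₅, h₆⟩ := hr O a
  obtain ⟨t, h₁, h₂⟩ := hp O a
  obtain ⟨u, h₃, h₄⟩ := hq O a
  simp only [Polynomial.eval_add, Polynomial.eval_one, Polynomial.eval_X]
  simp only [sz] at *
  cases h : c a <;> rw [h] at h₅
  · exact ⟨_, Run.cond_false h₅ h₃, by omega⟩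
  · exact ⟨_, Run.cond_true h₅ (by simp [enc, Data.ofBool]) h₁, by omega⟩

@[fun_prop]
theorem not {c : α → Bool} (hc : PolyFn c) : PolyFn (fun a => !(c a)) := by
  have h : PolyFn (fun a => bif c a then false else true) := by fun_prop
  convert h using 2 with a
  cases c a <;> rfl

@[fun_prop]
theorem and {c d : α → Bool} (hc : PolyFn c) (hd : PolyFn d) : PolyFn (fun a => c a && d a) := by
  have h : PolyFn (fun a => bif c a then d a else false) := by fun_prop
  convert h using 2 with a
  cases c a <;> rfl

@[fun_prop]
theorem or {c d : α → Bool} (hc : PolyFn c) (hd : PolyFn d) : PolyFn (fun a => c a || d a) := by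
  have h : PolyFn (fun a => bif c a then true else d a) := by fun_prop
  convert h using 2 with a
  cases c a <;> rfl

theorem enc_nat_injective : Function.Injective (enc : ℕ → Data) := by
  intro m n h
  have : sz m = sz n := by rw [sz, sz, h]
  simpa using this

-- The machine compares trees, so the encoding has to be injective; unary codes of distinct numbers
-- differ in size.
@[fun_prop]
theorem beq {f g : α → ℕ} (hf : PolyFn f) (hg : PolyFn g) : PolyFn (fun a => f a == g a) := by
  have h : PolyFn (fun p : ℕ × ℕ => p.1 == p.2) := by
    refine ⟨.eq, 1 + .X, fun O a => ⟨1 + (enc a).size, ?_, by simp [sz]⟩⟩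
    convert Run.eq (O := O) (enc a) using 1
    obtain ⟨m, n⟩ := a
    by_cases hmn : m = n
    · simp [enc, hmn, Data.left, Data.right]
    · have : enc m ≠ enc n := fun h => hmn (enc_nat_injective h)
      have h' : Data.ofNat m ≠ Data.ofNat n := this
      simp [enc, beq_false_of_ne hmn, Data.left, Data.right, h']
  exact h.comp (hf.prodMk hg)

@[fun_prop]
theorem succ {f : α → ℕ} (hf : PolyFn f) : PolyFn (fun a => f a + 1) := by
  have h : PolyFn (fun n : ℕ => n + 1) :=
    ⟨.pair .empty .skip, 3 * (1 + .X), fun O a => ⟨_, Run.pair (Run.empty _) (Run.skip _), by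
      simp [sz]; omega⟩⟩
  exact h.comp hf

@[fun_prop]
theorem cons {f : α → β} {g : α → List β} (hf : PolyFn f) (hg : PolyFn g) :
    PolyFn (fun a => f a :: g a) := by
  have h : PolyFn (fun p : β × List β => p.1 :: p.2) :=
    ⟨.skip, 1 + .X, fun O a => ⟨_, Run.skip _, by simp [sz]⟩⟩
  exact h.comp (hf.prodMk hg)

@[fun_prop]
theorem tail {g : α → List β} (hg : PolyFn g) : PolyFn (fun a => (g a).tail) := by
  have h : PolyFn (fun l : List β => l.tail) :=
    ⟨.snd, 1 + .X, fun O l => by cases l <;> exact ⟨_, Run.snd _, by simp [sz]⟩⟩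
  exact h.comp hg

@[fun_prop]
theorem isEmpty {g : α → List β} (hg : PolyFn g) : PolyFn (fun a => (g a).isEmpty) := by
  have h : PolyFn (fun l : List β => l.isEmpty) := by
    obtain ⟨P, p, hp⟩ := const (α := List β) true
    obtain ⟨Q, q, hq⟩ := const (α := List β) false
    -- A list is empty exactly if its tree is `nil`, so the input itself serves as the test.
    refine ⟨.cond .skip Q P, 2 * (1 + .X) + p + q, fun O l => ?_⟩
    obtain ⟨t, h₁, h₂⟩ := hp O l
    obtain ⟨u, h₃, h₄⟩ := hq O l
    simp only [Polynomial.eval_add, Polynomial.eval_one, Polynomial.eval_X, Polynomial.eval_mul,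
      Polynomial.eval_ofNat]
    simp only [sz] at *
    cases l with
    | nil => exact ⟨_, Run.cond_false (Run.skip _) h₁, by omega⟩
    | cons b l => exact ⟨_, Run.cond_true (Run.skip _) (by simp [enc, Data.ofList]) h₃, by omega⟩
  exact h.comp hg

@[fun_prop]
theorem headD {g : α → List β} {f : α → β} (hg : PolyFn g) (hf : PolyFn f) :
    PolyFn (fun a => (g a).headD (f a)) := by
  have h : PolyFn (fun p : List β × β => p.1.headD p.2) := by
    refine ⟨.cond .fst (.seq .fst .fst) .snd, 5 * (1 + .X), fun O p => ?_⟩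
    simp only [Polynomial.eval_add, Polynomial.eval_one, Polynomial.eval_X, Polynomial.eval_mul,
      Polynomial.eval_ofNat]
    obtain ⟨l, b⟩ := p
    have h₀ := (enc (l, b)).size_left_le
    simp only [sz]
    cases l with
    | nil => exact ⟨_, Run.cond_false (Run.fst _) (Run.snd _), by omega⟩
    | cons c l =>
      exact ⟨_, Run.cond_true (Run.fst _) (by simp [enc, Data.ofList, Data.left])
        (Run.seq (Run.fst _) (Run.fst _)), by omega⟩
  exact h.comp (hg.prodMk hf)

end PolyFn

/-- The loop that folds the program `g` over a list: it works on triples of a context, the current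
state, and the remaining list. -/
def foldProg (g : Prog) : Prog :=
  .loop (.seq .snd .snd)
    (.pair .fst (.pair
      (.seq (.pair .fst (.pair (.seq .snd .fst) (.seq .snd (.seq .snd .fst)))) g)
      (.seq .snd (.seq .snd .snd))))

/-- Each round costs `T` for `g` plus a multiple of `B` for taking the triple apart and rebuilding
it. The bounds are needed only in situations that satisfy `Inv`, and `g` only has to run well under
the given oracle, so the lemma also covers a loop body that asks queries. -/
theorem run_foldProg (O : Data → Bool → Prop) (g : Prog) (a : α) (f : σ → β → σ)
    (Inv : σ → List β → Prop) (B T : ℕ) (ha : sz a ≤ B)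
    (hB : ∀ s l, Inv s l → sz s ≤ B ∧ sz l ≤ B)
    (hf : ∀ s b l, Inv s (b :: l) → Inv (f s b) l ∧
      ∃ t ≤ T, Run O g (enc (a, s, b)) (enc (f s b)) t) (s : σ) (l : List β) (h : Inv s l) :
    ∃ t ≤ (l.length + 1) * (T + 100 * (B + 1)),
      Run O (foldProg g) (enc (a, s, l)) (enc (a, l.foldl f s, ([] : List β))) t := by
  induction l generalizing s with
  | nil =>
    refine ⟨_, ?_, Run.loop_done (Run.seq (Run.snd _) (Run.snd _))⟩
    have := (hB _ _ h).1
    simp only [enc_pair, Data.right, Data.size, List.length_nil]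
    simp only [sz] at *
    simp only [enc, List.map_nil, Data.ofList, Data.size] at *
    omega
  | cons b l ih =>
    obtain ⟨h₁, t, ht, hr⟩ := hf s b l h
    obtain ⟨u, hu, hu'⟩ := ih _ h₁
    have h₂ := hB _ _ h
    have h₃ := (hB _ _ h₁).1
    refine ⟨_, ?_, Run.loop_step (Run.seq (Run.snd _) (Run.snd _)) (by simp [enc, Data.ofList, Data.right])
      (Run.pair (Run.fst _) (Run.pair (Run.seq (Run.pair (Run.fst _) (Run.pair (Run.seq (Run.snd _) (Run.fst _))
        (Run.seq (Run.snd _) (Run.seq (Run.snd _) (Run.fst _))))) hr)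
        (Run.seq (Run.snd _) (Run.seq (Run.snd _) (Run.snd _))))) hu'⟩
    have e : (enc (b :: l)).size = (enc b).size + (enc l).size + 1 := rfl
    simp only [sz] at *
    simp only [enc_pair, Data.right, Data.size, List.length_cons] at *
    rw [add_mul (l.length + 1) 1]
    omega

namespace PolyFn

/-- The bound `q` on the folds over all prefixes cannot be dropped: a polynomial-time step that
doubles the size of the state would lead to exponential growth. -/
theorem foldl {L : α → List β} {i : α → σ} {f : α → σ → β → σ} (hL : PolyFn L) (hi : PolyFn i)
    (hf : PolyFn fun p : α × σ × β => f p.1 p.2.1 p.2.2) (q : Polynomial ℕ)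
    (hq : ∀ a l, l <+: L a → sz (l.foldl (f a) (i a)) ≤ q.eval (sz a)) :
    PolyFn (fun a => (L a).foldl (f a) (i a)) := by
  obtain ⟨rL, hrL⟩ := hL.sz_le
  have hs : PolyFn (fun a : α × σ × List β => a.2.1) := by fun_prop
  have hini : PolyFn (fun a => (a, i a, L a)) := by fun_prop
  obtain ⟨G, g, hg⟩ := hf
  set B : Polynomial ℕ := .X + q + rL with hBdef
  have key : ∃ p : Polynomial ℕ, ∀ O a, ∃ t ≤ p.eval (sz a),
      Run O (foldProg G) (enc (a, i a, L a)) (enc (a, (L a).foldl (f a) (i a), ([] : List β))) t := by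
    -- There are at most `rL` rounds and one final test. In each round `g` runs on a triple of
    -- context, state and list element, each of size at most `B`, and pairing adds two nodes.
    refine ⟨(rL + 1) * (g.comp (3 * B + 2) + 100 * (B + 1)), fun O a => ?_⟩
    have hB : B.eval (sz a) = sz a + q.eval (sz a) + rL.eval (sz a) := by simp [hBdef]
    obtain ⟨t, ht, hr⟩ := run_foldProg O G a (f a)
      (fun s l => ∃ l₁, L a = l₁ ++ l ∧ s = l₁.foldl (f a) (i a)) (B.eval (sz a))
      (g.eval (3 * B.eval (sz a) + 2)) (by omega)
      (by
        rintro s l ⟨l₁, h₁, rfl⟩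
        have h₂ := hq a l₁ ⟨l, h₁.symm⟩
        have h₃ := sz_le_of_sublist (l := l) (m := L a) (by rw [h₁]; exact List.sublist_append_right _ _)
        have h₄ := hrL a
        omega)
      (by
        rintro s b l ⟨l₁, h₁, rfl⟩
        refine ⟨⟨l₁ ++ [b], by simp [h₁], by simp⟩, ?_⟩
        obtain ⟨t, h₂, h₃⟩ := hg O (a, l₁.foldl (f a) (i a), b)
        refine ⟨t, h₃.trans (eval_mono g ?_), h₂⟩
        have h₂ := hq a l₁ ⟨_, h₁.symm⟩
        have h₃ := sz_le_of_mem (l := L a) (a := b) (by simp [h₁])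
        have h₄ := hrL a
        simp only [sz_pair]
        omega) (i a) (L a) ⟨[], by simp, rfl⟩
    refine ⟨t, ht.trans ?_, hr⟩
    have := (length_le_sz (L a)).trans (hrL a)
    simp only [Polynomial.eval_add, Polynomial.eval_mul, Polynomial.eval_comp, Polynomial.eval_one,
      Polynomial.eval_ofNat]
    gcongr
  have hfold : ∃ (prog : Prog) (p : Polynomial ℕ), ∀ O a, ∃ t,
      Run O prog (enc a) (enc (a, (L a).foldl (f a) (i a), ([] : List β))) t ∧ t ≤ p.eval (sz a) := by
    obtain ⟨I, p₁, h₁⟩ := hini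
    obtain ⟨p₂, h₂⟩ := key
    refine ⟨.seq I (foldProg G), 1 + .X + p₁ + p₂, fun O a => ?_⟩
    obtain ⟨t, h₃, h₄⟩ := h₁ O a
    obtain ⟨u, h₅, h₆⟩ := h₂ O a
    refine ⟨_, Run.seq h₃ h₆, ?_⟩
    simp only [Polynomial.eval_add, Polynomial.eval_one, Polynomial.eval_X, sz] at *
    omega
  have h : PolyFn (fun a => (a, (L a).foldl (f a) (i a), ([] : List β))) := hfold
  exact hs.comp h

end PolyFn

end

/-! ### List operations and counted loops in polynomial time. -/

namespace PolyFn

variable {α β γ σ : Type} [Enc α] [Enc β] [Enc γ] [Enc σ]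

@[fun_prop]
theorem reverse {L : α → List β} (hL : PolyFn L) : PolyFn (fun a => (L a).reverse) := by
  have h : PolyFn (fun l : List β => l.foldl (fun s b => b :: s) []) := by
    refine foldl (f := fun _ s b => b :: s) (by fun_prop) (by fun_prop) (by fun_prop) .X ?_
    intro l m hm
    have : m.foldl (fun s b => b :: s) [] = m.reverse := by simp
    rw [this, sz_reverse, Polynomial.eval_X]
    exact sz_le_of_sublist hm.sublist
  simp only [List.foldl_flip_cons_eq_append', List.append_nil] at h
  exact h.comp hL

@[fun_prop]
theorem append {L M : α → List β} (hL : PolyFn L) (hM : PolyFn M) :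
    PolyFn (fun a => L a ++ M a) := by
  have h : PolyFn (fun p : List β × List β => p.1.reverse.foldl (fun s b => b :: s) p.2) := by
    refine foldl (f := fun _ s b => b :: s) (by fun_prop) (by fun_prop) (by fun_prop) .X ?_
    rintro ⟨l, l'⟩ m hm
    have h₁ := sz_le_of_sublist hm.sublist
    have h₂ := sz_append m.reverse l'
    rw [sz_reverse] at h₁ h₂
    simp only [List.foldl_flip_cons_eq_append', Polynomial.eval_X, sz_pair] at h₁ ⊢
    omega
  simp only [List.foldl_flip_cons_eq_append', List.reverse_reverse] at h
  exact h.comp (hL.prodMk hM)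

@[fun_prop]
theorem map {L : α → List β} {f : α → β → γ} (hL : PolyFn L)
    (hf : PolyFn fun p : α × β => f p.1 p.2) : PolyFn (fun a => (L a).map (f a)) := by
  obtain ⟨rL, hrL⟩ := hL.sz_le
  obtain ⟨rf, hrf⟩ := hf.sz_le
  -- The fold puts the images in front of each other, hence in reverse order; a final reversal
  -- repairs this.
  have e : ∀ (g : β → γ) (l : List β) (s : List γ),
      l.foldl (fun s b => g b :: s) s = (l.map g).reverse ++ s := by
    intro g l
    induction l with
    | nil => simp
    | cons b l ih => simp [ih]
  have h : PolyFn (fun a => (L a).foldl (fun s b => f a b :: s) []) := by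
    refine foldl (f := fun a s b => f a b :: s) hL (by fun_prop) ?_
      (rL * (rf.comp (.X + rL + 1) + 1) + 1) ?_
    · have : PolyFn (fun p : α × List γ × β => f p.1 p.2.2) :=
        hf.comp (f := fun p : α × List γ × β => (p.1, p.2.2)) (by fun_prop)
      fun_prop
    · intro a l hl
      have h₀ : ∀ c ∈ l.map (f a), sz c ≤ rf.eval (sz a + rL.eval (sz a) + 1) := by
        intro c hc
        obtain ⟨b, hb, rfl⟩ := List.mem_map.1 hc
        refine (hrf (a, b)).trans (eval_mono _ ?_)
        have := (sz_le_of_mem (hl.subset hb)).trans (hrL a)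
        simp only [sz_pair]
        omega
      have h₁ := sz_list_le h₀
      have h₂ : l.length ≤ rL.eval (sz a) :=
        hl.length_le.trans ((length_le_sz _).trans (hrL a))
      simp only [e, List.append_nil, sz_reverse, List.length_map, Polynomial.eval_add,
        Polynomial.eval_mul, Polynomial.eval_comp, Polynomial.eval_X, Polynomial.eval_one] at h₁ ⊢
      refine h₁.trans ?_
      gcongr
  have h' := h.reverse
  simpa only [e, List.append_nil, List.reverse_reverse] using h'

@[fun_prop]
theorem filter {L : α → List β} {f : α → β → Bool} (hL : PolyFn L)
    (hf : PolyFn fun p : α × β => f p.1 p.2) : PolyFn (fun a => (L a).filter (f a)) := by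
  obtain ⟨rL, hrL⟩ := hL.sz_le
  have e : ∀ (g : β → Bool) (l : List β) (s : List β),
      l.foldl (fun s b => bif g b then b :: s else s) s = (l.filter g).reverse ++ s := by
    intro g l
    induction l with
    | nil => simp
    | cons b l ih => intro s; cases h : g b <;> simp [ih, h]
  have h : PolyFn (fun a => (L a).foldl (fun s b => bif f a b then b :: s else s) []) := by
    refine foldl (f := fun a s b => bif f a b then b :: s else s) hL (by fun_prop) ?_ rL ?_
    · have : PolyFn (fun p : α × List β × β => f p.1 p.2.2) :=
        hf.comp (f := fun p : α × List β × β => (p.1, p.2.2)) (by fun_prop)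
      fun_prop
    · intro a l hl
      rw [e, List.append_nil, sz_reverse]
      exact (sz_le_of_sublist (List.filter_sublist.trans hl.sublist)).trans (hrL a)
  have h' := h.reverse
  simpa only [e, List.append_nil, List.reverse_reverse] using h'

@[fun_prop]
theorem any {L : α → List β} {f : α → β → Bool} (hL : PolyFn L)
    (hf : PolyFn fun p : α × β => f p.1 p.2) : PolyFn (fun a => (L a).any (f a)) := by
  have h : PolyFn (fun a => !((L a).filter (f a)).isEmpty) := by fun_prop
  convert h using 2 with a
  rw [Bool.eq_iff_iff]
  simp [List.filter_eq_nil_iff]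

@[fun_prop]
theorem all {L : α → List β} {f : α → β → Bool} (hL : PolyFn L)
    (hf : PolyFn fun p : α × β => f p.1 p.2) : PolyFn (fun a => (L a).all (f a)) := by
  have h : PolyFn (fun a => !((L a).any fun b => !(f a b))) := by fun_prop
  convert h using 2 with a
  rw [Bool.eq_iff_iff]
  simp

/-- A unary number and a list of that many units are the same tree. So numbers can be used as lists,
which turns folds into counted loops, and the length of a list is obtained by mapping its elements
to units. -/
theorem enc_replicate (n : ℕ) : enc (List.replicate n ()) = enc n := by
  induction n with
  | zero => rfl
  | succ n ih => exact congrArg (Data.cons .nil) ih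

@[fun_prop]
theorem replicate {f : α → ℕ} (hf : PolyFn f) : PolyFn (fun a => List.replicate (f a) ()) := by
  obtain ⟨P, p, h⟩ := hf
  exact ⟨P, p, fun O a => by simpa only [enc_replicate] using h O a⟩

@[fun_prop]
theorem length {L : α → List β} (hL : PolyFn L) : PolyFn (fun a => (L a).length) := by
  have hm : PolyFn (fun a => (L a).map fun _ => ()) := by fun_prop
  obtain ⟨P, p, h⟩ := hm
  refine ⟨P, p, fun O a => ?_⟩
  simpa only [List.map_const', enc_replicate] using h O a

theorem foldl_replicate {δ : Type} (F : δ → δ) (n : ℕ) (s : δ) :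
    (List.replicate n ()).foldl (fun s _ => F s) s = F^[n] s := by
  induction n generalizing s with
  | zero => rfl
  | succ n ih => simp only [List.replicate_succ, List.foldl_cons, Function.iterate_succ_apply, ih]

theorem iterate {F : β → β} {i : α → β} {k : α → ℕ} (hF : PolyFn F) (hi : PolyFn i)
    (hk : PolyFn k) (q : Polynomial ℕ)
    (hq : ∀ a j, j ≤ k a → sz (F^[j] (i a)) ≤ q.eval (sz a)) :
    PolyFn (fun a => F^[k a] (i a)) := by
  have h : PolyFn (fun a => (List.replicate (k a) ()).foldl (fun s _ => F s) (i a)) := by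
    refine foldl (f := fun _ s _ => F s) (by fun_prop) hi (by fun_prop) q ?_
    intro a l hl
    obtain ⟨hl₁, hl₂⟩ := List.prefix_replicate_iff.1 hl
    rw [hl₂, foldl_replicate]
    exact hq a _ (by simpa using hl₁)
  simpa only [foldl_replicate] using h

@[fun_prop]
theorem range {f : α → ℕ} (hf : PolyFn f) : PolyFn (fun a => List.range (f a)) := by
  have e : ∀ n, (fun p : ℕ × List ℕ => (p.1 + 1, p.1 :: p.2))^[n] (0, []) =
      (n, (List.range n).reverse) := by
    intro n
    induction n with
    | zero => rfl
    | succ n ih => rw [Function.iterate_succ_apply', ih]; simp [List.range_succ]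
  have h : PolyFn (fun n : ℕ => (fun p : ℕ × List ℕ => (p.1 + 1, p.1 :: p.2))^[n] (0, [])) := by
    refine iterate (by fun_prop) (by fun_prop) (by fun_prop) (2 * .X * .X + 10 * .X + 10) ?_
    intro n j hj
    have h₁ := sz_list_le (l := List.range j) (c := 2 * n + 1) (fun i hi => by
      rw [sz_nat]; have := List.mem_range.1 hi; omega)
    rw [List.length_range] at h₁
    simp only [e, sz_pair, sz_nat, sz_reverse, Polynomial.eval_add, Polynomial.eval_mul,
      Polynomial.eval_X, Polynomial.eval_ofNat]
    nlinarith
  simp only [e] at h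
  have h' : PolyFn (fun n : ℕ => (List.range n).reverse) := h.snd
  have h'' := h'.reverse
  simp only [List.reverse_reverse] at h''
  exact h''.comp hf

@[fun_prop]
theorem drop {L : α → List β} {f : α → ℕ} (hL : PolyFn L) (hf : PolyFn f) :
    PolyFn (fun a => (L a).drop (f a)) := by
  obtain ⟨rL, hrL⟩ := hL.sz_le
  have e : ∀ n (l : List β), List.tail^[n] l = l.drop n := by
    intro n
    induction n with
    | zero => simp
    | succ n ih => intro l; rw [Function.iterate_succ_apply', ih, List.tail_drop]
  have h : PolyFn (fun a => List.tail^[f a] (L a)) := by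
    refine iterate (by fun_prop) hL hf rL fun a j _ => ?_
    rw [e]
    exact (sz_le_of_sublist (List.drop_sublist _ _)).trans (hrL a)
  simpa only [e] using h

@[fun_prop]
theorem getD {L : α → List β} {f : α → ℕ} {g : α → β} (hL : PolyFn L) (hf : PolyFn f)
    (hg : PolyFn g) : PolyFn (fun a => (L a).getD (f a) (g a)) := by
  have h : PolyFn (fun a => ((L a).drop (f a)).headD (g a)) := by fun_prop
  convert h using 2 with a
  rw [List.headD_eq_head?_getD, List.head?_drop, List.getD_eq_getElem?_getD]

@[fun_prop]
theorem flatten {L : α → List (List β)} (hL : PolyFn L) : PolyFn (fun a => (L a).flatten) := by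
  have e : ∀ (l : List (List β)) s, l.foldl (fun s m => s ++ m) s = s ++ l.flatten := by
    intro l
    induction l with
    | nil => simp
    | cons m l ih => intro s; simp [ih]
  have hsz : ∀ l : List (List β), sz l.flatten ≤ sz l := by
    intro l
    induction l with
    | nil => simp
    | cons m l ih =>
      have := sz_append m l.flatten
      simp only [List.flatten_cons, sz_cons]
      omega
  have h : PolyFn (fun l : List (List β) => l.foldl (fun s m => s ++ m) []) := by
    refine foldl (f := fun _ s m => s ++ m) (by fun_prop) (by fun_prop) (by fun_prop) .X ?_
    intro l m hm
    rw [e, List.nil_append, Polynomial.eval_X]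
    exact (hsz m).trans (sz_le_of_sublist hm.sublist)
  simp only [e, List.nil_append] at h
  exact h.comp hL

end PolyFn

/-! ### Conforming paths as lists of vertices -/

section

variable {V W : Type*}

/-- A list of vertices is conforming if no vertex `v` of it deletes an edge `ab` that comes later:
`D v a b` says that `v` deletes the edge `ab`. -/
def Conf (D : V → V → V → Prop) : List V → Prop
  | [] => True
  | v :: l => (v :: l).IsChain (fun a b => ¬ D v a b) ∧ Conf D l

/-- The list `l` is a conforming path from `s` to `t` in the graph with adjacency relation `A`. -/
structure IsPathList (A : V → V → Prop) (D : V → V → V → Prop) (s t : V) (l : List V) : Prop where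
  head : l.head? = some s
  last : l.getLast? = some t
  nodup : l.Nodup
  chain : l.IsChain A
  conf : Conf D l

def HasPath (A : V → V → Prop) (D : V → V → V → Prop) (s t : V) : Prop :=
  ∃ l, IsPathList A D s t l

theorem isPathList_singleton (A : V → V → Prop) (D : V → V → V → Prop) (s : V) :
    IsPathList A D s s [s] :=
  ⟨rfl, rfl, by simp, by simp, by simp [Conf]⟩

theorem conf_map (e : W → V) (D : V → V → V → Prop) (l : List W) :
    Conf D (l.map e) ↔ Conf (fun v a b => D (e v) (e a) (e b)) l := by
  induction l with
  | nil => simp [Conf]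
  | cons v l ih =>
    simp only [List.map_cons, Conf, ih, and_congr_left_iff]
    intro _
    exact List.isChain_map (l := v :: l) e

/-- Moves paths over `Fin n` and paths in induced subgraphs to paths over the natural numbers inside
a given set, so that one vertex type serves all instances. -/
theorem hasPath_comap_iff {e : W → V} (he : Function.Injective e) (A : V → V → Prop)
    (D : V → V → V → Prop) (s t : W) :
    HasPath (fun a b => A (e a) (e b)) (fun v a b => D (e v) (e a) (e b)) s t ↔
      ∃ l, IsPathList A D (e s) (e t) l ∧ ∀ v ∈ l, v ∈ Set.range e := by
  constructor
  · rintro ⟨l, h⟩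
    refine ⟨l.map e, ⟨by simp [h.head], by simp [h.last], h.nodup.map he,
      (List.isChain_map e).2 h.chain, (conf_map e D l).2 h.conf⟩, by simp⟩
  · rintro ⟨l, h, hl⟩
    obtain ⟨l, rfl⟩ : l ∈ Set.range (List.map e) := by
      rw [Set.range_list_map]
      exact hl
    refine ⟨l, ⟨?_, ?_, h.nodup.of_map, (List.isChain_map e).1 h.chain, (conf_map e D l).1 h.conf⟩⟩
    · have := h.head
      rw [List.head?_map, Option.map_eq_some_iff] at this
      obtain ⟨a, h₁, h₂⟩ := this
      rw [h₁, he h₂]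
    · have := h.last
      rw [List.getLast?_map, Option.map_eq_some_iff] at this
      obtain ⟨a, h₁, h₂⟩ := this
      rw [h₁, he h₂]

theorem conf_congr {D D' : V → V → V → Prop} {l : List V}
    (h : ∀ v ∈ l, ∀ a ∈ l, ∀ b ∈ l, D v a b ↔ D' v a b) : Conf D l ↔ Conf D' l := by
  induction l with
  | nil => simp [Conf]
  | cons v l ih =>
    simp only [Conf]
    rw [ih fun v hv a ha b hb => h v (by simp [hv]) a (by simp [ha]) b (by simp [hb])]
    rw [List.IsChain.iff_of_mem_imp fun a b ha hb => not_congr (h v (by simp) a ha b hb)]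

/-- Deleting non-edges has no effect. -/
theorem conf_and_iff {A : V → V → Prop} {D : V → V → V → Prop} {l : List V} (hl : l.IsChain A) :
    Conf (fun v a b => A a b ∧ D v a b) l ↔ Conf D l := by
  induction l with
  | nil => simp [Conf]
  | cons v l ih =>
    simp only [Conf, ih hl.of_cons, and_congr_left_iff]
    intro _
    constructor
    · intro h
      rw [List.isChain_iff_getElem] at *
      exact fun i hi hD => h i hi ⟨hl i hi, hD⟩
    · exact List.IsChain.imp fun a b h₁ h₂ => h₁ h₂.2

/-- Lets deletion sets be cut down to the surviving edges after a change of the graph, as `f_subset`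
demands, without affecting the answer. -/
theorem hasPath_and_iff {A : V → V → Prop} {D : V → V → V → Prop} {s t : V} :
    HasPath A (fun v a b => A a b ∧ D v a b) s t ↔ HasPath A D s t :=
  ⟨fun ⟨l, h⟩ => ⟨l, h.head, h.last, h.nodup, h.chain, (conf_and_iff h.chain).1 h.conf⟩,
    fun ⟨l, h⟩ => ⟨l, h.head, h.last, h.nodup, h.chain, (conf_and_iff h.chain).2 h.conf⟩⟩

theorem isConforming_iff {G : SimpleGraph V} (f : V → Finset (Sym2 V)) {u v : V} (p : G.Walk u v) :
    IsConforming f p ↔ Conf (fun v a b => s(a, b) ∈ f v) p.support := by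
  induction p with
  | nil => simp [IsConforming, Conf]
  | @cons u v w h p ih =>
    have e : (u :: p.support).IsChain (fun a b => ¬ s(a, b) ∈ f u) ↔
        ∀ i, i < p.length + 1 →
          s((p.cons h).getVert i, (p.cons h).getVert (i + 1)) ∉ f u := by
      have : u :: p.support = (p.cons h).support := by simp
      rw [this, List.isChain_iff_getElem]
      simp only [SimpleGraph.Walk.support_getElem_eq_getVert, SimpleGraph.Walk.length_support,
        SimpleGraph.Walk.length_cons, Nat.add_lt_add_iff_right]
    simp only [SimpleGraph.Walk.support_cons, Conf, e, ← ih]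
    constructor
    · intro H
      refine ⟨fun i hi => by simpa using H i 0 (by omega) (by simpa using hi), fun i j hij hi => ?_⟩
      simpa using H (i + 1) (j + 1) (by omega) (by simpa using hi)
    · rintro ⟨H₁, H₂⟩ i j hij hi
      simp only [SimpleGraph.Walk.length_cons] at hi
      cases j with
      | zero => simpa using H₁ i hi
      | succ j =>
        obtain ⟨i, rfl⟩ : ∃ i', i = i' + 1 := ⟨i - 1, by omega⟩
        simpa using H₂ i j (by omega) (by omega)

theorem exists_walk_iff_hasPath {G : SimpleGraph V} (f : V → Finset (Sym2 V)) (s t : V) :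
    (∃ p : G.Walk s t, p.IsPath ∧ IsConforming f p) ↔
      HasPath G.Adj (fun v a b => s(a, b) ∈ f v) s t := by
  constructor
  · rintro ⟨p, hp, hc⟩
    refine ⟨p.support, ?_, ?_, hp.support_nodup, p.isChain_adj_support, (isConforming_iff f p).1 hc⟩
    · rw [List.head?_eq_some_head p.support_ne_nil, p.head_support]
    · rw [List.getLast?_eq_some_getLast p.support_ne_nil, p.getLast_support]
  · rintro ⟨l, h⟩
    have hne : l ≠ [] := by rintro rfl; simpa using h.head
    have h₁ : l.head hne = s := by
      have := h.head; rw [List.head?_eq_some_head hne] at this; simpa using this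
    have h₂ : l.getLast hne = t := by
      have := h.last; rw [List.getLast?_eq_some_getLast hne] at this; simpa using this
    subst h₁ h₂
    refine ⟨.ofSupport l hne h.chain, ?_, ?_⟩
    · rw [SimpleGraph.Walk.isPath_def, SimpleGraph.Walk.support_ofSupport]; exact h.nodup
    · rw [isConforming_iff, SimpleGraph.Walk.support_ofSupport]; exact h.conf

/-- All vertices of a path with at least two vertices have neighbours. -/
theorem IsPathList.eq_or_exists {A : V → V → Prop} {D : V → V → V → Prop} {s t : V} {l : List V}
    (h : IsPathList A D s t l) {v : V} (hv : v ∈ l) : v = s ∨ ∃ u, A u v := by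
  obtain ⟨l₁, l₂, rfl⟩ := List.append_of_mem hv
  rcases List.eq_nil_or_concat l₁ with rfl | ⟨l₀, u, rfl⟩
  · left; simpa using h.head
  · right
    refine ⟨u, ?_⟩
    have := h.chain
    simp only [List.concat_eq_append, List.append_assoc, List.cons_append, List.nil_append] at this
    rw [List.isChain_append_cons_cons] at this
    exact this.2.1

/-- An inner vertex of a path is preceded and followed by distinct neighbours. -/
theorem IsPathList.exists_split {A : V → V → Prop} {D : V → V → V → Prop} {s t : V} {l : List V}
    (h : IsPathList A D s t l) {v : V} (hv : v ∈ l) (hs : v ≠ s) (ht : v ≠ t) :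
    ∃ l₁ a b l₂, l = l₁ ++ a :: v :: b :: l₂ ∧ a ≠ b ∧ A a v ∧ A v b := by
  obtain ⟨l₁, l₂, rfl⟩ := List.append_of_mem hv
  rcases List.eq_nil_or_concat l₁ with rfl | ⟨l₀, a, rfl⟩
  · exact absurd (by simpa using h.head) hs
  rcases l₂ with - | ⟨b, l₂⟩
  · exact absurd (by simpa using h.last) ht
  simp only [List.concat_eq_append, List.append_assoc, List.cons_append, List.nil_append] at h ⊢
  have h₁ := h.chain
  rw [List.isChain_append_cons_cons, List.isChain_cons_cons] at h₁
  refine ⟨l₀, a, b, l₂, rfl, ?_, h₁.2.1, h₁.2.2.1⟩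
  rintro rfl
  simpa [List.nodup_append] using h.nodup

end

/-! ### Instances and their encodings -/

/-- The data of an instance: number of vertices, source, target, adjacency matrix, and the adjacency
matrices of the deletion sets. -/
abbrev Raw := ℕ × ℕ × ℕ × List (List Bool) × List (List (List Bool)) × Unit

/-- The matrix with entries `A i j`, as a list of rows. -/
def tab (n : ℕ) (A : ℕ → ℕ → Bool) : List (List Bool) :=
  (List.range n).map fun i => (List.range n).map fun j => A i j

def rawOf (n s t : ℕ) (A : ℕ → ℕ → Bool) (D : ℕ → ℕ → ℕ → Bool) : Raw :=
  (n, s, t, tab n A, (List.range n).map fun v => tab n (D v), ())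

namespace Raw

def order (r : Raw) : ℕ := r.1
def src (r : Raw) : ℕ := r.2.1
def tgt (r : Raw) : ℕ := r.2.2.1
def adj (r : Raw) (i j : ℕ) : Bool := (r.2.2.2.1.getD i []).getD j false
def del (r : Raw) (v i j : ℕ) : Bool := ((r.2.2.2.2.1.getD v []).getD i []).getD j false

end Raw

theorem getD_map_range {β : Type*} (n i : ℕ) (g : ℕ → β) (d : β) :
    ((List.range n).map g).getD i d = if i < n then g i else d := by
  rw [List.getD_eq_getElem?_getD, List.getElem?_map]
  split_ifs with h
  · rw [List.getElem?_range h]; rfl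
  · rw [List.getElem?_eq_none (by simpa using h)]; rfl

@[simp] theorem order_rawOf (n s t : ℕ) (A D) : (rawOf n s t A D).order = n := rfl
@[simp] theorem src_rawOf (n s t : ℕ) (A D) : (rawOf n s t A D).src = s := rfl
@[simp] theorem tgt_rawOf (n s t : ℕ) (A D) : (rawOf n s t A D).tgt = t := rfl

theorem getD_tab (n : ℕ) (A : ℕ → ℕ → Bool) (i j : ℕ) :
    ((tab n A).getD i []).getD j false = (decide (i < n ∧ j < n) && A i j) := by
  rw [tab, getD_map_range]
  by_cases hi : i < n
  · rw [if_pos hi, getD_map_range]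
    by_cases hj : j < n <;> simp [hi, hj]
  · simp [hi]

theorem adj_rawOf (n s t : ℕ) (A D) (i j : ℕ) :
    (rawOf n s t A D).adj i j = (decide (i < n ∧ j < n) && A i j) := getD_tab n A i j

theorem del_rawOf (n s t : ℕ) (A D) (v i j : ℕ) :
    (rawOf n s t A D).del v i j = (decide (v < n ∧ i < n ∧ j < n) && D v i j) := by
  show ((((List.range n).map fun v => tab n (D v)).getD v []).getD i []).getD j false = _
  rw [getD_map_range]
  by_cases hv : v < n
  · rw [if_pos hv, getD_tab]; simp [hv]
  · simp [hv]

namespace Instance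

open Classical in
noncomputable def adjB (x : Instance) (i j : ℕ) : Bool :=
  decide (∃ (hi : i < x.n) (hj : j < x.n), x.G.Adj ⟨i, hi⟩ ⟨j, hj⟩)

open Classical in
noncomputable def delB (x : Instance) (v i j : ℕ) : Bool :=
  decide (∃ (hv : v < x.n) (hi : i < x.n) (hj : j < x.n), s(⟨i, hi⟩, ⟨j, hj⟩) ∈ x.f ⟨v, hv⟩)

noncomputable def toRaw (x : Instance) : Raw := rawOf x.n x.s x.t x.adjB x.delB

theorem ofFn_eq_map_range {β : Type*} (n : ℕ) (g : Fin n → β) (h : ℕ → β) (hg : ∀ i : Fin n, g i = h i) :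
    List.ofFn g = (List.range n).map h := by
  apply List.ext_getElem
  · simp
  · intro i h₁ h₂
    simp [hg]

theorem encode_eq (x : Instance) : x.encode = enc x.toRaw := by
  have h : ∀ (M : Fin x.n → Fin x.n → Bool) (A : ℕ → ℕ → Bool), (∀ i j : Fin x.n, M i j = A i j) →
      Data.ofMatrix M = enc (tab x.n A) := by
    intro M A hM
    simp only [Data.ofMatrix, enc, tab, List.map_map]
    congr 1
    refine ofFn_eq_map_range _ _ _ fun i => ?_
    simp only [Function.comp, List.map_map]
    congr 1
    exact ofFn_eq_map_range _ _ _ fun j => by rw [hM]; rfl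
  have h₁ := h (fun i j => @decide (x.G.Adj i j) (Classical.propDecidable _)) x.adjB
    (fun i j => by simp [adjB])
  have h₂ : ∀ inst : ∀ v i j, Decidable (s(i, j) ∈ x.f v),
      Data.ofList (List.ofFn fun v => .ofMatrix fun i j => @decide _ (inst v i j)) =
      enc ((List.range x.n).map fun v => tab x.n (x.delB v)) := by
    intro inst
    simp only [enc, List.map_map]
    congr 1
    refine ofFn_eq_map_range _ _ _ fun v => ?_
    exact h _ _ fun i j => by simp [delB]
  rw [encode, h₁, h₂ fun _ _ _ => _]
  rfl

theorem size_eq (x : Instance) : x.size = sz x.toRaw := by rw [size, encode_eq]; rfl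

@[simp] theorem order_toRaw (x : Instance) : x.toRaw.order = x.n := rfl
@[simp] theorem src_toRaw (x : Instance) : x.toRaw.src = x.s := rfl
@[simp] theorem tgt_toRaw (x : Instance) : x.toRaw.tgt = x.t := rfl

@[simp] theorem adj_toRaw (x : Instance) : x.toRaw.adj = x.adjB := by
  funext i j
  rw [toRaw, adj_rawOf, Bool.eq_iff_iff]
  simp only [adjB, Bool.and_eq_true, decide_eq_true_eq]
  exact ⟨fun h => h.2, fun h => ⟨⟨h.1, h.2.1⟩, h⟩⟩

@[simp] theorem del_toRaw (x : Instance) : x.toRaw.del = x.delB := by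
  funext v i j
  rw [toRaw, del_rawOf, Bool.eq_iff_iff]
  simp only [delB, Bool.and_eq_true, decide_eq_true_eq]
  exact ⟨fun h => h.2, fun h => ⟨⟨h.1, h.2.1, h.2.2.1⟩, h⟩⟩

theorem adjB_lt {x : Instance} {i j : ℕ} (h : x.adjB i j) : i < x.n ∧ j < x.n := by
  simp only [adjB, decide_eq_true_eq] at h
  exact ⟨h.1, h.2.1⟩

theorem adjB_symm (x : Instance) (i j : ℕ) : x.adjB i j = x.adjB j i := by
  rw [Bool.eq_iff_iff]
  simp only [adjB, decide_eq_true_eq]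
  exact ⟨fun ⟨h₁, h₂, h⟩ => ⟨h₂, h₁, h.symm⟩, fun ⟨h₁, h₂, h⟩ => ⟨h₂, h₁, h.symm⟩⟩

theorem adjB_self (x : Instance) (i : ℕ) : x.adjB i i = false := by
  simp [adjB]

theorem delB_symm (x : Instance) (v i j : ℕ) : x.delB v i j = x.delB v j i := by
  rw [Bool.eq_iff_iff]
  simp only [delB, decide_eq_true_eq]
  constructor <;> rintro ⟨h₀, h₁, h₂, h⟩ <;> exact ⟨h₀, h₂, h₁, by rwa [Sym2.eq_swap]⟩

theorem adjB_of_delB {x : Instance} {v i j : ℕ} (h : x.delB v i j) : x.adjB i j := by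
  simp only [delB, adjB, decide_eq_true_eq] at *
  obtain ⟨h₀, h₁, h₂, h⟩ := h
  exact ⟨h₁, h₂, by simpa using x.f_subset _ h⟩

@[simp] theorem adjB_val (x : Instance) (i j : Fin x.n) : x.adjB i j ↔ x.G.Adj i j := by
  simp [adjB]

@[simp] theorem delB_val (x : Instance) (v i j : Fin x.n) : x.delB v i j ↔ s(i, j) ∈ x.f v := by
  simp [delB]

/-- Yes-instances in terms of natural numbers as vertices. -/
theorem isYes_iff (x : Instance) :
    x.IsYes ↔ HasPath (fun i j => x.adjB i j) (fun v i j => x.delB v i j) x.s x.t := by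
  rw [IsYes, exists_walk_iff_hasPath]
  have := hasPath_comap_iff (Fin.val_injective (n := x.n)) (fun i j => x.adjB i j)
    (fun v i j => x.delB v i j) x.s x.t
  simp only [adjB_val, delB_val] at this
  rw [this]
  constructor
  · rintro ⟨l, h, -⟩; exact ⟨l, h⟩
  · rintro ⟨l, h⟩
    refine ⟨l, h, fun v hv => ?_⟩
    rcases h.eq_or_exists hv with rfl | ⟨u, hu⟩
    · simp
    · exact ⟨⟨v, (adjB_lt hu).2⟩, rfl⟩

/-- The instance given by Boolean-valued relations on the natural numbers. -/
def ofFun (n : ℕ) (A : ℕ → ℕ → Bool) (D : ℕ → ℕ → ℕ → Bool) (s t : ℕ) (hs : s < n) (ht : t < n)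
    (hA : ∀ i j, A i j = A j i) (hA' : ∀ i, A i i = false) (hD : ∀ v i j, D v i j → A i j) :
    Instance where
  n := n
  G := { Adj := fun i j => A i j, symm := ⟨fun i j h => by rwa [hA]⟩,
         loopless := ⟨fun i h => by simp [hA'] at h⟩ }
  f v := (Finset.univ.filter fun p : Fin n × Fin n => D v p.1 p.2).image fun p => s(p.1, p.2)
  f_subset v := by
    intro e he
    simp only [Finset.coe_image, Set.mem_image] at he
    obtain ⟨p, hp, rfl⟩ := he
    simp only [Finset.coe_filter, Set.mem_ofPred_eq] at hp
    exact hD _ _ _ hp.2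
  s := ⟨s, hs⟩
  t := ⟨t, ht⟩

theorem mem_ofFun_f {n : ℕ} {A : ℕ → ℕ → Bool} {D : ℕ → ℕ → ℕ → Bool} {s t hs ht hA hA' hD}
    (hD' : ∀ v i j, D v i j = D v j i) (v i j : Fin n) :
    s(i, j) ∈ (ofFun n A D s t hs ht hA hA' hD).f v ↔ D v i j := by
  show s(i, j) ∈ Finset.image _ _ ↔ _
  simp only [Finset.mem_image, Finset.mem_filter, Finset.mem_univ, true_and, Prod.exists,
    Sym2.eq_iff]
  constructor
  · rintro ⟨a, b, h, ⟨rfl, rfl⟩ | ⟨rfl, rfl⟩⟩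
    · exact h
    · rwa [hD']
  · intro h
    exact ⟨i, j, h, Or.inl ⟨rfl, rfl⟩⟩

theorem adjB_ofFun {n : ℕ} {A : ℕ → ℕ → Bool} {D : ℕ → ℕ → ℕ → Bool} {s t hs ht hA hA' hD}
    (i j : ℕ) : (ofFun n A D s t hs ht hA hA' hD).adjB i j = (decide (i < n ∧ j < n) && A i j) := by
  rw [Bool.eq_iff_iff]
  simp only [adjB, ofFun, exists_prop, decide_eq_true_eq, Bool.and_eq_true, and_assoc]

theorem delB_ofFun {n : ℕ} {A : ℕ → ℕ → Bool} {D : ℕ → ℕ → ℕ → Bool} {s t hs ht hA hA' hD}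
    (hD' : ∀ v i j, D v i j = D v j i) (v i j : ℕ) :
    (ofFun n A D s t hs ht hA hA' hD).delB v i j = (decide (v < n ∧ i < n ∧ j < n) && D v i j) := by
  rw [Bool.eq_iff_iff]
  simp only [delB, decide_eq_true_eq, Bool.and_eq_true]
  constructor
  · rintro ⟨h₁, h₂, h₃, h⟩
    exact ⟨⟨h₁, h₂, h₃⟩, (mem_ofFun_f hD' _ _ _).1 h⟩
  · rintro ⟨⟨h₁, h₂, h₃⟩, h⟩
    exact ⟨h₁, h₂, h₃, (mem_ofFun_f hD' ⟨v, h₁⟩ ⟨i, h₂⟩ ⟨j, h₃⟩).2 h⟩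

theorem toRaw_ofFun {n : ℕ} {A : ℕ → ℕ → Bool} {D : ℕ → ℕ → ℕ → Bool} {s t hs ht hA hA' hD}
    (hD' : ∀ v i j, D v i j = D v j i) :
    (ofFun n A D s t hs ht hA hA' hD).toRaw = rawOf n s t A D := by
  have hcongr : ∀ (A B : ℕ → ℕ → Bool), (∀ i < n, ∀ j < n, A i j = B i j) → tab n A = tab n B := by
    intro A B h
    refine List.map_congr_left fun i hi => List.map_congr_left fun j hj => ?_
    exact h i (List.mem_range.1 hi) j (List.mem_range.1 hj)
  have h₁ : tab n (ofFun n A D s t hs ht hA hA' hD).adjB = tab n A :=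
    hcongr _ _ fun i hi j hj => by simp [adjB_ofFun, hi, hj]
  have h₂ : ((List.range n).map fun v => tab n ((ofFun n A D s t hs ht hA hA' hD).delB v)) =
      (List.range n).map fun v => tab n (D v) := by
    refine List.map_congr_left fun v hv => hcongr _ _ fun i hi j hj => ?_
    simp [delB_ofFun hD', hi, hj, List.mem_range.1 hv]
  show rawOf n s t _ _ = _
  unfold rawOf
  rw [h₁, h₂]

end Instance

/-- The size of an encoding is bounded by a polynomial in the number of vertices. -/
theorem sz_rawOf_le (n s t : ℕ) (A D) :
    sz (rawOf n s t A D) ≤ 50 * (n + 1) ^ 3 + 2 * s + 2 * t := by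
  have h₁ : ∀ A, sz (tab n A) ≤ n * ((n * 4 + 1) + 1) + 1 := by
    intro A
    refine (sz_list_le (c := n * 4 + 1) ?_).trans (by simp [tab])
    intro a ha
    obtain ⟨i, -, rfl⟩ := List.mem_map.1 ha
    refine (sz_list_le (c := 3) fun b _ => sz_bool b).trans (by simp)
  have h₂ : sz ((List.range n).map fun v => tab n (D v)) ≤ n * ((n * ((n * 4 + 1) + 1) + 1) + 1) + 1 := by
    refine (sz_list_le (c := n * ((n * 4 + 1) + 1) + 1) ?_).trans (by simp)
    intro a ha
    obtain ⟨i, -, rfl⟩ := List.mem_map.1 ha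
    exact h₁ _
  have h₃ := h₁ A
  simp only [rawOf, sz_pair, sz_nat, sz_unit]
  nlinarith [sq_nonneg n]

theorem Instance.size_le (x : Instance) : x.size ≤ 100 * (x.n + 1) ^ 3 := by
  rw [Instance.size_eq]
  refine (sz_rawOf_le _ _ _ _ _).trans ?_
  have h₁ := x.s.2
  have h₂ := x.t.2
  have h₃ : x.n + 1 ≤ (x.n + 1) ^ 3 := Nat.le_self_pow (by norm_num) _
  omega

/-! ### Polynomial-time access to encodings, and vertex renumbering. -/

section

variable {α : Type} [Enc α]

@[fun_prop]
theorem PolyFn.order {r : α → Raw} (hr : PolyFn r) : PolyFn (fun a => (r a).order) := by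
  unfold Raw.order; fun_prop

@[fun_prop]
theorem PolyFn.src {r : α → Raw} (hr : PolyFn r) : PolyFn (fun a => (r a).src) := by
  unfold Raw.src; fun_prop

@[fun_prop]
theorem PolyFn.tgt {r : α → Raw} (hr : PolyFn r) : PolyFn (fun a => (r a).tgt) := by
  unfold Raw.tgt; fun_prop

@[fun_prop]
theorem PolyFn.adj {r : α → Raw} {i j : α → ℕ} (hr : PolyFn r) (hi : PolyFn i) (hj : PolyFn j) :
    PolyFn (fun a => (r a).adj (i a) (j a)) := by
  unfold Raw.adj; fun_prop

@[fun_prop]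
theorem PolyFn.del {r : α → Raw} {v i j : α → ℕ} (hr : PolyFn r) (hv : PolyFn v) (hi : PolyFn i)
    (hj : PolyFn j) : PolyFn (fun a => (r a).del (v a) (i a) (j a)) := by
  unfold Raw.del; fun_prop

theorem PolyFn.rawOf {n s t : α → ℕ} {A : α → ℕ → ℕ → Bool} {D : α → ℕ → ℕ → ℕ → Bool}
    (hn : PolyFn n) (hs : PolyFn s) (ht : PolyFn t)
    (hA : PolyFn fun p : (α × ℕ) × ℕ => A p.1.1 p.1.2 p.2)
    (hD : PolyFn fun p : ((α × ℕ) × ℕ) × ℕ => D p.1.1.1 p.1.1.2 p.1.2 p.2) :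
    PolyFn (fun a => rawOf (n a) (s a) (t a) (A a) (D a)) := by
  have h₁ : PolyFn (fun a => tab (n a) (A a)) :=
    .map (by fun_prop) (.map (f := fun (p : α × ℕ) j => A p.1 p.2 j) (by fun_prop) hA)
  have h₂ : PolyFn (fun a => (List.range (n a)).map fun v => tab (n a) (D a v)) :=
    .map (by fun_prop) (.map
      (f := fun (p : α × ℕ) i => (List.range (n p.1)).map fun j => D p.1 p.2 i j)
      (by fun_prop) (.map (f := fun (p : (α × ℕ) × ℕ) j => D p.1.1 p.1.2 p.2 j) (by fun_prop) hD))
  unfold SelfDeleting.rawOf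
  fun_prop

/-- The vertices below `n` that satisfy `K`, in increasing order. -/
def keepList (n : ℕ) (K : ℕ → Bool) : List ℕ := (List.range n).filter K

/-- The encoding of the instance induced on the vertices that satisfy `K`. -/
def subRaw (r : Raw) (K : ℕ → Bool) : Raw :=
  rawOf (keepList r.order K).length (keepList r.src K).length (keepList r.tgt K).length
    (fun i j => r.adj ((keepList r.order K).getD i 0) ((keepList r.order K).getD j 0))
    (fun v i j => r.del ((keepList r.order K).getD v 0) ((keepList r.order K).getD i 0)
      ((keepList r.order K).getD j 0))

theorem PolyFn.subRaw {r : α → Raw} {K : α → ℕ → Bool} (hr : PolyFn r)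
    (hK : PolyFn fun p : α × ℕ => K p.1 p.2) : PolyFn (fun a => subRaw (r a) (K a)) := by
  have hL : PolyFn (fun a => keepList (r a).order (K a)) := by unfold keepList; fun_prop
  have hs : PolyFn (fun a => keepList (r a).src (K a)) := by unfold keepList; fun_prop
  have ht : PolyFn (fun a => keepList (r a).tgt (K a)) := by unfold keepList; fun_prop
  have key : ∀ L : α → List ℕ, PolyFn L → PolyFn (fun a => SelfDeleting.rawOf (L a).length
      (keepList (r a).src (K a)).length (keepList (r a).tgt (K a)).length
      (fun i j => (r a).adj ((L a).getD i 0) ((L a).getD j 0))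
      (fun v i j => (r a).del ((L a).getD v 0) ((L a).getD i 0) ((L a).getD j 0))) :=
    fun L hL => PolyFn.rawOf (by fun_prop) (by fun_prop) (by fun_prop) (by fun_prop) (by fun_prop)
  exact key _ hL

end

theorem mem_keepList {n : ℕ} {K : ℕ → Bool} {v : ℕ} : v ∈ keepList n K ↔ v < n ∧ K v := by
  simp [keepList]

theorem nodup_keepList (n : ℕ) (K : ℕ → Bool) : (keepList n K).Nodup :=
  List.nodup_range.filter _

theorem length_keepList (n : ℕ) (K : ℕ → Bool) :
    (keepList n K).length = ((Finset.range n).filter fun v => K v).card := by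
  rw [← List.toFinset_card_of_nodup (nodup_keepList n K)]
  congr 1
  ext v
  simp [mem_keepList]

/-- The kept vertices below `v` come first in the increasing enumeration, so the new number of `v`
is their count. This is why `subRaw` computes source and target as lengths. -/
theorem keepList_split {n v : ℕ} {K : ℕ → Bool} (hv : v < n) (hK : K v) :
    ∃ l, keepList n K = keepList v K ++ v :: l := by
  obtain ⟨k, rfl⟩ : ∃ k, n = v + (k + 1) := ⟨n - v - 1, by omega⟩
  refine ⟨((List.range k).map fun i => v + (i + 1)).filter K, ?_⟩
  simp [keepList, List.range_add, List.range_succ_eq_map, hK, Function.comp_def]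

/-! ### Induced instances and crude bounds on the parameters. -/

namespace Instance

section

variable (x : Instance) (K : ℕ → Bool)

theorem keepList_getD_lt {v n : ℕ} {K : ℕ → Bool} (hv : v < n) (hK : K v) :
    (keepList v K).length < (keepList n K).length ∧
      (keepList n K).getD (keepList v K).length 0 = v := by
  obtain ⟨l, hl⟩ := keepList_split hv hK
  rw [hl]
  simp

/-- The instance induced on the vertices that satisfy `K`. -/
noncomputable def sub (hs : K x.s) (ht : K x.t) : Instance :=
  ofFun (keepList x.n K).length
    (fun i j => x.adjB ((keepList x.n K).getD i 0) ((keepList x.n K).getD j 0))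
    (fun v i j => x.delB ((keepList x.n K).getD v 0) ((keepList x.n K).getD i 0)
      ((keepList x.n K).getD j 0))
    (keepList x.s K).length (keepList x.t K).length
    (keepList_getD_lt x.s.2 hs).1 (keepList_getD_lt x.t.2 ht).1
    (fun _ _ => x.adjB_symm _ _) (fun _ => x.adjB_self _) (fun _ _ _ => adjB_of_delB)

variable {K} (hs : K x.s) (ht : K x.t)

theorem toRaw_sub : (x.sub K hs ht).toRaw = subRaw x.toRaw K := by
  rw [sub, toRaw_ofFun (by intro v i j; exact x.delB_symm _ _ _), subRaw, adj_toRaw, del_toRaw]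
  rfl

theorem n_sub : (x.sub K hs ht).n = ((Finset.range x.n).filter fun v => K v).card :=
  length_keepList _ _

/-- The embedding of the vertices of an induced instance. -/
noncomputable def subEmb (i : Fin (x.sub K hs ht).n) : Fin x.n :=
  ⟨(keepList x.n K).getD i 0, by
    have hi : i.1 < (keepList x.n K).length := i.2
    rw [List.getD_eq_getElem _ _ hi]
    exact (mem_keepList.1 (List.getElem_mem _)).1⟩

theorem subEmb_injective : Function.Injective (x.subEmb hs ht) := by
  intro i j h
  have hi : i.1 < (keepList x.n K).length := i.2
  have hj : j.1 < (keepList x.n K).length := j.2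
  have h' : (keepList x.n K).getD i 0 = (keepList x.n K).getD j 0 := congrArg Fin.val h
  rw [List.getD_eq_getElem _ _ hi, List.getD_eq_getElem _ _ hj] at h'
  exact Fin.ext ((nodup_keepList x.n K).getElem_inj_iff.1 h')

theorem exists_subEmb_iff (v : ℕ) : (∃ i, (x.subEmb hs ht i : ℕ) = v) ↔ v < x.n ∧ K v := by
  rw [← mem_keepList, List.mem_iff_getElem]
  constructor
  · rintro ⟨i, rfl⟩
    have hi : i.1 < (keepList x.n K).length := i.2
    exact ⟨i, hi, (List.getD_eq_getElem _ _ hi).symm⟩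
  · rintro ⟨i, hi, rfl⟩
    exact ⟨⟨i, hi⟩, List.getD_eq_getElem _ _ hi⟩

theorem adj_sub (i j : Fin (x.sub K hs ht).n) :
    (x.sub K hs ht).G.Adj i j ↔ x.G.Adj (x.subEmb hs ht i) (x.subEmb hs ht j) :=
  x.adjB_val (x.subEmb hs ht i) (x.subEmb hs ht j)

theorem mem_f_sub (v i j : Fin (x.sub K hs ht).n) :
    s(i, j) ∈ (x.sub K hs ht).f v ↔
      s(x.subEmb hs ht i, x.subEmb hs ht j) ∈ x.f (x.subEmb hs ht v) := by
  rw [← delB_val x]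
  have hD : ∀ v i j, (fun v i j => x.delB ((keepList x.n K).getD v 0) ((keepList x.n K).getD i 0)
      ((keepList x.n K).getD j 0)) v i j = (fun v i j => x.delB ((keepList x.n K).getD v 0)
      ((keepList x.n K).getD i 0) ((keepList x.n K).getD j 0)) v j i :=
    fun _ _ _ => x.delB_symm _ _ _
  exact mem_ofFun_f hD v i j

theorem isYes_sub : (x.sub K hs ht).IsYes ↔
    ∃ l, IsPathList (fun i j => x.adjB i j) (fun v i j => x.delB v i j) x.s x.t l ∧
      ∀ v ∈ l, K v := by
  rw [IsYes, exists_walk_iff_hasPath]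
  have e₁ : (x.sub K hs ht).G.Adj =
      fun i j => (x.adjB (x.subEmb hs ht i) (x.subEmb hs ht j) : Prop) := by
    funext i j
    rw [eq_iff_iff, adj_sub, adjB_val]
  simp only [e₁, mem_f_sub, ← delB_val x]
  rw [hasPath_comap_iff (e := fun i => (x.subEmb hs ht i : ℕ))
    (Fin.val_injective.comp (x.subEmb_injective hs ht)) (fun i j => x.adjB i j)
    (fun v i j => x.delB v i j)]
  have h₁ : (x.subEmb hs ht (x.sub K hs ht).s : ℕ) = x.s := (keepList_getD_lt x.s.2 hs).2
  have h₂ : (x.subEmb hs ht (x.sub K hs ht).t : ℕ) = x.t := (keepList_getD_lt x.t.2 ht).2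
  rw [h₁, h₂]
  refine exists_congr fun l => and_congr_right fun h => forall₂_congr fun v hv => ?_
  rw [Set.mem_range, x.exists_subEmb_iff hs ht]
  refine and_iff_right ?_
  rcases h.eq_or_exists hv with rfl | ⟨u, hu⟩
  · exact x.s.2
  · exact (adjB_lt hu).2

/-- Keeping all inner vertices of paths yields an equivalent instance. -/
theorem isYes_sub_iff (hK : ∀ l, IsPathList (fun i j => x.adjB i j) (fun v i j => x.delB v i j)
    x.s x.t l → ∀ v ∈ l, K v) : (x.sub K hs ht).IsYes ↔ x.IsYes := by
  rw [isYes_sub, isYes_iff]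
  exact exists_congr fun l => ⟨And.left, fun h => ⟨h, hK l h⟩⟩

end

theorem numEdges_le (x : Instance) : x.numEdges ≤ x.n ^ 2 := by
  have h : x.G.edgeSet ⊆ Set.range fun p : Fin x.n × Fin x.n => s(p.1, p.2) := by
    intro e _
    induction e with
    | _ a b => exact ⟨(a, b), rfl⟩
  rw [numEdges]
  refine (Set.ncard_le_ncard h (Set.toFinite _)).trans ?_
  rw [← Set.image_univ]
  refine (Set.ncard_image_le (Set.toFinite _)).trans ?_
  simp [Set.ncard_univ, sq]

theorem fen_le (x : Instance) : x.fen ≤ x.n ^ 2 := by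
  classical
  refine le_trans ?_ x.numEdges_le
  refine Nat.sInf_le ⟨x.G.edgeSet.toFinite.toFinset, by simp, ?_, ?_⟩
  · simp
  · rw [numEdges, Set.ncard_eq_toFinset_card]

theorem vcn_le (x : Instance) : x.vcn ≤ x.n := by
  have h := (SimpleGraph.isVertexCover_univ (G := x.G)).vertexCoverNum_le
  simp only [Set.encard_univ, ENat.card_eq_coe_fintype_card, Fintype.card_fin] at h
  exact ENat.toNat_le_of_le_natCast h

theorem mu_le (x : Instance) : x.mu ≤ x.n ^ 2 := by
  refine Finset.sup_le fun v _ => le_trans ?_ x.numEdges_le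
  rw [numEdges, ← Set.ncard_coe_finset]
  exact Set.ncard_le_ncard (x.f_subset v) (Set.toFinite _)

end Instance

/-- A polynomial-time function that maps instances to equivalent ones with few vertices and edges is a
kernel. -/
theorem hasKernel_of_polyFn {C : Instance → Prop} {κ : Instance → ℕ} {N M : ℕ → ℕ} (a : ℕ)
    (F : Raw → Raw) (hF : PolyFn F) (hκ : ∀ x, κ x ≤ x.n ^ 2) (hN : ∀ k, N k ≤ a * k + a)
    (h : ∀ x, C x → ∃ x' : Instance, F x.toRaw = x'.toRaw ∧ C x' ∧ (x'.IsYes ↔ x.IsYes) ∧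
      x'.n ≤ N (κ x) ∧ x'.numEdges ≤ M (κ x)) : HasKernel C κ N M := by
  obtain ⟨prog, p, hp⟩ := hF
  -- The output has n' ≤ ak + a vertices, its encoding has size at most 100(n' + 1)³, and its
  -- parameter is at most n'². No comparison with the parameter of the input is needed.
  refine ⟨prog, p, (100 * (.C a * .X + .C a + 1) ^ 3 + (.C a * .X + .C a) ^ 2), fun x hx => ?_⟩
  obtain ⟨x', h₁, h₂, h₃, h₄, h₅⟩ := h x hx
  obtain ⟨t, ht, ht'⟩ := hp noOracle x.toRaw
  refine ⟨x', t, ?_, ?_, h₂, h₃, ?_, h₄, h₅⟩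
  · rw [x.encode_eq, x'.encode_eq, ← h₁]; exact ht
  · rw [x.size_eq]; exact ht'.trans (eval_mono _ (by omega))
  · have h₆ := h₄.trans (hN _)
    have h₇ := x'.size_le
    have h₈ := hκ x'
    simp only [Polynomial.eval_add, Polynomial.eval_mul, Polynomial.eval_pow, Polynomial.eval_C,
      Polynomial.eval_X, Polynomial.eval_one, Polynomial.eval_ofNat]
    refine add_le_add (h₇.trans ?_) (h₈.trans ?_) <;> gcongr

/-! ### The Turing kernel for cliques -/

/-- Yes-instances in terms of their encodings. -/
def Raw.IsYes (r : Raw) : Prop :=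
  HasPath (fun i j => r.adj i j) (fun v i j => r.del v i j) r.src r.tgt

theorem Instance.isYes_toRaw (x : Instance) : x.toRaw.IsYes ↔ x.IsYes := by
  rw [Raw.IsYes, Instance.isYes_iff]
  simp

theorem Conf.of_append {V : Type*} {D : V → V → V → Prop} {l₁ l₂ : List V}
    (h : Conf D (l₁ ++ l₂)) : Conf D l₂ := by
  induction l₁ with
  | nil => exact h
  | cons v l ih => exact ih h.2

/-- On a clique, a shortest conforming path leaves `s` for some vertex and from then on visits only
vertices `u` for which `s` deletes the edge `su`. -/
theorem exists_isPathList_of_clique {V : Type*} {A : V → V → Prop} {D : V → V → V → Prop} {s t : V}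
    (hA : ∀ l, IsPathList A D s t l → ∀ a ∈ l, ∀ b ∈ l, a ≠ b → A a b) (h : HasPath A D s t) :
    ∃ (v : V) (l : List V), IsPathList A D s t l ∧ v ∈ l ∧ ∀ u ∈ l, u = s ∨ u = v ∨ D s s u := by
  classical
  have hex : ∃ n l, IsPathList A D s t l ∧ l.length = n := by
    obtain ⟨l, hl⟩ := h
    exact ⟨_, l, hl, rfl⟩
  obtain ⟨l, hl, hlen⟩ := Nat.find_spec hex
  have hmin : ∀ m, IsPathList A D s t m → l.length ≤ m.length := by
    intro m hm
    rw [hlen]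
    exact Nat.find_min' hex ⟨m, hm, rfl⟩
  rcases l with - | ⟨s', l⟩
  · simpa using hl.head
  obtain rfl : s' = s := by simpa using hl.head
  rcases l with - | ⟨v, l⟩
  · exact ⟨s', _, hl, by simp, by simp⟩
  refine ⟨v, _, hl, by simp, ?_⟩
  intro u hu
  simp only [List.mem_cons] at hu
  rcases hu with rfl | rfl | hu
  · simp
  · simp
  right; right
  by_contra hD
  obtain ⟨l₁, l₂, rfl⟩ := List.append_of_mem hu
  have hne : s' ≠ u := by
    rintro rfl
    simpa using hl.nodup
  have hsub : List.Sublist (s' :: u :: l₂) (s' :: v :: (l₁ ++ u :: l₂)) :=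
    ((List.sublist_append_right _ _).cons _).cons_cons _
  have hsuf : u :: l₂ <:+ s' :: v :: (l₁ ++ u :: l₂) := ⟨s' :: v :: l₁, by simp⟩
  have hconf := hl.conf
  -- The shortcut from `s'` to `u` has been left open by `s'`, and the remaining constraints are
  -- among those of the old path, so minimality is violated.
  have := hmin (s' :: u :: l₂) ⟨rfl, ?_, hl.nodup.sublist hsub, ?_, ?_, ?_⟩
  · simp at this
    omega
  · rw [← hl.last, ← List.singleton_append, List.getLast?_append_of_ne_nil _ (by simp)]
    have e : s' :: v :: (l₁ ++ u :: l₂) = (s' :: v :: l₁) ++ (u :: l₂) := by simp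
    rw [e, List.getLast?_append_of_ne_nil _ (by simp)]
  · rw [List.isChain_cons_cons]
    exact ⟨hA _ hl _ (by simp) _ (by simp) hne, hl.chain.suffix hsuf⟩
  · rw [List.isChain_cons_cons]
    exact ⟨hD, hconf.1.suffix hsuf⟩
  · exact Conf.of_append (l₁ := s' :: v :: l₁) (by simpa using hconf)

/-- The vertices of the instance queried for the vertex `v`. -/
def cliqueKeep (r : Raw) (v u : ℕ) : Bool :=
  u == r.src || u == r.tgt || u == v || r.del r.src r.src u

/-- The encodings of the queried instances. -/
def cliqueQueries (r : Raw) : List Raw :=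
  (List.range r.order).map fun v => subRaw r (cliqueKeep r v)

theorem polyFn_cliqueQueries : PolyFn cliqueQueries := by
  refine PolyFn.map (by fun_prop) (PolyFn.subRaw (by fun_prop) ?_)
  unfold cliqueKeep
  fun_prop

/-- A list of oracle queries can be evaluated in polynomial time. -/
theorem exists_run_any (Q : Raw → List Raw) (hQ : PolyFn Q) :
    ∃ (prog : Prog) (p : Polynomial ℕ), ∀ (O : Data → Bool → Prop) (r : Raw) (ans : Raw → Bool),
      (∀ q ∈ Q r, O (enc q) (ans q)) →
      ∃ t, Run O prog (enc r) (.ofBool ((Q r).any ans)) t ∧ t ≤ p.eval (sz r) := by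
  obtain ⟨rQ, hrQ⟩ := hQ.sz_le
  have hini : PolyFn (fun r => ((), false, Q r)) := by fun_prop
  have hend : PolyFn (fun p : Unit × Bool × List Raw => p.2.1) := by fun_prop
  obtain ⟨I, pI, hI⟩ := hini
  obtain ⟨E, pE, hE⟩ := hend
  obtain ⟨c, pc, hc⟩ := PolyFn.const (α := Unit × Bool × Raw) true
  -- The state tells whether an earlier query has been answered positively; if so, it stays true and
  -- the oracle is not asked again.
  let g : Prog := .cond (.seq .snd .fst) c (.seq (.seq .snd .snd) .query)
  refine ⟨.seq I (.seq (foldProg g) E),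
    1 + .X + pI + (1 + (rQ + 6) + (rQ + 1) * ((10 * (rQ + 20) + pc.comp (rQ + 6))
      + 100 * ((rQ + 3) + 1)) + pE.comp 7), fun O r ans hans => ?_⟩
  have hs := hrQ r
  obtain ⟨t₁, h₁, h₁'⟩ := hI O r
  obtain ⟨t₂, h₂', h₂⟩ := run_foldProg O g () (fun s q => s || ans q)
    (fun _ l => l.Sublist (Q r)) (rQ.eval (sz r) + 3)
    (10 * (rQ.eval (sz r) + 20) + pc.eval (rQ.eval (sz r) + 6))
    (by simp)
    (by
      intro s l hl
      have := sz_bool s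
      have := sz_le_of_sublist hl
      omega)
    (by
      intro s q l hl
      refine ⟨(List.sublist_cons_self _ _).trans hl, ?_⟩
      have hq : q ∈ Q r := hl.subset (by simp)
      have hsq := (sz_le_of_mem hq).trans hs
      have hss := sz_bool s
      obtain ⟨t, ht, ht'⟩ := hc O ((), s, q)
      have ht'' := ht'.trans (eval_mono pc (n := rQ.eval (sz r) + 6) (by simp; omega))
      cases s
      · refine ⟨_, ?_, Run.cond_false (Run.seq (Run.snd _) (Run.fst _))
          (Run.seq (Run.seq (Run.snd _) (Run.snd _)) (Run.query (b := ans q) (hans q hq)))⟩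
        have e₀ : (enc ()).size = 1 := rfl
        simp only [sz] at *
        simp only [enc_pair, Data.right, Data.size, e₀] at *
        omega
      · refine ⟨_, ?_, Run.cond_true (Run.seq (Run.snd _) (Run.fst _))
          (by simp [enc, Data.left, Data.right, Data.ofBool]) ht⟩
        have e₀ : (enc ()).size = 1 := rfl
        simp only [sz] at *
        simp only [enc_pair, Data.right, Data.size, e₀] at *
        omega) false (Q r) (List.Sublist.refl _)
  have hany : ∀ (l : List Raw) (b : Bool), l.foldl (fun s q => s || ans q) b = (b || l.any ans) := by
    intro l
    induction l with
    | nil => simp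
    | cons a l ih => intro b; simp [ih, Bool.or_assoc]
  rw [hany, Bool.false_or] at h₂
  obtain ⟨t₃, h₃, h₃'⟩ := hE O ((), (Q r).any ans, [])
  refine ⟨_, Run.seq h₁ (Run.seq h₂ h₃), ?_⟩
  have h₄ := h₃'.trans (eval_mono pE (n := 7) (by
    have := sz_bool ((Q r).any ans)
    simp only [sz_pair, sz_unit, sz_nil]
    omega))
  have h₅ : (enc ((), false, Q r)).size ≤ rQ.eval (sz r) + 6 := by
    show sz ((), false, Q r) ≤ _
    have := sz_bool false
    simp only [sz_pair, sz_unit]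
    omega
  have h₆ : t₂ ≤ (rQ.eval (sz r) + 1) * ((10 * (rQ.eval (sz r) + 20) +
      pc.eval (rQ.eval (sz r) + 6)) + 100 * ((rQ.eval (sz r) + 3) + 1)) := by
    refine h₂'.trans ?_
    have := (length_le_sz (Q r)).trans hs
    gcongr
  simp only [Polynomial.eval_add, Polynomial.eval_mul, Polynomial.eval_comp, Polynomial.eval_one,
    Polynomial.eval_ofNat, Polynomial.eval_X]
  have e : (enc r).size = sz r := rfl
  omega

theorem hasTuringKernel_clique :
    HasTuringKernel (fun x => x.G = ⊤) Instance.mu (fun k => 3 * k + 3) := by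
  obtain ⟨prog, p, hp⟩ := exists_run_any cliqueQueries polyFn_cliqueQueries
  refine ⟨prog, p, 100 * (3 * .X + 3 + 1) ^ 3 + (3 * .X + 3) ^ 2, fun x hx => ?_⟩
  classical
  have hks : ∀ v, cliqueKeep x.toRaw v x.s := fun v => by simp [cliqueKeep]
  have hkt : ∀ v, cliqueKeep x.toRaw v x.t := fun v => by simp [cliqueKeep]
  let y : ℕ → Instance := fun v => x.sub (cliqueKeep x.toRaw v) (hks v) (hkt v)
  have hy : cliqueQueries x.toRaw = (List.range x.n).map fun v => (y v).toRaw := by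
    simp only [cliqueQueries, y, Instance.toRaw_sub]
    rfl
  have hyn : ∀ v, (y v).n ≤ 3 * x.mu + 3 := by
    intro v
    have hsub : ((Finset.range x.n).filter fun u => cliqueKeep x.toRaw v u) ⊆
        {x.s.1, x.t.1, v} ∪ (Finset.univ.filter fun u : Fin x.n => s(x.s, u) ∈ x.f x.s).image
          Fin.val := by
      intro u hu
      simp only [Finset.mem_filter, Finset.mem_range, cliqueKeep, Instance.src_toRaw,
        Instance.tgt_toRaw, Instance.del_toRaw, Bool.or_eq_true, beq_iff_eq] at hu
      simp only [Finset.mem_union, Finset.mem_insert, Finset.mem_singleton, Finset.mem_image,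
        Finset.mem_filter, Finset.mem_univ, true_and]
      obtain ⟨hu₁, ((hu | hu) | hu) | hu⟩ := hu
      · simp [hu]
      · simp [hu]
      · simp [hu]
      · exact Or.inr ⟨⟨u, hu₁⟩, (x.delB_val x.s x.s ⟨u, hu₁⟩).1 hu, rfl⟩
    have h₁ : (Finset.univ.filter fun u : Fin x.n => s(x.s, u) ∈ x.f x.s).card ≤ (x.f x.s).card := by
      refine Finset.card_le_card_of_injOn (fun u => s(x.s, u)) (fun u hu => by simpa using hu) ?_
      intro u _ w _ h
      exact Sym2.congr_right.1 h
    have h₂ : (x.f x.s).card ≤ x.mu := Finset.le_sup (f := fun v => (x.f v).card) (Finset.mem_univ _)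
    have h₃ := Finset.card_le_card hsub
    have h₄ := Finset.card_union_le {x.s.1, x.t.1, v}
      ((Finset.univ.filter fun u : Fin x.n => s(x.s, u) ∈ x.f x.s).image Fin.val)
    have h₅ : ({x.s.1, x.t.1, v} : Finset ℕ).card ≤ 3 := Finset.card_le_three
    have h₆ := Finset.card_image_le (f := Fin.val)
      (s := Finset.univ.filter fun u : Fin x.n => s(x.s, u) ∈ x.f x.s)
    -- The count is at most μ + 3: the vertices s, t, v and the ends of edges in f(s). The bound 3μ
    -- + 3 has the required form.
    rw [Instance.n_sub]
    omega
  have hytop : ∀ v, (y v).G = ⊤ := by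
    intro v
    ext i j
    rw [Instance.adj_sub, hx, SimpleGraph.top_adj, SimpleGraph.top_adj]
    exact (x.subEmb_injective _ _).ne_iff
  obtain ⟨t, ht, ht'⟩ := hp (boundedOracle (fun x => x.G = ⊤) Instance.mu (3 * x.mu + 3)
    ((100 * (3 * .X + 3 + 1) ^ 3 + (3 * .X + 3) ^ 2 : Polynomial ℕ).eval x.mu)) x.toRaw
    (fun q => decide q.IsYes) (by
      intro q hq
      rw [hy] at hq
      obtain ⟨v, -, rfl⟩ := List.mem_map.1 hq
      refine ⟨y v, (y v).encode_eq.symm, hytop v, hyn v, ?_, by simp [Instance.isYes_toRaw]⟩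
      have h₁ := (y v).size_le
      have h₂ := (y v).mu_le
      have h₃ := hyn v
      simp only [Polynomial.eval_add, Polynomial.eval_mul, Polynomial.eval_pow,
        Polynomial.eval_X, Polynomial.eval_one, Polynomial.eval_ofNat]
      refine add_le_add (h₁.trans ?_) (h₂.trans ?_) <;> gcongr)
  refine ⟨_, t, by rw [x.encode_eq]; exact ht, ?_, ?_⟩
  · rw [x.size_eq]; exact ht'.trans (eval_mono _ (by omega))
  rw [hy]
  simp only [List.any_map, List.any_eq_true, List.mem_range, Function.comp_apply,
    decide_eq_true_eq, Instance.isYes_toRaw]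
  constructor
  · rintro ⟨v, -, hv⟩
    rw [Instance.isYes_sub] at hv
    obtain ⟨l, hl, -⟩ := hv
    exact x.isYes_iff.2 ⟨l, hl⟩
  · intro h
    -- Over the natural numbers adjacency is complete only below `x.n`, so the vertices of paths
    -- have to be located there before the clique lemma applies.
    have hlt : ∀ l, IsPathList (fun i j => x.adjB i j) (fun v i j => x.delB v i j) x.s x.t l →
        ∀ v ∈ l, v < x.n := by
      intro l hl v hv
      rcases hl.eq_or_exists hv with rfl | ⟨u, hu⟩
      · exact x.s.2
      · exact (Instance.adjB_lt hu).2
    obtain ⟨v, l, hl, hv, hl'⟩ := exists_isPathList_of_clique (fun l hl a ha b hb hab => by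
      have := (x.adjB_val ⟨a, hlt l hl a ha⟩ ⟨b, hlt l hl b hb⟩).2 (by
        rw [hx, SimpleGraph.top_adj]; simpa using hab)
      exact this) (x.isYes_iff.1 h)
    refine ⟨v, hlt l hl v hv, (x.isYes_sub _ _).2 ⟨l, hl, fun u hu => ?_⟩⟩
    rcases hl' u hu with rfl | rfl | h
    · exact hks v
    · simp [cliqueKeep]
    · simp [cliqueKeep, h]

/-! ### The kernel for outerplanar graphs -/

theorem sin_half_sub_pos {a b : ℝ} (ha : -Real.pi < a) (hb : b ≤ Real.pi) (h : a < b) :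
    0 < Real.sin ((b - a) / 2) :=
  Real.sin_pos_of_pos_of_lt_pi (by linarith) (by linarith)

/-- Three points in counterclockwise order on the unit circle span a positive area. -/
theorem area_pos {a b c : ℝ} (ha : -Real.pi < a) (hab : a < b) (hbc : b < c) (hc : c ≤ Real.pi) :
    0 < (Real.cos b - Real.cos a) * (Real.sin c - Real.sin a) -
      (Real.cos c - Real.cos a) * (Real.sin b - Real.sin a) := by
  have h₁ := sin_half_sub_pos ha (by linarith) hab
  have h₂ := sin_half_sub_pos (by linarith) hc hbc
  have h₃ := sin_half_sub_pos ha hc (hab.trans hbc)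
  -- By the sum-to-product formulas the expression equals 4 sin((b-a)/2) sin((c-a)/2) sin((c-b)/2).
  have e : (c - b) / 2 = (c + a) / 2 - (b + a) / 2 := by ring
  rw [e, Real.sin_sub] at h₂
  rw [Real.cos_sub_cos, Real.cos_sub_cos, Real.sin_sub_sin, Real.sin_sub_sin]
  have := mul_pos (mul_pos h₁ h₃) h₂
  nlinarith

/-- Chords of the unit circle whose end points alternate cross each other. -/
theorem not_disjoint_openSegment {a b c d : ℝ} (ha : -Real.pi < a) (hab : a < b) (hbc : b < c)
    (hcd : c < d) (hd : d ≤ Real.pi) {p q r w : ℂ} (hp : p = ⟨Real.cos a, Real.sin a⟩)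
    (hq : q = ⟨Real.cos b, Real.sin b⟩) (hr : r = ⟨Real.cos c, Real.sin c⟩)
    (hw : w = ⟨Real.cos d, Real.sin d⟩) :
    ¬ Disjoint (openSegment ℝ p r) (openSegment ℝ q w) := by
  have h₁ := area_pos (by linarith) hbc hcd hd
  have h₂ := area_pos ha hab (hbc.trans hcd) hd
  have h₃ := area_pos ha (hab.trans hbc) hcd hd
  have h₄ := area_pos ha hab hbc (by linarith)
  generalize Real.cos a = xa at *
  generalize Real.cos b = xb at *
  generalize Real.cos c = xc at *
  generalize Real.cos d = xd at *
  generalize Real.sin a = ya at *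
  generalize Real.sin b = yb at *
  generalize Real.sin c = yc at *
  generalize Real.sin d = yd at *
  -- Twice the areas of the triangles bcd, abd, acd and abc. Weighting each point by the area of the
  -- triangle on the other three gives the affine dependence of the four points, and its two sides
  -- describe the crossing point on either chord.
  set u₁ := (xc - xb) * (yd - yb) - (xd - xb) * (yc - yb) with hu₁
  set u₂ := (xb - xa) * (yd - ya) - (xd - xa) * (yb - ya) with hu₂
  set u₃ := (xc - xa) * (yd - ya) - (xd - xa) * (yc - ya) with hu₃
  set u₄ := (xb - xa) * (yc - ya) - (xc - xa) * (yb - ya) with hu₄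
  have hsum : u₁ + u₂ = u₃ + u₄ := by rw [hu₁, hu₂, hu₃, hu₄]; ring
  have hx : u₁ * xa + u₂ * xc = u₃ * xb + u₄ * xd := by rw [hu₁, hu₂, hu₃, hu₄]; ring
  have hy : u₁ * ya + u₂ * yc = u₃ * yb + u₄ * yd := by rw [hu₁, hu₂, hu₃, hu₄]; ring
  have hpos : 0 < u₁ + u₂ := by linarith
  rw [Set.not_disjoint_iff]
  refine ⟨(u₁ / (u₁ + u₂)) • p + (u₂ / (u₁ + u₂)) • r,
    ⟨_, _, by positivity, by positivity, by field_simp, rfl⟩,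
    ⟨u₃ / (u₁ + u₂), u₄ / (u₁ + u₂), by positivity, by positivity, ?_, ?_⟩⟩
  · rw [← add_div, ← hsum]; field_simp
  · subst hp hq hr hw
    apply Complex.ext
    · simp only [Complex.add_re, Complex.real_smul, Complex.re_ofReal_mul, div_mul_eq_mul_div,
        ← add_div, hx]
    · simp only [Complex.add_im, Complex.real_smul, Complex.im_ofReal_mul, div_mul_eq_mul_div,
        ← add_div, hy]

/-! ### Counting in graphs drawn above a line without crossings. -/

section

variable {V : Type*} (G : SimpleGraph V)

/-- The vertices of `G` can be placed on a line, according to `θ`, so that no two edges cross when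
drawn above that line. -/
structure NonCrossing (θ : V → ℝ) : Prop where
  inj : Function.Injective θ
  not_cross : ∀ a b c d : V, θ a < θ c → θ c < θ b → θ b < θ d → G.Adj a b → G.Adj c d → False

variable {G}

/-- Cut the circle at -1: the argument places the vertices on a line, and edges with alternating
ends would be crossing chords. -/
theorem IsOuterplanar.exists_nonCrossing (h : IsOuterplanar G) : ∃ θ : V → ℝ, NonCrossing G θ := by
  obtain ⟨pos, hinj, hnorm, hdis⟩ := h
  have e : ∀ v, pos v = ⟨Real.cos (pos v).arg, Real.sin (pos v).arg⟩ := by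
    intro v
    apply Complex.ext
    · rw [Complex.cos_arg (by rw [← norm_ne_zero_iff, hnorm]; simp), hnorm, div_one]
    · rw [Complex.sin_arg, hnorm, div_one]
  refine ⟨fun v => (pos v).arg, fun u v huv => hinj ?_, ?_⟩
  · rw [e u, e v, huv]
  · intro a b c d h₁ h₂ h₃ hab hcd
    refine not_disjoint_openSegment (Complex.neg_pi_lt_arg (pos a)) h₁ h₂ h₃
      (Complex.arg_le_pi (pos d)) (e a) (e c) (e b) (e d) (hdis a b c d hab hcd ?_)
    rw [Ne, Sym2.eq_iff]
    rintro (⟨rfl, -⟩ | ⟨rfl, -⟩)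
    · exact lt_irrefl _ h₁
    · exact lt_irrefl _ (h₁.trans (h₂.trans h₃))

/-- Reflecting the line reduces vertices with two neighbours on the left to those with two
neighbours on the right. -/
theorem NonCrossing.neg {θ : V → ℝ} (h : NonCrossing G θ) : NonCrossing G (fun v => -θ v) :=
  ⟨fun u v huv => h.inj (neg_injective huv), fun a b c d h₁ h₂ h₃ hab hcd =>
    h.not_cross d c b a (by linarith) (by linarith) (by linarith) hcd.symm hab.symm⟩

/-- For an edge from a to b with a left of b, either b is the last neighbour of a or a is the first
neighbour of b; otherwise the edge from a to its last neighbour crosses the one from b to its first.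
So each vertex accounts for at most two edges. -/
theorem NonCrossing.ncard_edgeSet_le [Fintype V] {θ : V → ℝ} (h : NonCrossing G θ) :
    G.edgeSet.ncard ≤ 2 * Fintype.card V := by
  classical
  have hmax : ∀ v, ∃ w, ∀ u, G.Adj v u → G.Adj v w ∧ θ u ≤ θ w := by
    intro v
    rcases (Finset.univ.filter fun u => G.Adj v u).eq_empty_or_nonempty with h | h
    · exact ⟨v, fun u hu => by simpa [h] using Finset.mem_filter.2 ⟨Finset.mem_univ u, hu⟩⟩
    · obtain ⟨w, hw, hw'⟩ := Finset.exists_max_image _ θ h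
      exact ⟨w, fun u hu => ⟨(Finset.mem_filter.1 hw).2, hw' u (by simp [hu])⟩⟩
  have hmin : ∀ v, ∃ w, ∀ u, G.Adj v u → G.Adj v w ∧ θ w ≤ θ u := by
    intro v
    rcases (Finset.univ.filter fun u => G.Adj v u).eq_empty_or_nonempty with h | h
    · exact ⟨v, fun u hu => by simpa [h] using Finset.mem_filter.2 ⟨Finset.mem_univ u, hu⟩⟩
    · obtain ⟨w, hw, hw'⟩ := Finset.exists_min_image _ θ h
      exact ⟨w, fun u hu => ⟨(Finset.mem_filter.1 hw).2, hw' u (by simp [hu])⟩⟩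
  choose M hM using hmax
  choose m hm using hmin
  have key : ∀ a b, G.Adj a b → θ a < θ b → b = M a ∨ a = m b := by
    intro a b hab hlt
    by_contra! hne
    obtain ⟨h₁, h₂⟩ := hM a b hab
    obtain ⟨h₃, h₄⟩ := hm b a hab.symm
    have h₅ := h₂.lt_of_ne (h.inj.ne hne.1)
    have h₆ := h₄.lt_of_ne (h.inj.ne hne.2.symm)
    exact h.not_cross (m b) b a (M a) h₆ hlt h₅ h₃.symm h₁
  have hsub : G.edgeSet ⊆ (Set.range fun v => s(v, M v)) ∪ Set.range fun v => s(m v, v) := by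
    have aux : ∀ a b, G.Adj a b → θ a < θ b →
        s(a, b) ∈ (Set.range fun v => s(v, M v)) ∪ Set.range fun v => s(m v, v) := by
      intro a b hab hlt
      rcases key a b hab hlt with rfl | rfl
      · exact Or.inl ⟨a, rfl⟩
      · exact Or.inr ⟨b, rfl⟩
    intro e he
    induction e with
    | _ a b =>
      rcases lt_trichotomy (θ a) (θ b) with hlt | heq | hlt
      · exact aux a b he hlt
      · exact absurd (h.inj heq) (G.ne_of_adj he)
      · rw [Sym2.eq_swap]; exact aux b a (G.adj_symm he) hlt
  have hr : ∀ f : V → Sym2 V, (Set.range f).ncard ≤ Fintype.card V := by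
    intro f
    rw [← Set.image_univ]
    refine (Set.ncard_image_le (Set.toFinite _)).trans ?_
    rw [Set.ncard_univ, Nat.card_eq_fintype_card]
  refine (Set.ncard_le_ncard hsub (Set.toFinite _)).trans ((Set.ncard_union_le _ _).trans ?_)
  have h₁ := hr fun v => s(v, M v)
  have h₂ := hr fun v => s(m v, v)
  omega

/-- Send v to the nearer, `a v`, of its two chosen neighbours on the right. If v < w had the same
image, the edge from v to it would cross the edge from w to `b w`. -/
theorem NonCrossing.card_left_le {θ : V → ℝ} (h : NonCrossing G θ) {C S : Finset V}
    (hC : ∀ v ∈ S, ∀ u, G.Adj v u → u ∈ C)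
    (hS : ∀ v ∈ S, ∃ a b, G.Adj v a ∧ G.Adj v b ∧ θ v < θ a ∧ θ a < θ b) : S.card ≤ C.card := by
  choose! a b ha hb h₁ h₂ using hS
  refine Finset.card_le_card_of_injOn a (fun v hv => hC v hv _ (ha v hv)) ?_
  have aux : ∀ v ∈ S, ∀ w ∈ S, a v = a w → ¬ θ v < θ w := by
    intro v hv w hw hvw hlt
    refine h.not_cross v (a v) w (b w) hlt ?_ ?_ (ha v hv) (hb w hw)
    · rw [hvw]; exact h₁ w hw
    · rw [hvw]; exact h₂ w hw
  intro v hv w hw hvw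
  rcases lt_trichotomy (θ v) (θ w) with hlt | heq | hlt
  · exact absurd hlt (aux v hv w hw hvw)
  · exact h.inj heq
  · exact absurd hlt (aux w hw v hv hvw.symm)

/-- Send v to the next cover vertex on its right. If v < w have the same image, no cover vertex lies
between them, so the left neighbour of w lies left of v and the right neighbour of v lies right of
w, and these two edges cross. -/
theorem NonCrossing.card_mid_le {θ : V → ℝ} (h : NonCrossing G θ) {C S : Finset V}
    (hC : ∀ v ∈ S, ∀ u, G.Adj v u → u ∈ C) (hCS : ∀ v ∈ S, v ∉ C)
    (hS : ∀ v ∈ S, ∃ a b, G.Adj v a ∧ G.Adj v b ∧ θ a < θ v ∧ θ v < θ b) : S.card ≤ C.card := by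
  classical
  choose! a b ha hb h₁ h₂ using hS
  have hnext : ∀ v ∈ S, ∃ c ∈ C, θ v < θ c ∧ ∀ d ∈ C, θ v < θ d → θ c ≤ θ d := by
    intro v hv
    obtain ⟨c, hc, hc'⟩ := Finset.exists_min_image (C.filter fun c => θ v < θ c) θ
      ⟨b v, by simp [hC v hv _ (hb v hv), h₂ v hv]⟩
    rw [Finset.mem_filter] at hc
    exact ⟨c, hc.1, hc.2, fun d hd hd' => hc' d (by simp [hd, hd'])⟩
  choose! c hc hc₁ hc₂ using hnext
  refine Finset.card_le_card_of_injOn c hc ?_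
  have aux : ∀ v ∈ S, ∀ w ∈ S, c v = c w → ¬ θ v < θ w := by
    intro v hv w hw hvw hlt
    have hno : ∀ d ∈ C, θ v < θ d → θ w ≤ θ d := fun d hd hd' =>
      (hc₁ w hw).le.trans (by rw [← hvw]; exact hc₂ v hv d hd hd')
    have hav : θ (a w) < θ v := by
      have haC := hC w hw _ (ha w hw)
      rcases lt_trichotomy (θ (a w)) (θ v) with hlt | heq | hlt
      · exact hlt
      · exact absurd (h.inj heq ▸ haC) (hCS v hv)
      · exact absurd (hno _ haC hlt) (not_le.2 (h₁ w hw))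
    have hbw : θ w < θ (b v) := by
      have hbC := hC v hv _ (hb v hv)
      refine (hno _ hbC (h₂ v hv)).lt_of_ne fun heq => ?_
      exact absurd (h.inj heq ▸ hbC) (hCS w hw)
    exact h.not_cross (a w) w v (b v) hav hlt hbw (ha w hw).symm (hb v hv)
  intro v hv w hw hvw
  rcases lt_trichotomy (θ v) (θ w) with hlt | heq | hlt
  · exact absurd hlt (aux v hv w hw hvw)
  · exact h.inj heq
  · exact absurd hlt (aux w hw v hv hvw.symm)

/-- In an outerplanar graph with vertex cover `C`, at most `3 |C|` vertices outside `C` have more than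
one neighbour. -/
theorem NonCrossing.card_le {θ : V → ℝ} (h : NonCrossing G θ) {C S : Finset V}
    (hC : ∀ v ∈ S, ∀ u, G.Adj v u → u ∈ C) (hCS : ∀ v ∈ S, v ∉ C)
    (hS : ∀ v ∈ S, ∃ a b, G.Adj v a ∧ G.Adj v b ∧ a ≠ b) : S.card ≤ 3 * C.card := by
  classical
  set S₁ := S.filter fun v => ∃ a b, G.Adj v a ∧ G.Adj v b ∧ θ v < θ a ∧ θ a < θ b
  set S₂ := S.filter fun v => ∃ a b, G.Adj v a ∧ G.Adj v b ∧ -θ v < -θ a ∧ -θ a < -θ b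
  set S₃ := S.filter fun v => ∃ a b, G.Adj v a ∧ G.Adj v b ∧ θ a < θ v ∧ θ v < θ b
  have h₁ : S₁.card ≤ C.card := h.card_left_le (fun v hv => hC v (Finset.mem_filter.1 hv).1)
    (fun v hv => (Finset.mem_filter.1 hv).2)
  have h₂ : S₂.card ≤ C.card := h.neg.card_left_le (fun v hv => hC v (Finset.mem_filter.1 hv).1)
    (fun v hv => (Finset.mem_filter.1 hv).2)
  have h₃ : S₃.card ≤ C.card := h.card_mid_le (fun v hv => hC v (Finset.mem_filter.1 hv).1)
    (fun v hv => hCS v (Finset.mem_filter.1 hv).1) (fun v hv => (Finset.mem_filter.1 hv).2)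
  have hsub : S ⊆ S₁ ∪ (S₂ ∪ S₃) := by
    have aux : ∀ v ∈ S, ∀ a b, G.Adj v a → G.Adj v b → θ a < θ b → v ∈ S₁ ∪ (S₂ ∪ S₃) := by
      intro v hv a b ha hb hab
      have hva := h.inj.ne (G.ne_of_adj ha)
      have hvb := h.inj.ne (G.ne_of_adj hb)
      simp only [Finset.mem_union]
      rcases lt_or_gt_of_ne hva with h₁ | h₁
      · exact Or.inl (Finset.mem_filter.2 ⟨hv, a, b, ha, hb, h₁, hab⟩)
      rcases lt_or_gt_of_ne hvb with h₂ | h₂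
      · exact Or.inr (Or.inr (Finset.mem_filter.2 ⟨hv, a, b, ha, hb, h₁, h₂⟩))
      · exact Or.inr (Or.inl (Finset.mem_filter.2
          ⟨hv, b, a, hb, ha, by linarith, by linarith⟩))
    intro v hv
    obtain ⟨a, b, ha, hb, hab⟩ := hS v hv
    rcases lt_or_gt_of_ne (h.inj.ne hab) with h₁ | h₁
    · exact aux v hv a b ha hb h₁
    · exact aux v hv b a hb ha h₁
  have h₄ := Finset.card_le_card hsub
  have h₅ := Finset.card_union_le S₁ (S₂ ∪ S₃)
  have h₆ := Finset.card_union_le S₂ S₃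
  omega

end

/-- The vertices kept by the kernelization for outerplanar graphs: `s`, `t`, and all vertices with more
than one neighbour. -/
def outerKeep (r : Raw) (v : ℕ) : Bool :=
  v == r.src || v == r.tgt || (List.range r.order).any fun i => (List.range r.order).any fun j =>
    !(i == j) && r.adj v i && r.adj v j

theorem Instance.outerKeep_iff (x : Instance) (v : Fin x.n) : outerKeep x.toRaw v ↔
    v = x.s ∨ v = x.t ∨ ∃ a b, x.G.Adj v a ∧ x.G.Adj v b ∧ a ≠ b := by
  simp only [outerKeep, src_toRaw, tgt_toRaw, order_toRaw, adj_toRaw, Bool.or_eq_true, beq_iff_eq,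
    List.any_eq_true, List.mem_range, Bool.and_eq_true, Bool.not_eq_true', beq_eq_false_iff_ne,
    or_assoc, Fin.val_inj]
  refine or_congr_right (or_congr_right ?_)
  constructor
  · rintro ⟨a, ha, b, hb, ⟨hne, h₁⟩, h₂⟩
    exact ⟨⟨a, ha⟩, ⟨b, hb⟩, (x.adjB_val _ _).1 h₁, (x.adjB_val _ _).1 h₂, by simpa using hne⟩
  · rintro ⟨a, b, h₁, h₂, hne⟩
    exact ⟨a, a.2, b, b.2, ⟨by simpa [Fin.ext_iff] using hne, (x.adjB_val _ _).2 h₁⟩,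
      (x.adjB_val _ _).2 h₂⟩

theorem hasKernel_outerplanar : HasKernel (fun x => IsOuterplanar x.G) Instance.vcn
    (fun k => 8 * k + 8) (fun k => 8 * k + 8) := by
  classical
  refine hasKernel_of_polyFn 8 (fun r => subRaw r (outerKeep r)) ?_ ?_ (fun _ => le_rfl) ?_
  · refine PolyFn.subRaw (by fun_prop) ?_
    unfold outerKeep
    fun_prop
  · intro x
    refine x.vcn_le.trans (Nat.le_self_pow (by norm_num) _)
  intro x hx
  have hs : outerKeep x.toRaw x.s := (x.outerKeep_iff _).2 (Or.inl rfl)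
  have ht : outerKeep x.toRaw x.t := (x.outerKeep_iff _).2 (Or.inr (Or.inl rfl))
  have hx' : IsOuterplanar (x.sub _ hs ht).G := by
    obtain ⟨pos, h₁, h₂, h₃⟩ := hx
    refine ⟨fun i => pos (x.subEmb hs ht i), h₁.comp (x.subEmb_injective hs ht), fun i => h₂ _, ?_⟩
    intro a b c d hab hcd hne
    refine h₃ _ _ _ _ ((x.adj_sub hs ht _ _).1 hab) ((x.adj_sub hs ht _ _).1 hcd) fun h => hne ?_
    exact Sym2.map.injective (x.subEmb_injective hs ht) (by simpa using h)
  -- Two for s and t, at most vcn in a minimum cover, and at most 3 vcn outside it.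
  have hn : (x.sub _ hs ht).n ≤ 4 * x.vcn + 2 := by
    obtain ⟨θ, hθ⟩ := hx.exists_nonCrossing
    obtain ⟨C, hC, hC'⟩ := x.G.vertexCoverNum_exists
    have hcard : C.toFinset.card = x.vcn := by
      rw [Instance.vcn, ← hC, ← Set.ncard_def, Set.ncard_eq_toFinset_card']
    set S := Finset.univ.filter fun v => v ∉ C ∧ ∃ a b, x.G.Adj v a ∧ x.G.Adj v b ∧ a ≠ b
    have hS : S.card ≤ 3 * C.toFinset.card := by
      refine hθ.card_le (fun v hv u hu => ?_) (fun v hv => ?_) fun v hv => ?_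
      · have := (Finset.mem_filter.1 hv).2.1
        simpa [this] using hC' hu
      · simpa using (Finset.mem_filter.1 hv).2.1
      · exact (Finset.mem_filter.1 hv).2.2
    have hsub : ((Finset.range x.n).filter fun v => outerKeep x.toRaw v) ⊆
        ({x.s, x.t} ∪ (C.toFinset ∪ S)).image Fin.val := by
      intro v hv
      rw [Finset.mem_filter, Finset.mem_range] at hv
      refine Finset.mem_image.2 ⟨⟨v, hv.1⟩, ?_, rfl⟩
      have := (x.outerKeep_iff ⟨v, hv.1⟩).1 hv.2
      simp only [Finset.mem_union, Finset.mem_insert, Finset.mem_singleton, Set.mem_toFinset, S,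
        Finset.mem_filter, Finset.mem_univ, true_and]
      tauto
    rw [Instance.n_sub]
    have h₁ := (Finset.card_le_card hsub).trans Finset.card_image_le
    have h₂ := Finset.card_union_le {x.s, x.t} (C.toFinset ∪ S)
    have h₃ := Finset.card_union_le C.toFinset S
    have h₄ : ({x.s, x.t} : Finset (Fin x.n)).card ≤ 2 := Finset.card_le_two
    omega
  refine ⟨x.sub _ hs ht, (x.toRaw_sub hs ht).symm, hx', x.isYes_sub_iff hs ht ?_, by omega, ?_⟩
  · intro l hl v hv
    have hvn : v < x.n := by
      rcases hl.eq_or_exists hv with rfl | ⟨u, hu⟩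
      · exact x.s.2
      · exact (Instance.adjB_lt hu).2
    refine (x.outerKeep_iff ⟨v, hvn⟩).2 ?_
    by_cases h₁ : v = x.s
    · exact Or.inl (Fin.ext h₁)
    by_cases h₂ : v = x.t
    · exact Or.inr (Or.inl (Fin.ext h₂))
    obtain ⟨l₁, a, b, l₂, -, hab, ha, hb⟩ := hl.exists_split hv h₁ h₂
    refine Or.inr (Or.inr ⟨⟨a, (Instance.adjB_lt ha).1⟩, ⟨b, (Instance.adjB_lt hb).2⟩,
      (x.adjB_val _ _).1 (by rw [x.adjB_symm]; exact ha), (x.adjB_val _ _).1 hb, ?_⟩)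
    simpa using hab
  -- The edges number at most twice the vertices, that is, 8 vcn + 4.
  · obtain ⟨θ, hθ⟩ := hx'.exists_nonCrossing
    have := hθ.ncard_edgeSet_le
    rw [Fintype.card_fin] at this
    rw [Instance.numEdges]
    omega

/-! ### Reduction rules for graphs with small feedback edge number -/

section

variable {V : Type*} {A : V → V → Prop} {D : V → V → V → Prop} {s t : V}

theorem isChain_and_iff {R S : V → V → Prop} {l : List V} :
    l.IsChain (fun a b => R a b ∧ S a b) ↔ l.IsChain R ∧ l.IsChain S := by
  simp only [List.isChain_iff_getElem]
  exact ⟨fun h => ⟨fun i hi => (h i hi).1, fun i hi => (h i hi).2⟩,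
    fun h i hi => ⟨h.1 i hi, h.2 i hi⟩⟩

/-- Deleting the edges at a vertex other than `s` and `t` with at most one neighbour does not change
the conforming paths. -/
theorem hasPath_pendant_iff {v : V} (hA : ∀ a b, A a b → A b a) (hs : v ≠ s) (ht : v ≠ t)
    (hv : ∀ a b, A v a → A v b → a = b) :
    HasPath (fun a b => a ≠ v ∧ b ≠ v ∧ A a b) D s t ↔ HasPath A D s t := by
  refine exists_congr fun l => ⟨fun h => ⟨h.head, h.last, h.nodup, ?_, h.conf⟩,
    fun h => ⟨h.head, h.last, h.nodup, ?_, h.conf⟩⟩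
  · exact h.chain.imp fun a b h => h.2.2
  · have hvl : v ∉ l := by
      intro hvl
      obtain ⟨l₁, a, b, l₂, -, hab, ha, hb⟩ := h.exists_split hvl hs ht
      exact hab (hv a b (hA _ _ ha) hb)
    refine h.chain.imp_of_mem_imp fun a b ha hb h => ⟨?_, ?_, h⟩
    · rintro rfl; exact hvl ha
    · rintro rfl; exact hvl hb

/-- The adjacency relation after the path `x`, `y`, `w` has been replaced by an edge `xw`. -/
def contractAdj (A : V → V → Prop) (x y w a b : V) : Prop :=
  a ≠ y ∧ b ≠ y ∧ (A a b ∨ ((a = x ∧ b = w) ∨ (a = w ∧ b = x)))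

/-- The deletions after the path `x`, `y`, `w` has been replaced by an edge `xw`, where `x` takes over
the role of `y`. -/
def contractDel (D : V → V → V → Prop) (x y w v a b : V) : Prop :=
  (((a = x ∧ b = w) ∨ (a = w ∧ b = x)) ∧ (D v x y ∨ D v y w ∨ (v = x ∧ D y y w))) ∨
  (¬ ((a = x ∧ b = w) ∨ (a = w ∧ b = x)) ∧
    (D v a b ∨ (v = x ∧ (D y a b ∨ ((a = x ∨ b = x) ∧ D y x y)))))

variable {x y w u : V}

theorem contractDel_symm (hD : ∀ v a b, D v a b ↔ D v b a) (v a b : V) :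
    contractDel D x y w v a b ↔ contractDel D x y w v b a := by
  have e : ((a = x ∧ b = w) ∨ (a = w ∧ b = x)) ↔ ((b = x ∧ a = w) ∨ (b = w ∧ a = x)) := by
    rw [or_comm, and_comm, and_comm (a := a = x)]
  rw [contractDel, contractDel, e, hD v a b, hD y a b, or_comm (a := a = x)]

theorem contractDel_of_ne {v a b : V} (hv : v ≠ x) (ha : a ≠ x) (hb : b ≠ x) :
    contractDel D x y w v a b ↔ D v a b := by
  simp [contractDel, hv, ha, hb]

theorem contractDel_self {a b : V} (ha : a ≠ x) (hb : b ≠ x) :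
    contractDel D x y w x a b ↔ D x a b ∨ D y a b := by
  simp [contractDel, ha, hb]

theorem contractDel_edge {v : V} (hv : v ≠ x) :
    contractDel D x y w v x w ↔ D v x y ∨ D v y w := by
  simp [contractDel, hv]

theorem contractDel_edge' {v : V} (hv : v ≠ x) :
    contractDel D x y w v w x ↔ D v x y ∨ D v y w := by
  simp [contractDel, hv]

theorem contractDel_side {v : V} (hv : v ≠ x) (hu : u ≠ w) (hux : u ≠ x) :
    contractDel D x y w v u x ↔ D v u x := by
  simp [contractDel, hv, hu, hux]

theorem contractDel_side' {v : V} (hv : v ≠ x) (hu : u ≠ w) (hux : u ≠ x) :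
    contractDel D x y w v x u ↔ D v x u := by
  simp [contractDel, hv, hu, hux]

theorem isChain_contractDel_iff {v : V} {l : List V} (hv : v ≠ x) (hl : x ∉ l) :
    l.IsChain (fun a b => ¬ contractDel D x y w v a b) ↔ l.IsChain (fun a b => ¬ D v a b) := by
  refine List.IsChain.iff_of_mem_imp fun a b ha hb => not_congr (contractDel_of_ne hv ?_ ?_)
  · rintro rfl; exact hl ha
  · rintro rfl; exact hl hb

theorem isChain_contractDel_self_iff {l : List V} (hl : x ∉ l) :
    l.IsChain (fun a b => ¬ contractDel D x y w x a b) ↔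
      l.IsChain (fun a b => ¬ D x a b) ∧ l.IsChain (fun a b => ¬ D y a b) := by
  rw [← isChain_and_iff]
  refine List.IsChain.iff_of_mem_imp fun a b ha hb => ?_
  rw [contractDel_self, not_or]
  · rintro rfl; exact hl ha
  · rintro rfl; exact hl hb

theorem conf_contractDel_iff {l : List V} (hl : x ∉ l) :
    Conf (contractDel D x y w) l ↔ Conf D l := by
  refine conf_congr fun v hv a ha b hb => contractDel_of_ne ?_ ?_ ?_ <;> rintro rfl
  exacts [hl hv, hl ha, hl hb]

/-- For a vertex other than `x`, deleting xw stands for deleting xy or yw. The assumption `u ≠ w`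
keeps the edge ux apart from the new one. -/
theorem isChain_forward_iff {v : V} {m l : List V} (hv : v ≠ x) (huw : u ≠ w)
    (hm : x ∉ m ++ [u]) (hl : x ∉ w :: l) :
    (m ++ u :: x :: w :: l).IsChain (fun a b => ¬ contractDel D x y w v a b) ↔
      (m ++ u :: x :: y :: w :: l).IsChain (fun a b => ¬ D v a b) := by
  have hux : u ≠ x := by rintro rfl; simp at hm
  rw [List.isChain_split, isChain_contractDel_iff hv hm, List.isChain_split (l₂ := _ :: _)]
  simp only [List.isChain_cons_cons, isChain_contractDel_iff hv hl, contractDel_edge hv,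
    contractDel_side hv huw hux, not_or, and_assoc]

/-- Direction of travel u, x, y, w. The deletion of yw by `y` is recorded at `x` on the edge xw, and
`x` inherits the deletions of `y` on the later edges. Whatever `x` now deletes on ux is harmless, as
that edge has been passed. -/
theorem conf_forward_iff {m l : List V} (huw : u ≠ w) (hm : x ∉ m ++ [u]) (hl : x ∉ w :: l) :
    Conf (contractDel D x y w) (m ++ u :: x :: w :: l) ↔ Conf D (m ++ u :: x :: y :: w :: l) := by
  induction m with
  | nil =>
    have hux : u ≠ x := by rintro rfl; simp at hm
    have h₁ := isChain_forward_iff (D := D) (y := y) (m := []) hux huw hm hl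
    have h₂ : (x :: w :: l).IsChain (fun a b => ¬ contractDel D x y w x a b) ↔
        (x :: y :: w :: l).IsChain (fun a b => ¬ D x a b) ∧
          (y :: w :: l).IsChain (fun a b => ¬ D y a b) := by
      simp only [List.isChain_cons_cons, isChain_contractDel_self_iff hl]
      simp only [contractDel, true_and, true_or, not_true, false_and, or_false]
      tauto
    simp only [List.nil_append] at h₁ ⊢
    simp only [Conf] at *
    rw [h₁, h₂]
    have h₃ := conf_contractDel_iff (D := D) (y := y) (w := w) hl
    simp only [Conf] at h₃
    rw [h₃]
    tauto
  | cons v m ih =>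
    have hvx : v ≠ x := by rintro rfl; simp at hm
    have hm' : x ∉ m ++ [u] := fun h => hm (by simp only [List.cons_append, List.mem_cons, h, or_true])
    have h₁ := isChain_forward_iff (D := D) (y := y) (m := v :: m) hvx huw hm hl
    simp only [List.cons_append] at h₁ ⊢
    simp only [Conf]
    rw [ih hm', h₁]

theorem isChain_backward_iff (hD : ∀ v a b, D v a b ↔ D v b a)
    {v : V} {m l : List V} (hv : v ≠ x) (huw : u ≠ w)
    (hm : x ∉ m ++ [w]) (hl : x ∉ u :: l) :
    (m ++ w :: x :: u :: l).IsChain (fun a b => ¬ contractDel D x y w v a b) ↔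
      (m ++ w :: y :: x :: u :: l).IsChain (fun a b => ¬ D v a b) := by
  have hux : u ≠ x := by rintro rfl; simp at hl
  rw [List.isChain_split, isChain_contractDel_iff hv hm, List.isChain_split (l₂ := _ :: _)]
  simp only [List.isChain_cons_cons, isChain_contractDel_iff hv hl, contractDel_edge' hv,
    contractDel_side' hv huw hux, not_or, and_assoc]
  rw [hD v w y, hD v y x]
  tauto

/-- Direction of travel w, y, x, u. Here `y` precedes `x`, so its deletions of yx and of xu count;
both are recorded at `x` on the edge xu, while the deletions of `x` on xw come too late to matter.
-/
theorem conf_backward_iff (hD : ∀ v a b, D v a b ↔ D v b a)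
    {m l : List V} (huw : u ≠ w) (hm : x ∉ m ++ [w]) (hl : x ∉ u :: l) :
    Conf (contractDel D x y w) (m ++ w :: x :: u :: l) ↔ Conf D (m ++ w :: y :: x :: u :: l) := by
  induction m with
  | nil =>
    have hwx : w ≠ x := by rintro rfl; simp at hm
    have h₁ := isChain_backward_iff hD (y := y) (m := []) hwx huw hm hl
    have h₂ : (x :: u :: l).IsChain (fun a b => ¬ contractDel D x y w x a b) ↔
        (y :: x :: u :: l).IsChain (fun a b => ¬ D y a b) ∧
          (x :: u :: l).IsChain (fun a b => ¬ D x a b) := by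
      have hux : u ≠ x := by rintro rfl; simp at hl
      simp only [List.isChain_cons_cons, isChain_contractDel_self_iff hl]
      rw [hD y y x]
      simp only [contractDel, huw, hwx.symm, true_and, and_false, false_and, or_self, not_false_eq_true,
        true_or, false_or]
      tauto
    simp only [List.nil_append] at h₁ ⊢
    simp only [Conf] at *
    rw [h₁, h₂]
    have h₃ := conf_contractDel_iff (D := D) (y := y) (w := w) hl
    simp only [Conf] at h₃
    rw [h₃]
    tauto
  | cons v m ih =>
    have hvx : v ≠ x := by rintro rfl; simp at hm
    have hm' : x ∉ m ++ [w] := fun h => hm (by simp only [List.cons_append, List.mem_cons, h, or_true])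
    have h₁ := isChain_backward_iff hD (y := y) (m := v :: m) hvx huw hm hl
    simp only [List.cons_append] at h₁ ⊢
    simp only [Conf]
    rw [ih hm', h₁]

/-- Replacing the path `x`, `y`, `w` by an edge does not change the answer, if `x` and `y` have at most
two neighbours each. -/
theorem hasPath_contract_iff (hD : ∀ v a b, D v a b ↔ D v b a)
    (hA : ∀ a b, A a b → A b a) (hxy : A x y) (hyw : A y w) (hyx : y ≠ x)
    (hwx : w ≠ x) (hwy : w ≠ y) (hxs : x ≠ s) (hxt : x ≠ t) (hys : y ≠ s) (hyt : y ≠ t)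
    (hy : ∀ z, A y z → z = x ∨ z = w) (hx : ∀ z, A x z → z = y ∨ z = u) :
    HasPath (contractAdj A x y w) (contractDel D x y w) s t ↔ HasPath A D s t := by
  have hside : ∀ l : List V, x ∉ l → y ∉ l →
      (l.IsChain (contractAdj A x y w) ↔ l.IsChain A) := by
    intro l hxl hyl
    refine List.IsChain.iff_of_mem_imp fun a b ha hb => ?_
    have h₁ : a ≠ y := by rintro rfl; exact hyl ha
    have h₂ : b ≠ y := by rintro rfl; exact hyl hb
    have h₃ : a ≠ x := by rintro rfl; exact hxl ha
    have h₄ : b ≠ x := by rintro rfl; exact hxl hb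
    simp [contractAdj, h₁, h₂, h₃, h₄]
  constructor
  · rintro ⟨l, h⟩
    have hyl : y ∉ l := by
      intro hyl
      obtain ⟨l₁, a, b, l₂, -, -, ha, -⟩ := h.exists_split hyl hys hyt
      exact ha.2.1 rfl
    by_cases hxl : x ∈ l
    · obtain ⟨l₁, a, b, l₂, rfl, hab, ha, hb⟩ := h.exists_split hxl hxs hxt
      -- A path through `x` in the new graph has to use both `u` and `w`; their order decides on
      -- which side of `x` the vertex `y` is inserted.
      have hnb : ∀ z, contractAdj A x y w x z → z = u ∨ z = w := by
        rintro z ⟨-, h₂, h₃ | h₃ | h₃⟩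
        · exact Or.inl ((hx z h₃).resolve_left h₂)
        · exact Or.inr h₃.2
        · exact absurd h₃.1.symm hwx
      have hA' : contractAdj A x y w x a := by
        obtain ⟨h₁, h₂, h₃⟩ := ha
        exact ⟨h₂, h₁, h₃.imp (hA _ _) (by tauto)⟩
      have hn := h.nodup
      have hchain := h.chain
      rw [List.isChain_split, List.isChain_cons_cons, List.isChain_cons_cons] at hchain
      have hx₁ : x ∉ l₁ ++ [a] := by
        intro h'
        have : l₁ ++ a :: x :: b :: l₂ = (l₁ ++ [a]) ++ (x :: b :: l₂) := by simp
        rw [this, List.nodup_append] at hn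
        exact hn.2.2 x h' x (by simp) rfl
      have hx₂ : x ∉ b :: l₂ := by
        have : l₁ ++ a :: x :: b :: l₂ = (l₁ ++ [a]) ++ (x :: b :: l₂) := by simp
        rw [this, List.nodup_append] at hn
        exact (List.nodup_cons.1 hn.2.1).1
      have hy₁ : y ∉ l₁ ++ [a] := fun h' => hyl (by simp at h' ⊢; tauto)
      have hy₂ : y ∉ b :: l₂ := fun h' => hyl (by simp at h' ⊢; tauto)
      rw [hside _ hx₁ hy₁, hside _ hx₂ hy₂] at hchain
      have hay : a ≠ y := ha.1
      rcases hnb b hb with rfl | rfl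
      · obtain rfl : a = w := (hnb a hA').resolve_left hab
        refine ⟨l₁ ++ a :: y :: x :: b :: l₂, ?_, ?_, ?_, ?_, ?_⟩
        · have := h.head
          cases l₁ <;> simpa using this
        · have := h.last
          rw [List.getLast?_append_of_ne_nil _ (by simp)] at this ⊢
          simpa using this
        · have e : (l₁ ++ a :: y :: x :: b :: l₂).Perm (y :: (l₁ ++ a :: x :: b :: l₂)) := by
            have : l₁ ++ a :: y :: x :: b :: l₂ = (l₁ ++ [a]) ++ y :: x :: b :: l₂ := by simp
            rw [this]
            refine List.perm_middle.trans ?_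
            simp
          rw [e.nodup_iff]
          exact List.nodup_cons.2 ⟨hyl, hn⟩
        · rw [List.isChain_split, List.isChain_cons_cons, List.isChain_cons_cons,
            List.isChain_cons_cons]
          have hxb : A x b := by
            obtain ⟨h₁, h₂, h₃⟩ := hb
            rcases h₃ with h₃ | h₃ | h₃
            · exact h₃
            · exact absurd h₃.2.symm hab
            · exact absurd h₃.1.symm hwx
          exact ⟨hchain.1, hA _ _ hyw, hA _ _ hxy, hxb, hchain.2.2.2⟩
        · exact (conf_backward_iff hD hab.symm hx₁ hx₂).1 h.conf
      · obtain rfl : a = u := (hnb a hA').resolve_right hab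
        refine ⟨l₁ ++ a :: x :: y :: b :: l₂, ?_, ?_, ?_, ?_, ?_⟩
        · have := h.head
          cases l₁ <;> simpa using this
        · have := h.last
          rw [List.getLast?_append_of_ne_nil _ (by simp)] at this ⊢
          simpa using this
        · have e : (l₁ ++ a :: x :: y :: b :: l₂).Perm (y :: (l₁ ++ a :: x :: b :: l₂)) := by
            have : l₁ ++ a :: x :: y :: b :: l₂ = (l₁ ++ [a, x]) ++ y :: b :: l₂ := by simp
            rw [this]
            refine List.perm_middle.trans ?_
            simp
          rw [e.nodup_iff]
          exact List.nodup_cons.2 ⟨hyl, hn⟩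
        · rw [List.isChain_split, List.isChain_cons_cons, List.isChain_cons_cons,
            List.isChain_cons_cons]
          have hax : A a x := by
            obtain ⟨h₁, h₂, h₃⟩ := ha
            rcases h₃ with h₃ | h₃ | h₃
            · exact h₃
            · exact absurd h₃.2.symm hwx
            · exact absurd h₃.1 hab
          exact ⟨hchain.1, hax, hxy, hyw, hchain.2.2.2⟩
        · exact (conf_forward_iff hab hx₁ hx₂).1 h.conf
    · exact ⟨l, h.head, h.last, h.nodup, (hside l hxl hyl).1 h.chain,
        (conf_contractDel_iff hxl).1 h.conf⟩
  · rintro ⟨l, h⟩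
    by_cases hyl : y ∈ l
    · obtain ⟨l₁, a, b, l₂, rfl, hab, ha, hb⟩ := h.exists_split hyl hys hyt
      have hn := h.nodup
      rcases hy b hb with rfl | rfl
      · obtain rfl : a = w := (hy a (hA _ _ ha)).resolve_left hab
        -- Having come from `w` through `y`, the path continues beyond `x` because `x ≠ t`, and `u`
        -- is the only vertex left to go to.
        rcases l₂ with - | ⟨u', l₂⟩
        · have := h.last
          rw [List.getLast?_append_of_ne_nil _ (by simp)] at this
          exact absurd (by simpa using this) hxt
        have hchain := h.chain
        rw [List.isChain_split, List.isChain_cons_cons, List.isChain_cons_cons,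
            List.isChain_cons_cons] at hchain
        obtain rfl : u' = u := by
          refine (hx u' hchain.2.2.2.1).resolve_left ?_
          rintro rfl
          simp [List.nodup_append] at hn
        have hsplit : l₁ ++ a :: y :: b :: u' :: l₂ = (l₁ ++ [a]) ++ (y :: b :: (u' :: l₂)) := by simp
        rw [hsplit, List.nodup_append, List.nodup_cons, List.nodup_cons] at hn
        obtain ⟨hn₁, ⟨hn₂, hn₃, hn₄⟩, hn₅⟩ := hn
        have hx₁ : b ∉ l₁ ++ [a] := fun h' => hn₅ b h' b (by simp) rfl
        have hy₁ : y ∉ l₁ ++ [a] := fun h' => hn₅ y h' y (by simp) rfl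
        have hy₂ : y ∉ u' :: l₂ := fun h' => hn₂ (List.mem_cons_of_mem _ h')
        have huw : u' ≠ a := fun h' => hn₅ a (by simp) u' (by simp) h'.symm
        refine ⟨l₁ ++ a :: b :: u' :: l₂, ?_, ?_, ?_, ?_, ?_⟩
        · have := h.head
          cases l₁ <;> simpa using this
        · have := h.last
          rw [List.getLast?_append_of_ne_nil _ (by simp)] at this ⊢
          simpa using this
        · refine h.nodup.sublist (List.Sublist.append (List.Sublist.refl _) ?_)
          exact (List.sublist_cons_self _ _).cons_cons _
        · rw [List.isChain_split, List.isChain_cons_cons, List.isChain_cons_cons,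
            hside _ hx₁ hy₁, hside _ hn₃ hy₂]
          exact ⟨hchain.1, ⟨hwy, hyx.symm, by simp⟩,
            ⟨hyx.symm, fun h' => hy₂ (by simp [h']), Or.inl hchain.2.2.2.1⟩, hchain.2.2.2.2⟩
        · exact (conf_backward_iff hD huw hx₁ hn₃).2 h.conf
      · obtain rfl : a = x := (hy a (hA _ _ ha)).resolve_right hab
        rcases List.eq_nil_or_concat l₁ with rfl | ⟨l₀, u', rfl⟩
        · exact absurd (by simpa using h.head) hxs
        simp only [List.concat_eq_append, List.append_assoc, List.cons_append,
          List.nil_append] at h hn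
        have hchain := h.chain
        rw [List.isChain_split, List.isChain_cons_cons, List.isChain_cons_cons,
            List.isChain_cons_cons] at hchain
        obtain rfl : u' = u := by
          refine (hx u' (hA _ _ hchain.2.1)).resolve_left ?_
          rintro rfl
          simp [List.nodup_append] at hn
        have hsplit : l₀ ++ u' :: a :: y :: b :: l₂ = (l₀ ++ [u']) ++ (a :: y :: (b :: l₂)) := by simp
        rw [hsplit, List.nodup_append, List.nodup_cons, List.nodup_cons] at hn
        obtain ⟨hn₁, ⟨hn₂, hn₃, hn₄⟩, hn₅⟩ := hn
        have hx₁ : a ∉ l₀ ++ [u'] := fun h' => hn₅ a h' a (by simp) rfl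
        have hy₁ : y ∉ l₀ ++ [u'] := fun h' => hn₅ y h' y (by simp) rfl
        have hx₂ : a ∉ b :: l₂ := fun h' => hn₂ (List.mem_cons_of_mem _ h')
        have huw : u' ≠ b := hn₅ u' (by simp) b (by simp)
        refine ⟨l₀ ++ u' :: a :: b :: l₂, ?_, ?_, ?_, ?_, ?_⟩
        · have := h.head
          cases l₀ <;> simpa using this
        · have := h.last
          rw [List.getLast?_append_of_ne_nil _ (by simp)] at this ⊢
          simpa using this
        · refine h.nodup.sublist (List.Sublist.append (List.Sublist.refl _) ?_)
          exact ((List.sublist_cons_self _ _).cons_cons _).cons_cons _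
        · rw [List.isChain_split, List.isChain_cons_cons, List.isChain_cons_cons,
            hside _ hx₁ hy₁, hside _ hx₂ hn₃]
          exact ⟨hchain.1, ⟨fun h' => hy₁ (by simp [h']), hyx.symm, Or.inl hchain.2.1⟩,
            ⟨hyx.symm, hwy, by simp⟩, hchain.2.2.2.2⟩
        · exact (conf_forward_iff huw hx₁ hx₂).2 h.conf
    -- A path through `x` needs two of its neighbours, and one of them would be `y`.
    · have hxl : x ∉ l := by
        intro hxl
        obtain ⟨l₁, a, b, l₂, rfl, hab, ha, hb⟩ := h.exists_split hxl hxs hxt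
        rcases hx b hb with rfl | rfl
        · simp at hyl
        · have := (hx a (hA _ _ ha)).resolve_right hab
          subst this
          simp at hyl
      exact ⟨l, h.head, h.last, h.nodup, (hside l hxl hyl).2 h.chain,
        (conf_contractDel_iff hxl).2 h.conf⟩

end

/-! ### Sparse graphs -/

/-- The number of ordered pairs of adjacent vertices in `S`. -/
def pairCount (A : ℕ → ℕ → Bool) (S : Finset ℕ) : ℕ := ((S ×ˢ S).filter fun p => A p.1 p.2).card

/-- Every set `S` of vertices spans at most `|S| - 1 + k` edges. -/
def Sparse (A : ℕ → ℕ → Bool) (k : ℕ) : Prop :=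
  ∀ S : Finset ℕ, S.Nonempty → pairCount A S + 2 ≤ 2 * S.card + 2 * k

theorem pairCount_mono {A B : ℕ → ℕ → Bool} {S : Finset ℕ}
    (h : ∀ a ∈ S, ∀ b ∈ S, A a b → B a b) : pairCount A S ≤ pairCount B S := by
  refine Finset.card_le_card fun p hp => ?_
  simp only [Finset.mem_filter, Finset.mem_product] at hp ⊢
  exact ⟨hp.1, h _ hp.1.1 _ hp.1.2 hp.2⟩

/-- Extend the forest to a spanning tree of the complete graph; a tree has one edge less than
vertices, and each edge makes two ordered pairs. -/
theorem card_adj_le_of_isAcyclic {W : Type*} [Fintype W] [DecidableEq W] [Nonempty W] (H : SimpleGraph W)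
    [DecidableRel H.Adj] (hH : H.IsAcyclic) :
    (Finset.univ.filter fun p : W × W => H.Adj p.1 p.2).card + 2 ≤ 2 * Fintype.card W := by
  classical
  obtain ⟨T, hHT, -, hT⟩ := SimpleGraph.connected_top.exists_isTree_le_of_le_of_isAcyclic
    (le_top : H ≤ ⊤) hH
  have h₁ := hT.card_edgeFinset
  have h₂ : (Finset.univ.filter fun p : W × W => T.Adj p.1 p.2).card = 2 * T.edgeFinset.card := by
    rw [← T.sum_degrees_eq_twice_card_edges, ← Finset.univ_product_univ, Finset.card_filter,
      Finset.sum_product]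
    refine Finset.sum_congr rfl fun a _ => ?_
    rw [← Finset.card_filter, ← SimpleGraph.card_neighborFinset_eq_degree]
    congr 1
    ext b
    simp
  have h₃ : (Finset.univ.filter fun p : W × W => H.Adj p.1 p.2).card ≤
      (Finset.univ.filter fun p : W × W => T.Adj p.1 p.2).card :=
    Finset.card_le_card fun p hp => by
      simp only [Finset.mem_filter, Finset.mem_univ, true_and] at hp ⊢
      exact hHT hp
  omega

theorem card_pairs_le_two_mul {W : Type*} [Fintype W] [DecidableEq W] (F : Finset (Sym2 W)) :
    (Finset.univ.filter fun p : W × W => s(p.1, p.2) ∈ F).card ≤ 2 * F.card := by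
  refine Finset.card_le_mul_card_image_of_maps_to (f := fun p : W × W => s(p.1, p.2))
    (fun p hp => (Finset.mem_filter.1 hp).2) 2 fun e _ => ?_
  induction e with
  | _ a b =>
    refine (Finset.card_le_card (t := {(a, b), (b, a)}) fun p hp => ?_).trans Finset.card_le_two
    have := (Finset.mem_filter.1 hp).2
    obtain ⟨c, d⟩ := p
    simpa [Sym2.eq_iff] using this

/-- Take a minimum set `F` whose deletion leaves a forest: an edge inside S belongs to `F` or to the
forest restricted to S. In contrast to a feedback edge set, this condition is easy to carry through
contractions. -/
theorem Instance.sparse (x : Instance) : Sparse x.adjB x.fen := by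
  classical
  obtain ⟨F, hF, hacyc, hcard⟩ : x.fen ∈ {k | ∃ F : Finset (Sym2 (Fin x.n)),
      (F : Set (Sym2 (Fin x.n))) ⊆ x.G.edgeSet ∧
      (x.G.deleteEdges (F : Set (Sym2 (Fin x.n)))).IsAcyclic ∧ F.card = k} :=
    Nat.sInf_mem ⟨_, x.G.edgeSet.toFinite.toFinset, by simp, by simp, rfl⟩
  intro S hS
  set T := Finset.univ.filter fun v : Fin x.n => v.1 ∈ S with hT
  have hTS : T.card ≤ S.card := by
    refine Finset.card_le_card_of_injOn Fin.val (fun v hv => (Finset.mem_filter.1 hv).2) ?_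
    exact Fin.val_injective.injOn
  -- `S` may contain numbers that are not vertices. If it contains no vertex at all, the bound holds
  -- merely because `S` is non-empty.
  rcases T.eq_empty_or_nonempty with hT0 | hT0
  · have : pairCount x.adjB S = 0 := by
      rw [pairCount, Finset.card_eq_zero, Finset.filter_eq_empty_iff]
      rintro ⟨a, b⟩ hp h
      have : (⟨a, (adjB_lt h).1⟩ : Fin x.n) ∈ T :=
        Finset.mem_filter.2 ⟨Finset.mem_univ _, (Finset.mem_product.1 hp).1⟩
      simp [hT0] at this
    have := hS.card_pos
    omega
  have : Nonempty T := hT0.to_subtype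
  set H := (x.G.deleteEdges (F : Set (Sym2 (Fin x.n)))).comap
    (Function.Embedding.subtype fun v => v ∈ T) with hH
  have h₁ := card_adj_le_of_isAcyclic H (hacyc.of_comap _)
  rw [Fintype.card_coe] at h₁
  have h₂ := card_pairs_le_two_mul F
  have hsub : ((S ×ˢ S).filter fun p => x.adjB p.1 p.2) ⊆
      ((Finset.univ.filter fun p : T × T => H.Adj p.1 p.2).image fun p => (p.1.1.1, p.2.1.1)) ∪
      ((Finset.univ.filter fun p : Fin x.n × Fin x.n => s(p.1, p.2) ∈ F).image
        fun p => (p.1.1, p.2.1)) := by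
    rintro ⟨a, b⟩ hp
    simp only [Finset.mem_filter, Finset.mem_product] at hp
    obtain ⟨⟨ha, hb⟩, hab⟩ := hp
    have hlt := adjB_lt hab
    have hadj := (x.adjB_val ⟨a, hlt.1⟩ ⟨b, hlt.2⟩).1 hab
    rw [Finset.mem_union]
    by_cases hF' : s((⟨a, hlt.1⟩ : Fin x.n), ⟨b, hlt.2⟩) ∈ F
    · right
      exact Finset.mem_image.2 ⟨(⟨a, hlt.1⟩, ⟨b, hlt.2⟩), by simpa using hF', rfl⟩
    · left
      refine Finset.mem_image.2 ⟨(⟨⟨a, hlt.1⟩, by simp [hT, ha]⟩, ⟨⟨b, hlt.2⟩, by simp [hT, hb]⟩),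
        Finset.mem_filter.2 ⟨Finset.mem_univ _, ?_⟩, rfl⟩
      show (x.G.deleteEdges _).Adj _ _
      rw [SimpleGraph.deleteEdges_adj]
      exact ⟨hadj, by simpa using hF'⟩
  have h₃ := Finset.card_le_card hsub
  have h₄ := Finset.card_union_le
    ((Finset.univ.filter fun p : T × T => H.Adj p.1 p.2).image fun p => (p.1.1.1, p.2.1.1))
    ((Finset.univ.filter fun p : Fin x.n × Fin x.n => s(p.1, p.2) ∈ F).image
        fun p => (p.1.1, p.2.1))
  have h₅ := Finset.card_image_le (s := Finset.univ.filter fun p : T × T => H.Adj p.1 p.2)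
    (f := fun p => (p.1.1.1, p.2.1.1))
  have h₆ := Finset.card_image_le
    (s := Finset.univ.filter fun p : Fin x.n × Fin x.n => s(p.1, p.2) ∈ F)
    (f := fun p => (p.1.1, p.2.1))
  rw [pairCount]
  omega

/-- Boolean version of `contractAdj`. -/
def contractAdjB (A : ℕ → ℕ → Bool) (x y w a b : ℕ) : Bool :=
  !(a == y) && !(b == y) && (A a b || ((a == x && b == w) || (a == w && b == x)))

/-- Boolean version of `contractDel`. -/
def contractDelB (D : ℕ → ℕ → ℕ → Bool) (x y w v a b : ℕ) : Bool :=
  (((a == x && b == w) || (a == w && b == x)) && (D v x y || (D v y w || (v == x && D y y w)))) ||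
  (!((a == x && b == w) || (a == w && b == x)) &&
    (D v a b || (v == x && (D y a b || ((a == x || b == x) && D y x y)))))

theorem contractAdjB_iff (A : ℕ → ℕ → Bool) (x y w a b : ℕ) :
    contractAdjB A x y w a b ↔ contractAdj (fun a b => A a b) x y w a b := by
  simp [contractAdjB, contractAdj, and_assoc]

theorem contractDelB_iff (D : ℕ → ℕ → ℕ → Bool) (x y w v a b : ℕ) :
    contractDelB D x y w v a b ↔ contractDel (fun v a b => D v a b) x y w v a b := by
  simp only [contractDelB, contractDel, Bool.or_eq_true, Bool.and_eq_true, beq_iff_eq,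
    Bool.not_eq_true', ← Bool.not_eq_true]

section

variable {A : ℕ → ℕ → Bool} {x y w : ℕ}

/-- The four ordered pairs of xy and yw disappear, and at most the two pairs of xw are new. -/
theorem pairCount_contract_add_two_le (hA : ∀ a b, A a b = A b a) (hxy : A x y) (hyw : A y w)
    (hyx : y ≠ x) (hwx : w ≠ x) (hwy : w ≠ y) {S : Finset ℕ} (hx : x ∈ S) (hw : w ∈ S) :
    pairCount (contractAdjB A x y w) S + 2 ≤ pairCount A (insert y S) := by
  set P := (S ×ˢ S).filter fun p => contractAdjB A x y w p.1 p.2 with hP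
  set Q : Finset (ℕ × ℕ) := {(x, y), (y, x), (y, w), (w, y)} with hQ
  have hQc : Q.card = 4 := by
    rw [hQ, Finset.card_insert_of_notMem, Finset.card_insert_of_notMem,
      Finset.card_insert_of_notMem, Finset.card_singleton] <;>
      simp [hyx, hwy, hyx.symm, hwx.symm, hwy.symm]
  have hdis : Disjoint (P \ {(x, w), (w, x)}) Q := by
    rw [Finset.disjoint_left]
    rintro ⟨a, b⟩ h₁ h₂
    simp only [hP, Finset.mem_sdiff, Finset.mem_filter, contractAdjB_iff, contractAdj] at h₁
    simp only [hQ, Finset.mem_insert, Finset.mem_singleton, Prod.mk.injEq] at h₂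
    obtain ⟨⟨-, h₃, h₄, -⟩, -⟩ := h₁
    omega
  have hsub : (P \ {(x, w), (w, x)}) ∪ Q ⊆
      ((insert y S) ×ˢ (insert y S)).filter fun p => A p.1 p.2 := by
    rintro ⟨a, b⟩ h
    rw [Finset.mem_union] at h
    rw [Finset.mem_filter, Finset.mem_product, Finset.mem_insert, Finset.mem_insert]
    rcases h with h | h
    · simp only [hP, Finset.mem_sdiff, Finset.mem_filter, contractAdjB_iff, contractAdj,
        Finset.mem_product, Finset.mem_insert, Finset.mem_singleton, Prod.mk.injEq] at h
      obtain ⟨⟨⟨h₁, h₂⟩, -, -, h₃⟩, h₄⟩ := h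
      exact ⟨⟨Or.inr h₁, Or.inr h₂⟩, h₃.resolve_right h₄⟩
    · simp only [hQ, Finset.mem_insert, Finset.mem_singleton, Prod.mk.injEq] at h
      rcases h with ⟨rfl, rfl⟩ | ⟨rfl, rfl⟩ | ⟨rfl, rfl⟩ | ⟨rfl, rfl⟩
      · exact ⟨⟨Or.inr hx, Or.inl rfl⟩, hxy⟩
      · exact ⟨⟨Or.inl rfl, Or.inr hx⟩, by rw [hA]; exact hxy⟩
      · exact ⟨⟨Or.inl rfl, Or.inr hw⟩, hyw⟩
      · exact ⟨⟨Or.inr hw, Or.inl rfl⟩, by rw [hA]; exact hyw⟩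
  have h₁ := Finset.card_le_card hsub
  rw [Finset.card_union_of_disjoint hdis, hQc] at h₁
  have h₂ := Finset.le_card_sdiff {(x, w), (w, x)} P
  have h₃ : ({(x, w), (w, x)} : Finset (ℕ × ℕ)).card ≤ 2 := Finset.card_le_two
  rw [pairCount, pairCount, ← hP]
  omega

/-- The new edge counts only if S contains both of its ends. Comparing with S ∪ {y} then raises the
bound by at most two, exactly what the contraction saves. -/
theorem Sparse.contract {k : ℕ} (h : Sparse A k) (hA : ∀ a b, A a b = A b a) (hxy : A x y)
    (hyw : A y w) (hyx : y ≠ x) (hwx : w ≠ x) (hwy : w ≠ y) :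
    Sparse (contractAdjB A x y w) k := by
  intro S hS
  by_cases hxw : x ∈ S ∧ w ∈ S
  · have h₁ := pairCount_contract_add_two_le hA hxy hyw hyx hwx hwy hxw.1 hxw.2
    have h₂ := h (insert y S) (Finset.insert_nonempty _ _)
    have h₃ := Finset.card_insert_le y S
    omega
  · have h₁ : pairCount (contractAdjB A x y w) S ≤ pairCount A S := by
      refine pairCount_mono fun a ha b hb hab => ?_
      rw [contractAdjB_iff] at hab
      rcases hab.2.2 with h₁ | ⟨rfl, rfl⟩ | ⟨rfl, rfl⟩
      · exact h₁
      · exact absurd ⟨ha, hb⟩ hxw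
      · exact absurd ⟨hb, ha⟩ hxw
    have := h S hS
    omega

end

/-- If all inner vertices have at least two neighbours and no two inner vertices with exactly two
neighbours are adjacent, then a sparse graph has few vertices. -/
theorem Sparse.card_le {A : ℕ → ℕ → Bool} {k : ℕ} (h : Sparse A k) (hA : ∀ a b, A a b = A b a)
    {S : Finset ℕ} {s t : ℕ} (hst : s ≠ t) (hs : s ∈ S) (ht : t ∈ S)
    (hns : ∃ a ∈ S, A s a) (hnt : ∃ a ∈ S, A t a)
    (h₂ : ∀ v ∈ S, v ≠ s → v ≠ t → ∃ a ∈ S, ∃ b ∈ S, A v a ∧ A v b ∧ a ≠ b)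
    (hind : ∀ v ∈ S, ∀ v' ∈ S, v ≠ s → v ≠ t → v' ≠ s → v' ≠ t → A v v' →
      (S.filter fun a => A v a).card = 2 → (S.filter fun a => A v' a).card = 2 → False) :
    S.card ≤ 5 * k + 3 := by
  classical
  set d : ℕ → ℕ := fun v => (S.filter fun a => A v a).card with hd
  set D₂ := S.filter fun v => v ≠ s ∧ v ≠ t ∧ d v = 2 with hD₂
  set D₃ := S.filter fun v => v ≠ s ∧ v ≠ t ∧ d v ≠ 2 with hD₃
  have hP : ∀ T ⊆ S, ((S ×ˢ S).filter fun p => p.1 ∈ T ∧ A p.1 p.2).card = ∑ v ∈ T, d v := by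
    intro T hT
    have : (S ×ˢ S).filter (fun p => p.1 ∈ T ∧ A p.1 p.2) = (T ×ˢ S).filter fun p => A p.1 p.2 := by
      ext ⟨a, b⟩
      simp only [Finset.mem_filter, Finset.mem_product]
      exact ⟨fun h => ⟨⟨h.2.1, h.1.2⟩, h.2.2⟩, fun h => ⟨⟨hT h.1.1, h.1.2⟩, h.1.1, h.2⟩⟩
    rw [this, Finset.card_filter, Finset.sum_product]
    refine Finset.sum_congr rfl fun v _ => ?_
    rw [hd, ← Finset.card_filter]
  have hPS : pairCount A S = ∑ v ∈ S, d v := by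
    rw [← hP S (Finset.Subset.refl _), pairCount]
    congr 1
    refine Finset.filter_congr fun p hp => ?_
    simp [(Finset.mem_product.1 hp).1]
  have hsplit : S = {s, t} ∪ (D₂ ∪ D₃) := by
    ext v
    simp only [hD₂, hD₃, Finset.mem_union, Finset.mem_insert, Finset.mem_singleton,
      Finset.mem_filter]
    constructor
    · intro hv; tauto
    · rintro ((rfl | rfl) | h)
      · exact hs
      · exact ht
      · tauto
  have hdis₁ : Disjoint {s, t} (D₂ ∪ D₃) := by
    rw [Finset.disjoint_left]
    intro v hv
    simp only [hD₂, hD₃, Finset.mem_union, Finset.mem_filter]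
    simp only [Finset.mem_insert, Finset.mem_singleton] at hv
    tauto
  have hdis₂ : Disjoint D₂ D₃ := by
    rw [Finset.disjoint_left]
    intro v hv
    simp only [hD₂, hD₃, Finset.mem_filter] at hv ⊢
    tauto
  have hcard : S.card = 2 + (D₂.card + D₃.card) := by
    rw [hsplit, Finset.card_union_of_disjoint hdis₁, Finset.card_union_of_disjoint hdis₂,
      Finset.card_pair hst]
  have hpos : ∀ v, (∃ a ∈ S, A v a) → 1 ≤ d v := by
    rintro v ⟨a, ha, hva⟩
    exact Finset.card_pos.2 ⟨a, by simp [ha, hva]⟩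
  have hsum₂ : ∑ v ∈ D₂, d v = 2 * D₂.card := by
    rw [Finset.sum_congr rfl fun v hv => (Finset.mem_filter.1 hv).2.2.2]
    simp [mul_comm]
  have hsum₃ : 3 * D₃.card ≤ ∑ v ∈ D₃, d v := by
    have : ∀ v ∈ D₃, 3 ≤ d v := by
      intro v hv
      obtain ⟨hvS, hvs, hvt, hv2⟩ := Finset.mem_filter.1 hv
      obtain ⟨a, ha, b, hb, hva, hvb, hab⟩ := h₂ v hvS hvs hvt
      have : 1 < d v := Finset.one_lt_card.2 ⟨a, by simp [ha, hva], b, by simp [hb, hvb], hab⟩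
      omega
    have := Finset.card_nsmul_le_sum D₃ d 3 this
    simpa [mul_comm] using this
  -- The first summand 2 comes from `s` and `t`, which have at least one neighbour each.
  have hlow : 2 + (2 * D₂.card + 3 * D₃.card) ≤ pairCount A S := by
    rw [hPS, hsplit, Finset.sum_union hdis₁, Finset.sum_union hdis₂, Finset.sum_pair hst, hsum₂]
    have := hpos s hns
    have := hpos t hnt
    omega
  -- No edge joins two vertices of `D₂`, so the pairs that start in `D₂` and those that end in it
  -- are disjoint, with 2|D₂| of each kind.
  have hlow' : 4 * D₂.card ≤ pairCount A S := by
    have e₁ := hP D₂ (Finset.filter_subset _ _)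
    rw [hsum₂] at e₁
    have e₂ : ((S ×ˢ S).filter fun p => p.2 ∈ D₂ ∧ A p.1 p.2).card = 2 * D₂.card := by
      rw [← e₁]
      refine Finset.card_bij (fun p _ => (p.2, p.1)) ?_ ?_ ?_
      · rintro ⟨a, b⟩ hp
        simp only [Finset.mem_filter, Finset.mem_product] at hp ⊢
        exact ⟨⟨hp.1.2, hp.1.1⟩, hp.2.1, by rw [hA]; exact hp.2.2⟩
      · rintro ⟨a, b⟩ _ ⟨c, d⟩ _ h
        simp only [Prod.mk.injEq] at h ⊢
        exact ⟨h.2, h.1⟩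
      · rintro ⟨a, b⟩ hp
        refine ⟨(b, a), ?_, rfl⟩
        simp only [Finset.mem_filter, Finset.mem_product] at hp ⊢
        exact ⟨⟨hp.1.2, hp.1.1⟩, hp.2.1, by rw [hA]; exact hp.2.2⟩
    have hdis : Disjoint ((S ×ˢ S).filter fun p => p.1 ∈ D₂ ∧ A p.1 p.2)
        ((S ×ˢ S).filter fun p => p.2 ∈ D₂ ∧ A p.1 p.2) := by
      rw [Finset.disjoint_left]
      rintro ⟨a, b⟩ h₁ h₂
      obtain ⟨-, ha, hab⟩ := Finset.mem_filter.1 h₁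
      obtain ⟨-, hb, -⟩ := Finset.mem_filter.1 h₂
      obtain ⟨ha, has, hat, ha'⟩ := Finset.mem_filter.1 ha
      obtain ⟨hb, hbs, hbt, hb'⟩ := Finset.mem_filter.1 hb
      exact hind a ha b hb has hat hbs hbt hab ha' hb'
    have := Finset.card_le_card (s := ((S ×ˢ S).filter fun p => p.1 ∈ D₂ ∧ A p.1 p.2) ∪
      ((S ×ˢ S).filter fun p => p.2 ∈ D₂ ∧ A p.1 p.2)) (t := (S ×ˢ S).filter fun p => A p.1 p.2)
      (by
        refine Finset.union_subset ?_ ?_ <;> intro p hp <;>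
          exact Finset.mem_filter.2 ⟨(Finset.mem_filter.1 hp).1, (Finset.mem_filter.1 hp).2.2⟩)
    rw [Finset.card_union_of_disjoint hdis, e₁, e₂] at this
    rw [pairCount]
    omega
  -- Sparsity bounds the pairs by 2 + 2|D₂| + 2|D₃| + 2k. So |D₃| ≤ 2k by `hlow`, then |D₂| ≤ |D₃| +
  -- k + 1 ≤ 3k + 1 by `hlow'`, and |S| = 2 + |D₂| + |D₃|.
  have := h S ⟨s, hs⟩
  omega

/-! ### The kernel for the feedback edge number -/

/-- The rule with applicability test `C` and effect `act`, applied to the first candidate that passes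
the test. -/
def ruleStep {β : Type} (cands : Raw → List β) (C : Raw → β → Bool) (act : Raw → β → Raw) (d : β)
    (r : Raw) : Raw :=
  -- The default `d` is never used, as the filtered list has a head in the second branch.
  bif ((cands r).filter (C r)).isEmpty then r else act r (((cands r).filter (C r)).headD d)

theorem PolyFn.ruleStep {β : Type} [Enc β] {cands : Raw → List β} {C : Raw → β → Bool}
    {act : Raw → β → Raw} (d : β) (h₁ : PolyFn cands) (h₂ : PolyFn fun p : Raw × β => C p.1 p.2)
    (h₃ : PolyFn fun p : Raw × β => act p.1 p.2) : PolyFn (ruleStep cands C act d) := by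
  have h₄ : PolyFn (fun r => (r, ((cands r).filter (C r)).headD d)) := by fun_prop
  have h₅ := h₃.comp h₄
  unfold SelfDeleting.ruleStep
  fun_prop

theorem ruleStep_of_nil {β : Type} {cands : Raw → List β} {C : Raw → β → Bool}
    {act : Raw → β → Raw} {d : β} {r : Raw} (h : (cands r).filter (C r) = []) :
    ruleStep cands C act d r = r := by
  simp [ruleStep, h]

theorem ruleStep_of_ne_nil {β : Type} {cands : Raw → List β} {C : Raw → β → Bool}
    {act : Raw → β → Raw} {d : β} {r : Raw} (h : (cands r).filter (C r) ≠ []) :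
    ∃ c ∈ cands r, C r c ∧ ruleStep cands C act d r = act r c := by
  obtain ⟨c, l, hl⟩ := List.exists_cons_of_ne_nil h
  have hc : c ∈ (cands r).filter (C r) := by simp [hl]
  rw [List.mem_filter] at hc
  exact ⟨c, hc.1, hc.2, by simp [ruleStep, hl]⟩

/-- The vertex `v` is not `s` or `t` and has exactly one neighbour. -/
def isPendant (r : Raw) (v : ℕ) : Bool :=
  !(v == r.src) && !(v == r.tgt) && ((List.range r.order).any fun i => r.adj v i &&
    (List.range r.order).all fun j => !(r.adj v j) || j == i)

/-- Delete the edges at `v`. -/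
def deletePendant (r : Raw) (v : ℕ) : Raw :=
  rawOf r.order r.src r.tgt (fun a b => !(a == v) && !(b == v) && r.adj a b)
    (fun c a b => !(a == v) && !(b == v) && r.adj a b && r.del c a b)

/-- The vertices `x` and `y` are adjacent, not equal to `s` or `t`, and have at most two neighbours;
the other neighbour of `y` is `w`. -/
def isContractible (r : Raw) (c : ℕ × ℕ × ℕ) : Bool :=
  r.adj c.1 c.2.1 && r.adj c.2.1 c.2.2 && !(c.2.2 == c.1) &&
  (!(c.1 == r.src) && !(c.1 == r.tgt) && !(c.2.1 == r.src) && !(c.2.1 == r.tgt)) &&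
  ((List.range r.order).all fun z => !(r.adj c.2.1 z) || (z == c.1 || z == c.2.2)) &&
  ((List.range r.order).any fun u => (List.range r.order).all fun z =>
    !(r.adj c.1 z) || (z == c.2.1 || z == u))

/-- Replace the path `x`, `y`, `w` by an edge. -/
def contractPath (r : Raw) (c : ℕ × ℕ × ℕ) : Raw :=
  rawOf r.order r.src r.tgt (contractAdjB r.adj c.1 c.2.1 c.2.2)
    (fun v a b => contractAdjB r.adj c.1 c.2.1 c.2.2 a b &&
      contractDelB r.del c.1 c.2.1 c.2.2 v a b)

def triples (r : Raw) : List (ℕ × ℕ × ℕ) :=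
  ((List.range r.order).map fun a => ((List.range r.order).map fun b =>
    (List.range r.order).map fun c => (a, b, c)).flatten).flatten

theorem mem_triples {r : Raw} {a b c : ℕ} :
    (a, b, c) ∈ triples r ↔ a < r.order ∧ b < r.order ∧ c < r.order := by
  simp [triples]

def pendantStep : Raw → Raw :=
  ruleStep (fun r => List.range r.order) isPendant deletePendant 0

def contractStep : Raw → Raw := ruleStep triples isContractible contractPath (0, 0, 0)

theorem polyFn_pendantStep : PolyFn pendantStep := by
  refine PolyFn.ruleStep 0 (by fun_prop) ?_ ?_
  · unfold isPendant; fun_prop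
  · unfold deletePendant
    exact PolyFn.rawOf (by fun_prop) (by fun_prop) (by fun_prop) (by fun_prop) (by fun_prop)

theorem polyFn_contractStep : PolyFn contractStep := by
  refine PolyFn.ruleStep (0, 0, 0) ?_ ?_ ?_
  · unfold triples; fun_prop
  · unfold isContractible; fun_prop
  · unfold contractPath contractAdjB contractDelB
    exact PolyFn.rawOf (by fun_prop) (by fun_prop) (by fun_prop) (by fun_prop) (by fun_prop)

/-- One round of the reduction: both rules are applied at most once. -/
def reduceRound (r : Raw) : Raw := contractStep (pendantStep r)

/-- More than the number of ordered adjacent pairs, which drops in every round that changes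
anything. The form as a length makes polynomial-time computability a matter of list operations. -/
def numRounds (r : Raw) : ℕ :=
  (((List.range (r.order + 1)).map fun _ => List.range (r.order + 1)).flatten).length

theorem numRounds_eq (r : Raw) : numRounds r = (r.order + 1) * (r.order + 1) := by
  simp [numRounds]

/-- `r'` has the same vertices as `r`, and is not much larger. -/
structure Similar (r r' : Raw) : Prop where
  order : r'.order = r.order
  src : r'.src = r.src
  tgt : r'.tgt = r.tgt
  sz : sz r' ≤ sz r + 50 * (r.order + 1) ^ 3 + 2 * r.src + 2 * r.tgt

theorem Similar.ruleStep {β : Type} {cands : Raw → List β} {C : Raw → β → Bool}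
    {act : Raw → β → Raw} {d : β} (hact : ∀ r c, ∃ A D, act r c = rawOf r.order r.src r.tgt A D)
    {r r' : Raw} (h : Similar r r') : Similar r (ruleStep cands C act d r') := by
  by_cases hl : (cands r').filter (C r') = []
  · rwa [ruleStep_of_nil hl]
  · obtain ⟨c, -, -, hc⟩ := ruleStep_of_ne_nil (act := act) (d := d) hl
    obtain ⟨A, D, hA⟩ := hact r' c
    rw [hc, hA, h.order, h.src, h.tgt]
    refine ⟨rfl, rfl, rfl, ?_⟩
    have := sz_rawOf_le r.order r.src r.tgt A D
    omega

/-- The rules only isolate vertices and leave their removal to the end, so all intermediate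
encodings keep the same order and have polynomially bounded size. -/
theorem similar_iterate (r : Raw) (j : ℕ) : Similar r (reduceRound^[j] r) := by
  induction j with
  | zero => exact ⟨rfl, rfl, rfl, by simp; omega⟩
  | succ j ih =>
    rw [Function.iterate_succ_apply']
    exact Similar.ruleStep (act := contractPath) (d := (0, 0, 0)) (fun r c => ⟨_, _, rfl⟩)
      (Similar.ruleStep (act := deletePendant) (d := 0) (fun r c => ⟨_, _, rfl⟩) ih)

theorem polyFn_reduce : PolyFn (fun r : Raw => reduceRound^[numRounds r] r) := by
  have hk : PolyFn numRounds := by unfold numRounds; fun_prop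
  have hF : PolyFn reduceRound := polyFn_contractStep.comp polyFn_pendantStep
  refine PolyFn.iterate hF (by fun_prop) hk (.X + 50 * (.X + 1) ^ 3 + 2 * .X + 2 * .X) ?_
  intro r j _
  refine (similar_iterate r j).sz.trans ?_
  have h : sz r = sz r.order + (sz r.src + (sz r.tgt + sz r.2.2.2 + 1) + 1) + 1 := rfl
  simp only [sz_nat] at h
  simp only [Polynomial.eval_add, Polynomial.eval_mul, Polynomial.eval_pow, Polynomial.eval_X,
    Polynomial.eval_one, Polynomial.eval_ofNat]
  gcongr <;> omega

/-- The instance `x'` is equivalent to `x` and not denser. -/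
structure Reduces (x x' : Instance) : Prop where
  isYes : x'.IsYes ↔ x.IsYes
  sparse : ∀ k, Sparse x.adjB k → Sparse x'.adjB k

theorem Reduces.refl (x : Instance) : Reduces x x := ⟨Iff.rfl, fun _ h => h⟩

theorem Reduces.trans {x y z : Instance} (h : Reduces x y) (h' : Reduces y z) : Reduces x z :=
  ⟨h'.isYes.trans h.isYes, fun k hk => h'.sparse k (h.sparse k hk)⟩

/-! ### Correctness and termination of the reduction. -/

namespace Instance

/-- The number of ordered pairs of adjacent vertices. -/
noncomputable def total (x : Instance) : ℕ := pairCount x.adjB (Finset.range x.n)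

theorem total_lt (x : Instance) : x.total < (x.n + 1) * (x.n + 1) := by
  refine (Finset.card_filter_le _ _).trans_lt ?_
  rw [Finset.card_product, Finset.card_range]
  nlinarith

theorem isYes_ofFun {n : ℕ} {A : ℕ → ℕ → Bool} {D : ℕ → ℕ → ℕ → Bool} {s t hs ht hA hA' hD}
    (hD' : ∀ v i j, D v i j = D v j i) (hlt : ∀ a b, A a b → a < n ∧ b < n) :
    (ofFun n A D s t hs ht hA hA' hD).IsYes ↔
      HasPath (fun a b => A a b) (fun v a b => D v a b) s t := by
  have e₁ : (ofFun n A D s t hs ht hA hA' hD).adjB = A := by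
    funext a b
    rw [adjB_ofFun, Bool.eq_iff_iff, Bool.and_eq_true, decide_eq_true_eq]
    exact ⟨And.right, fun h => ⟨hlt a b h, h⟩⟩
  rw [isYes_iff, e₁]
  show HasPath _ _ s t ↔ _
  refine exists_congr fun l => ⟨fun h => ⟨h.head, h.last, h.nodup, h.chain, ?_⟩,
    fun h => ⟨h.head, h.last, h.nodup, h.chain, ?_⟩⟩
  all_goals
    have hl : ∀ v ∈ l, v < n := by
      intro v hv
      rcases h.eq_or_exists hv with rfl | ⟨u, hu⟩
      · exact hs
      · exact (hlt _ _ hu).2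
    have e : ∀ v ∈ l, ∀ a ∈ l, ∀ b ∈ l,
        (ofFun n A D s t hs ht hA hA' hD).delB v a b ↔ D v a b := by
      intro v hv a ha b hb
      rw [delB_ofFun hD']
      simp [hl v hv, hl a ha, hl b hb]
  · exact (conf_congr e).1 h.conf
  · exact (conf_congr e).2 h.conf

theorem pairCount_ofFun_le {n : ℕ} {A : ℕ → ℕ → Bool} {D : ℕ → ℕ → ℕ → Bool} {s t hs ht hA hA' hD}
    (S : Finset ℕ) : pairCount (ofFun n A D s t hs ht hA hA' hD).adjB S ≤ pairCount A S := by
  refine pairCount_mono fun a _ b _ h => ?_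
  rw [adjB_ofFun, Bool.and_eq_true] at h
  exact h.2

theorem Sparse.ofFun {n : ℕ} {A : ℕ → ℕ → Bool} {D : ℕ → ℕ → ℕ → Bool} {s t hs ht hA hA' hD}
    {k : ℕ} (h : Sparse A k) : Sparse (ofFun n A D s t hs ht hA hA' hD).adjB k := fun S hS =>
  (Nat.add_le_add_right (pairCount_ofFun_le S) 2).trans (h S hS)

theorem isPendant_iff (x : Instance) (v : ℕ) : isPendant x.toRaw v ↔
    v ≠ x.s ∧ v ≠ x.t ∧ ∃ i, x.adjB v i ∧ ∀ j, x.adjB v j → j = i := by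
  simp only [isPendant, src_toRaw, tgt_toRaw, order_toRaw, adj_toRaw, Bool.and_eq_true,
    Bool.not_eq_true', List.any_eq_true, List.mem_range, List.all_eq_true,
    Bool.or_eq_true, beq_iff_eq, and_assoc, ← Bool.not_eq_true, ← imp_iff_not_or]
  refine and_congr_right fun _ => and_congr_right fun _ => ⟨?_, ?_⟩
  · rintro ⟨i, -, h₁, h₂⟩
    exact ⟨i, h₁, fun j hj => h₂ j (adjB_lt hj).2 hj⟩
  · rintro ⟨i, h₁, h₂⟩
    exact ⟨i, (adjB_lt h₁).2, h₁, fun j _ hj => h₂ j hj⟩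

theorem isContractible_iff (x : Instance) (a b c : ℕ) : isContractible x.toRaw (a, b, c) ↔
    x.adjB a b ∧ x.adjB b c ∧ c ≠ a ∧ (a ≠ x.s ∧ a ≠ x.t ∧ b ≠ x.s ∧ b ≠ x.t) ∧
      (∀ z, x.adjB b z → z = a ∨ z = c) ∧ ∃ u < x.n, ∀ z, x.adjB a z → z = b ∨ z = u := by
  simp only [isContractible, src_toRaw, tgt_toRaw, order_toRaw, adj_toRaw, Bool.and_eq_true,
    Bool.not_eq_true', List.any_eq_true, List.mem_range, List.all_eq_true,
    Bool.or_eq_true, beq_iff_eq, and_assoc, ← Bool.not_eq_true, ← imp_iff_not_or]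
  have e : ∀ {b : ℕ} {p : ℕ → Prop}, (∀ z < x.n, x.adjB b z → p z) ↔ ∀ z, x.adjB b z → p z :=
    ⟨fun h z hz => h z (adjB_lt hz).2 hz, fun h z _ hz => h z hz⟩
  simp only [e]

theorem exists_deletePendant (x : Instance) {v : ℕ} (h : isPendant x.toRaw v) :
    ∃ x' : Instance, deletePendant x.toRaw v = x'.toRaw ∧ Reduces x x' ∧ x'.total < x.total := by
  obtain ⟨hs, ht, i, hi, hv⟩ := (x.isPendant_iff v).1 h
  set A : ℕ → ℕ → Bool := fun a b => !(a == v) && !(b == v) && x.adjB a b with hA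
  set D : ℕ → ℕ → ℕ → Bool := fun c a b => A a b && x.delB c a b with hD
  have hA' : ∀ a b, A a b ↔ a ≠ v ∧ b ≠ v ∧ x.adjB a b := by
    intro a b; simp [hA, and_assoc]
  have hsymm : ∀ a b, A a b = A b a := by
    intro a b
    rw [Bool.eq_iff_iff, hA', hA', x.adjB_symm a b]
    tauto
  have hDsymm : ∀ c a b, D c a b = D c b a := by
    intro c a b
    simp only [hD, hsymm a b, x.delB_symm c a b]
  have hself : ∀ a, A a a = false := by
    intro a
    simp [hA, x.adjB_self]
  have hDA : ∀ c a b, D c a b → A a b := by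
    intro c a b h
    exact (Bool.and_eq_true _ _ ▸ h).1
  have hle : ∀ S, pairCount A S ≤ pairCount x.adjB S := fun S =>
    pairCount_mono fun a _ b _ h => ((hA' a b).1 h).2.2
  refine ⟨ofFun x.n A D x.s x.t x.s.2 x.t.2 hsymm hself hDA, ?_, ⟨?_, ?_⟩, ?_⟩
  · rw [toRaw_ofFun hDsymm, deletePendant, adj_toRaw, del_toRaw]
    rfl
  · rw [isYes_ofFun hDsymm fun a b h => adjB_lt ((hA' a b).1 h).2.2, isYes_iff]
    simp only [hD, Bool.and_eq_true]
    -- The restriction of the deletion sets to surviving edges is discarded here.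
    rw [hasPath_and_iff]
    simp only [hA']
    exact hasPath_pendant_iff (fun a b h => by rwa [x.adjB_symm]) hs ht
      fun a b ha hb => (hv a ha).trans (hv b hb).symm
  · exact fun k hk => Sparse.ofFun fun S hS => (Nat.add_le_add_right (hle S) 2).trans (hk S hS)
  · refine (pairCount_ofFun_le _).trans_lt (Finset.card_lt_card ?_)
    show (Finset.range x.n ×ˢ Finset.range x.n).filter _ ⊂
      (Finset.range x.n ×ˢ Finset.range x.n).filter _
    rw [Finset.ssubset_iff_of_subset]
    · refine ⟨(v, i), ?_, ?_⟩
      · simp [adjB_lt hi, hi]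
      · simp [hA]
    · intro p hp
      rw [Finset.mem_filter] at hp ⊢
      exact ⟨hp.1, ((hA' _ _).1 hp.2).2.2⟩

theorem exists_contractPath (x : Instance) {c : ℕ × ℕ × ℕ} (h : isContractible x.toRaw c) :
    ∃ x' : Instance, contractPath x.toRaw c = x'.toRaw ∧ Reduces x x' ∧ x'.total < x.total := by
  obtain ⟨a, y, w⟩ := c
  obtain ⟨hay, hyw, hwa, ⟨has, hat, hys, hyt⟩, hy, u, -, ha⟩ := (x.isContractible_iff a y w).1 h
  have hya : y ≠ a := by
    rintro rfl
    simp [x.adjB_self] at hay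
  have hwy : w ≠ y := by
    rintro rfl
    simp [x.adjB_self] at hyw
  set A : ℕ → ℕ → Bool := contractAdjB x.adjB a y w with hA
  set D : ℕ → ℕ → ℕ → Bool := fun v i j => A i j && contractDelB x.delB a y w v i j with hD
  have hsymm : ∀ i j, A i j = A j i := by
    intro i j
    rw [Bool.eq_iff_iff, hA, contractAdjB_iff, contractAdjB_iff, contractAdj, contractAdj,
      x.adjB_symm i j]
    tauto
  have hDsymm : ∀ v i j, D v i j = D v j i := by
    intro v i j
    simp only [hD, hsymm i j]
    congr 1
    rw [Bool.eq_iff_iff, contractDelB_iff, contractDelB_iff]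
    exact contractDel_symm (fun v i j => by rw [x.delB_symm]) v i j
  have hself : ∀ i, A i i = false := by
    intro i
    rw [← Bool.not_eq_true, hA, contractAdjB_iff, contractAdj, x.adjB_self]
    rintro ⟨-, -, h | h | h⟩
    · simp at h
    · exact hwa (h.2.symm.trans h.1)
    · exact hwa (h.1.symm.trans h.2)
  have hDA : ∀ v i j, D v i j → A i j := by
    intro v i j h
    exact (Bool.and_eq_true _ _ ▸ h).1
  have hlt : ∀ i j, A i j → i < x.n ∧ j < x.n := by
    intro i j h
    rw [hA, contractAdjB_iff] at h
    rcases h.2.2 with h | ⟨rfl, rfl⟩ | ⟨rfl, rfl⟩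
    · exact adjB_lt h
    · exact ⟨(adjB_lt hay).1, (adjB_lt hyw).2⟩
    · exact ⟨(adjB_lt hyw).2, (adjB_lt hay).1⟩
  refine ⟨ofFun x.n A D x.s x.t x.s.2 x.t.2 hsymm hself hDA, ?_, ⟨?_, ?_⟩, ?_⟩
  · rw [toRaw_ofFun hDsymm, contractPath, adj_toRaw, del_toRaw]
    rfl
  · rw [isYes_ofFun hDsymm hlt, isYes_iff]
    simp only [hD, Bool.and_eq_true]
    rw [hasPath_and_iff]
    simp only [hA, contractAdjB_iff, contractDelB_iff]
    exact hasPath_contract_iff (fun v i j => by rw [x.delB_symm]) (fun i j h => by rwa [x.adjB_symm])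
      hay hyw hya hwa hwy has hat hys hyt hy ha
  · exact fun k hk => Sparse.ofFun (hk.contract x.adjB_symm hay hyw hya hwa hwy)
  · refine (pairCount_ofFun_le _).trans_lt ?_
    have := pairCount_contract_add_two_le x.adjB_symm hay hyw hya hwa hwy
      (S := Finset.range x.n) (by simpa using (adjB_lt hay).1) (by simpa using (adjB_lt hyw).2)
    rw [Finset.insert_eq_of_mem (by simpa using (adjB_lt hay).2), ← hA] at this
    show pairCount A (Finset.range x.n) < pairCount x.adjB (Finset.range x.n)
    omega

/-- No reduction rule applies. -/
def Irreducible (x : Instance) : Prop :=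
  (List.range x.toRaw.order).filter (isPendant x.toRaw) = [] ∧
    (triples x.toRaw).filter (isContractible x.toRaw) = []

theorem exists_reduceRound (x : Instance) :
    ∃ x' : Instance, reduceRound x.toRaw = x'.toRaw ∧ Reduces x x' ∧
      (x.Irreducible ∧ x' = x ∨ ¬ x.Irreducible ∧ x'.total < x.total) := by
  obtain ⟨x₁, h₁, h₂, h₃⟩ : ∃ x₁ : Instance, pendantStep x.toRaw = x₁.toRaw ∧ Reduces x x₁ ∧
      ((List.range x.toRaw.order).filter (isPendant x.toRaw) = [] ∧ x₁ = x ∨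
        (List.range x.toRaw.order).filter (isPendant x.toRaw) ≠ [] ∧ x₁.total < x.total) := by
    by_cases hl : (List.range x.toRaw.order).filter (isPendant x.toRaw) = []
    · exact ⟨x, ruleStep_of_nil hl, .refl x, Or.inl ⟨hl, rfl⟩⟩
    · obtain ⟨c, -, hc, hc'⟩ := ruleStep_of_ne_nil (cands := fun r => List.range r.order)
        (act := deletePendant) (d := 0) hl
      obtain ⟨x₁, h₁, h₂, h₃⟩ := x.exists_deletePendant hc
      exact ⟨x₁, hc'.trans h₁, h₂, Or.inr ⟨hl, h₃⟩⟩
  obtain ⟨x₂, h₄, h₅, h₆⟩ : ∃ x₂ : Instance, contractStep x₁.toRaw = x₂.toRaw ∧ Reduces x₁ x₂ ∧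
      ((triples x₁.toRaw).filter (isContractible x₁.toRaw) = [] ∧ x₂ = x₁ ∨
        (triples x₁.toRaw).filter (isContractible x₁.toRaw) ≠ [] ∧ x₂.total < x₁.total) := by
    by_cases hl : (triples x₁.toRaw).filter (isContractible x₁.toRaw) = []
    · exact ⟨x₁, ruleStep_of_nil hl, .refl x₁, Or.inl ⟨hl, rfl⟩⟩
    · obtain ⟨c, -, hc, hc'⟩ := ruleStep_of_ne_nil (act := contractPath) (d := (0, 0, 0)) hl
      obtain ⟨x₂, h₁, h₂, h₃⟩ := x₁.exists_contractPath hc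
      exact ⟨x₂, hc'.trans h₁, h₂, Or.inr ⟨hl, h₃⟩⟩
  refine ⟨x₂, by rw [reduceRound, h₁, h₄], h₂.trans h₅, ?_⟩
  rcases h₃ with ⟨h₃, rfl⟩ | ⟨h₃, h₃'⟩
  · rcases h₆ with ⟨h₆, rfl⟩ | ⟨h₆, h₆'⟩
    · exact Or.inl ⟨⟨h₃, h₆⟩, rfl⟩
    · exact Or.inr ⟨fun h => h₆ h.2, h₆'⟩
  · refine Or.inr ⟨fun h => h₃ h.1, ?_⟩
    rcases h₆ with ⟨-, rfl⟩ | ⟨-, h₆'⟩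
    · exact h₃'
    · omega

/-- The potential `total` drops by at least one in each round until the instance is irreducible;
from then on rounds change nothing. -/
theorem exists_iterate_reduceRound (x : Instance) (m : ℕ) :
    ∃ x' : Instance, reduceRound^[m] x.toRaw = x'.toRaw ∧ Reduces x x' ∧
      (x'.Irreducible ∨ x'.total + m ≤ x.total) := by
  induction m with
  | zero => exact ⟨x, rfl, .refl x, Or.inr le_rfl⟩
  | succ m ih =>
    obtain ⟨x₁, h₁, h₂, h₃⟩ := ih
    obtain ⟨x₂, h₄, h₅, h₆⟩ := x₁.exists_reduceRound
    refine ⟨x₂, by rw [Function.iterate_succ_apply', h₁, h₄], h₂.trans h₅, ?_⟩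
    rcases h₆ with ⟨h₆, rfl⟩ | ⟨h₆, h₆'⟩
    · exact Or.inl h₆
    · have := h₃.resolve_left h₆
      right
      omega

theorem exists_reduce (x : Instance) : ∃ x' : Instance,
    reduceRound^[numRounds x.toRaw] x.toRaw = x'.toRaw ∧ Reduces x x' ∧ x'.Irreducible := by
  obtain ⟨x', h₁, h₂, h₃⟩ := x.exists_iterate_reduceRound (numRounds x.toRaw)
  refine ⟨x', h₁, h₂, h₃.resolve_right ?_⟩
  rw [numRounds_eq, order_toRaw]
  have := x.total_lt
  omega

end Instance

/-- The vertex `v` has a neighbour. -/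
def hasNeighbor (r : Raw) (v : ℕ) : Bool := (List.range r.order).any fun i => r.adj v i

/-- The vertices kept in the end: `s`, `t`, and, unless the answer is obvious, all vertices that have
neighbours. -/
def fenKeep (r : Raw) (v : ℕ) : Bool :=
  v == r.src || v == r.tgt || (!(r.src == r.tgt) && hasNeighbor r r.src && hasNeighbor r r.tgt &&
    hasNeighbor r v)

/-! ### Correctness and size of the final restriction. -/

namespace Instance

theorem hasNeighbor_iff (x : Instance) (v : ℕ) : hasNeighbor x.toRaw v ↔ ∃ i, x.adjB v i := by
  simp only [hasNeighbor, order_toRaw, adj_toRaw, List.any_eq_true, List.mem_range]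
  exact exists_congr fun i => ⟨And.right, fun h => ⟨(adjB_lt h).2, h⟩⟩

theorem fenKeep_iff (x : Instance) (v : ℕ) : fenKeep x.toRaw v ↔ v = x.s ∨ v = x.t ∨
    ((x.s : ℕ) ≠ x.t ∧ (∃ i, x.adjB x.s i) ∧ (∃ i, x.adjB x.t i) ∧ ∃ i, x.adjB v i) := by
  simp only [fenKeep, src_toRaw, tgt_toRaw, Bool.or_eq_true, Bool.and_eq_true, beq_iff_eq,
    Bool.not_eq_true', beq_eq_false_iff_ne, hasNeighbor_iff, or_assoc, and_assoc]

/-- If s = t, the path with one vertex survives. If not, any path shows that s, t and all of its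
vertices have neighbours, so it is kept entirely. -/
theorem isYes_sub_fenKeep (x : Instance) (hs : fenKeep x.toRaw x.s) (ht : fenKeep x.toRaw x.t) :
    (x.sub _ hs ht).IsYes ↔ x.IsYes := by
  rw [isYes_sub, isYes_iff]
  constructor
  · rintro ⟨l, hl, -⟩
    exact ⟨l, hl⟩
  rintro ⟨l, hl⟩
  by_cases hst : (x.s : ℕ) = x.t
  · refine ⟨[x.s.1], ?_, by simpa using hs⟩
    have := isPathList_singleton (fun i j => (x.adjB i j : Prop)) (fun v i j => (x.delB v i j : Prop))
      x.s.1
    rwa [← hst]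
  refine ⟨l, hl, fun v hv => (x.fenKeep_iff v).2 ?_⟩
  have hsn : ∃ i, x.adjB x.s i := by
    rcases l with - | ⟨a, - | ⟨b, l⟩⟩
    · simpa using hl.head
    · exact absurd (by simpa using hl.head.symm.trans hl.last) hst
    · obtain rfl : a = x.s := by simpa using hl.head
      exact ⟨b, (List.isChain_cons_cons.1 hl.chain).1⟩
  have hpred : ∀ v ∈ l, v ≠ x.s → ∃ i, x.adjB v i := by
    intro v hv hvs
    obtain ⟨u, hu⟩ := (hl.eq_or_exists hv).resolve_left hvs
    exact ⟨u, by rw [x.adjB_symm]; exact hu⟩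
  by_cases hvs : v = x.s
  · exact Or.inl hvs
  · exact Or.inr (Or.inr ⟨hst, hsn, hpred _ (List.mem_of_getLast? hl.last) (Ne.symm hst),
      hpred v hv hvs⟩)

/-- One orientation is chosen for every edge; a factor of two is given away. -/
theorem numEdges_sub_le (x : Instance) {K : ℕ → Bool} (hs : K x.s) (ht : K x.t) :
    (x.sub K hs ht).numEdges ≤ pairCount x.adjB ((Finset.range x.n).filter fun v => K v) := by
  rw [numEdges, pairCount, ← Set.ncard_coe_finset]
  refine Set.ncard_le_ncard_of_injOn
    (fun e => ((x.subEmb hs ht e.out.1 : ℕ), (x.subEmb hs ht e.out.2 : ℕ))) ?_ ?_ (Set.toFinite _)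
  · intro e he
    have hK : ∀ i, (x.subEmb hs ht i : ℕ) < x.n ∧ K (x.subEmb hs ht i) := fun i =>
      (x.exists_subEmb_iff hs ht _).1 ⟨i, rfl⟩
    have he' : s(e.out.1, e.out.2) = e := Quot.out_eq e
    rw [← he', SimpleGraph.mem_edgeSet, adj_sub, ← adjB_val] at he
    simp only [Finset.coe_filter, Set.mem_ofPred_eq, Finset.mem_product, Finset.mem_filter,
      Finset.mem_range]
    exact ⟨⟨hK _, hK _⟩, he⟩
  · intro e _ e' _ h
    simp only [Prod.mk.injEq] at h
    have h₁ := x.subEmb_injective hs ht (Fin.val_injective h.1)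
    have h₂ := x.subEmb_injective hs ht (Fin.val_injective h.2)
    rw [← Quot.out_eq e, ← Quot.out_eq e']
    exact congrArg _ (Prod.ext h₁ h₂)

/-- Unless only s and t are kept, all neighbours of kept vertices are kept, so degrees within the
kept set are true degrees. Irreducibility then says that inner vertices have at least two neighbours
and that no two inner vertices of degree two are adjacent. -/
theorem card_fenKeep_le (x : Instance) (hx : x.Irreducible) {k : ℕ} (hk : Sparse x.adjB k) :
    ((Finset.range x.n).filter fun v => fenKeep x.toRaw v).card ≤ 5 * k + 3 := by
  set S := (Finset.range x.n).filter fun v => fenKeep x.toRaw v with hS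
  have hpend : ∀ v, ¬ isPendant x.toRaw v := by
    intro v h
    have hlt : v < x.n := by
      obtain ⟨-, -, i, hi, -⟩ := (x.isPendant_iff v).1 h
      exact (adjB_lt hi).1
    exact List.filter_eq_nil_iff.1 hx.1 v (by simpa using hlt) h
  have hcon : ∀ a b c, ¬ isContractible x.toRaw (a, b, c) := by
    intro a b c h
    obtain ⟨h₁, h₂, -⟩ := (x.isContractible_iff a b c).1 h
    exact List.filter_eq_nil_iff.1 hx.2 (a, b, c)
      (mem_triples.2 ⟨(adjB_lt h₁).1, (adjB_lt h₁).2, (adjB_lt h₂).2⟩) h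
  by_cases hdeg : (x.s : ℕ) ≠ x.t ∧ (∃ i, x.adjB x.s i) ∧ ∃ i, x.adjB x.t i
  · obtain ⟨hst, hsn, htn⟩ := hdeg
    have hmem : ∀ {v i}, x.adjB v i → i ∈ S := by
      intro v i h
      rw [hS, Finset.mem_filter, fenKeep_iff, Finset.mem_range]
      exact ⟨(adjB_lt h).2, Or.inr (Or.inr ⟨hst, hsn, htn, v, by rwa [x.adjB_symm]⟩)⟩
    refine hk.card_le x.adjB_symm hst ?_ ?_ ?_ ?_ ?_ ?_
    · simp [hS, fenKeep_iff]
    · simp [hS, fenKeep_iff]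
    · obtain ⟨i, hi⟩ := hsn; exact ⟨i, hmem hi, hi⟩
    · obtain ⟨i, hi⟩ := htn; exact ⟨i, hmem hi, hi⟩
    · intro v hv hvs hvt
      rw [hS, Finset.mem_filter, fenKeep_iff] at hv
      obtain ⟨i, hi⟩ := ((hv.2.resolve_left hvs).resolve_left hvt).2.2.2
      by_contra hno
      refine hpend v ((x.isPendant_iff v).2 ⟨hvs, hvt, i, hi, fun j hj => ?_⟩)
      by_contra hne
      exact hno ⟨j, hmem hj, i, hmem hi, hj, hi, hne⟩
    · intro v hv v' hv' hvs hvt hvs' hvt' hadj hc hc'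
      rw [Finset.card_eq_two] at hc hc'
      obtain ⟨p, q, hpq, hc⟩ := hc
      obtain ⟨p', q', hpq', hc'⟩ := hc'
      have e : ∀ z, x.adjB v z ↔ z = p ∨ z = q := by
        intro z
        have : z ∈ S.filter (fun a => x.adjB v a) ↔ z ∈ ({p, q} : Finset ℕ) := by rw [hc]
        simp only [Finset.mem_filter, Finset.mem_insert, Finset.mem_singleton] at this
        rw [← this]
        exact ⟨fun h => ⟨hmem h, h⟩, And.right⟩
      have e' : ∀ z, x.adjB v' z ↔ z = p' ∨ z = q' := by
        intro z
        have : z ∈ S.filter (fun a => x.adjB v' a) ↔ z ∈ ({p', q'} : Finset ℕ) := by rw [hc']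
        simp only [Finset.mem_filter, Finset.mem_insert, Finset.mem_singleton] at this
        rw [← this]
        exact ⟨fun h => ⟨hmem h, h⟩, And.right⟩
      have hadj' : x.adjB v' v := by rwa [x.adjB_symm]
      obtain ⟨u, hu⟩ : ∃ u, x.adjB v u ∧ ∀ z, x.adjB v z → z = v' ∨ z = u := by
        rcases (e v').1 hadj with rfl | rfl
        · exact ⟨q, (e q).2 (Or.inr rfl), fun z hz => (e z).1 hz⟩
        · exact ⟨p, (e p).2 (Or.inl rfl), fun z hz => ((e z).1 hz).symm⟩
      obtain ⟨w, hw₁, hw₂, hw₃⟩ : ∃ w, x.adjB v' w ∧ w ≠ v ∧ ∀ z, x.adjB v' z → z = v ∨ z = w := by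
        rcases (e' v).1 hadj' with rfl | rfl
        · exact ⟨q', (e' q').2 (Or.inr rfl), hpq'.symm, fun z hz => (e' z).1 hz⟩
        · exact ⟨p', (e' p').2 (Or.inl rfl), hpq', fun z hz => ((e' z).1 hz).symm⟩
      exact hcon v v' w ((x.isContractible_iff v v' w).2 ⟨hadj, hw₁, hw₂, ⟨hvs, hvt, hvs', hvt'⟩,
        hw₃, u, (adjB_lt hu.1).2, hu.2⟩)
  · have hsub : S ⊆ {x.s.1, x.t.1} := by
      intro v hv
      rw [hS, Finset.mem_filter, fenKeep_iff] at hv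
      simp only [Finset.mem_insert, Finset.mem_singleton]
      tauto
    have h₁ := Finset.card_le_card hsub
    have h₂ : ({x.s.1, x.t.1} : Finset ℕ).card ≤ 2 := Finset.card_le_two
    omega

end Instance

theorem hasKernel_fen : HasKernel (fun _ => True) Instance.fen (fun k => 8 * k + 4)
    (fun k => 12 * k + 12) := by
  refine hasKernel_of_polyFn 8
    (fun r => subRaw (reduceRound^[numRounds r] r) (fenKeep (reduceRound^[numRounds r] r))) ?_
    Instance.fen_le (fun k => by omega) ?_
  · have h : PolyFn (fun r => subRaw r (fenKeep r)) := by
      refine PolyFn.subRaw (by fun_prop) ?_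
      unfold fenKeep hasNeighbor
      fun_prop
    exact h.comp polyFn_reduce
  intro x _
  obtain ⟨y, h₁, h₂, h₃⟩ := x.exists_reduce
  have hs : fenKeep y.toRaw y.s := (y.fenKeep_iff _).2 (Or.inl rfl)
  have ht : fenKeep y.toRaw y.t := (y.fenKeep_iff _).2 (Or.inr (Or.inl rfl))
  have hsp := h₂.sparse _ x.sparse
  have hcard := y.card_fenKeep_le h₃ hsp
  refine ⟨y.sub _ hs ht, by rw [h₁, Instance.toRaw_sub], trivial,
    (y.isYes_sub_fenKeep hs ht).trans h₂.isYes, ?_, ?_⟩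
  · rw [Instance.n_sub]
    omega
  -- By sparsity there are at most 2(5k + 3) + 2k - 2 = 12k + 4 ordered pairs.
  · have h₄ := y.numEdges_sub_le hs ht
    have h₅ := hsp ((Finset.range y.n).filter fun v => fenKeep y.toRaw v)
      ⟨y.s, Finset.mem_filter.2 ⟨by simp, hs⟩⟩
    omega

end SelfDeleting

theorem mainTheorem11 :
    -- a) a kernel with at most `8 fen + 4` vertices and `O(fen)` edges
    (∃ a : ℕ, SelfDeleting.HasKernel (fun _ => True) SelfDeleting.Instance.fen
      (fun k => 8 * k + 4) (fun k => a * k + a)) ∧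
    -- b) a kernel with `O(vcn)` vertices and edges on outerplanar graphs
    (∃ a : ℕ, SelfDeleting.HasKernel (fun x => SelfDeleting.IsOuterplanar x.G)
      SelfDeleting.Instance.vcn (fun k => a * k + a) (fun k => a * k + a)) ∧
    -- c) a Turing kernel with `O(μ)` vertices on cliques
    (∃ a : ℕ, SelfDeleting.HasTuringKernel (fun x => x.G = ⊤)
      SelfDeleting.Instance.mu (fun k => a * k + a)) := by
  exact ⟨⟨12, SelfDeleting.hasKernel_fen⟩, ⟨8, SelfDeleting.hasKernel_outerplanar⟩,
    ⟨3, SelfDeleting.hasTuringKernel_clique⟩⟩
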